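/- Let $\mathbb{k}$ be an algebraically closed field of characteristic $0$, let $G=\mathbb{Z}_2\times\mathbb{Z}_2\times\mathbb{Z}_2=\langle g_1\rangle\times\langle g_2\rangle\times\langle g_3\rangle$, and let $\Phi$ be the normalized $3$-cocycle on $G$ given by $$\Phi(g_1^{i_1}g_2^{i_2}g_3^{i_3},\,g_1^{j_1}g_2^{j_2}g_3^{j_3},\,g_1^{k_1}g_2^{k_2}g_3^{k_3})=(-1)^{i_3j_2k_1},\qquad i_s,j_s,k_s\in\{0,1\}.$$ The category ${}^{\mathbb{k}G}_{\mathbb{k}G}\mathcal{YD}^{\Phi}$ of twisted Yetter–Drinfeld modules: an object is a $G$-graded vector space $V=\bigoplus_{g}V_g$ with linear maps $e\triangleright$ ($e\in G$) preserving the grading, with $1\triangleright v=v$ and $e\triangleright(f\triangleright v)=\widetilde\Phi_g(e,f)\,(ef)\triangleright v$ for $v\in V_g$, where $\widetilde\Phi_g(x,y)=\Phi(g,x,y)\Phi(x,y,g)/\Phi(x,g,y)$. For $X\in U_e$, $Y\in V_f$, $Z\in W_g$ and $h\in G$, the tensor product has $\deg(X\otimes Y)=ef$ and $h\triangleright(X\otimes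 Y)=\widetilde\Phi_h(e,f)\,(h\triangleright X)\otimes(h\triangleright Y)$, the associativity constraint is $(X\otimes Y)\otimes Z\mapsto\Phi(e,f,g)^{-1}X\otimes(Y\otimes Z)$, and the braiding is $X\otimes Y\mapsto(e\triangleright Y)\otimes X$. The cocycle $\Phi$ is called abelian if all simple objects are one-dimensional. The tensor algebra $T_\Phi(V)=\bigoplus_{n\ge0}(\cdots(V\otimes V)\otimes\cdots)\otimes V$ is a graded Hopf algebra in this braided category, with $\Delta(X)=X\otimes1+1\otimes X$, $\varepsilon(X)=0$ and $S(X)=-X$ for $X\in V$, and the Nichols algebra is $B(V)=T_\Phi(V)/I$, where $I$ is the largest graded Hopf ideal (in the category) generated by homogeneous elements of degree at least $2$. The same definitions are used for any finite abelian group and any normalized $3$-cocycle on it; for the trivial cocycle one speaks of usual Nichols algebras. Let $V_1=\mathbb{k}\{X_1,X_2\}$, $V_2=\mathbb{k}\{Y_1,Y_2\}$, $V_3=\mathbb{k}\{Z_1,Z_2\}$ be the objects of degree $g_1$, $g_2$, $g_3$, respectively, with - $g_1\triangleright X_1=-X_1$, $g_1\triangleright X_2=-X_2$, $g_2\triangleright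 X_1=X_1$, $g_2\triangleright X_2=-X_2$, $g_3\triangleright X_1=X_2$, $g_3\triangleright X_2=X_1$; - $g_1\triangleright Y_1=Y_1$, $g_1\triangleright Y_2=-Y_2$, $g_2\triangleright Y_1=-Y_1$, $g_2\triangleright Y_2=-Y_2$, $g_3\triangleright Y_1=Y_2$, $g_3\triangleright Y_2=Y_1$; - $g_1\triangleright Z_1=Z_2$, $g_1\triangleright Z_2=Z_1$, $g_2\triangleright Z_1=Z_1$, $g_2\triangleright Z_2=-Z_2$, $g_3\triangleright Z_1=-Z_1$, $g_3\triangleright Z_2=-Z_2$ (the other group elements act by $g_1^ag_2^bg_3^c\triangleright v=g_1^a\triangleright(g_2^b\triangleright(g_3^c\triangleright v))$ for $a,b,c\in\{0,1\}$, as the axioms force). Then $\Phi$ is not abelian, and $V_1,V_2,V_3$ are simple objects. The Nichols algebras $B(V_1\oplus V_2)$, $B(V_1\oplus V_3)$ and $B(V_2\oplus V_3)$ are finite-dimensional. Moreover, each of these three Nichols algebras $B(V)$ is twist equivalent to a usual Nichols algebra $B(W)$ of diagonal type whose generalized Dynkin diagram consists of two disjoint copies of the diagram of type $A_2$ at $-1$.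 That is, there are a finite abelian group $H$, a Yetter–Drinfeld module $W$ over $\mathbb{k}H$ (trivial cocycle) with a basis $w_1,\dots,w_4$, $w_i$ of degree $h_i\in H$, such that every line $\mathbb{k}w_i$ is stable under $H$, and $h_i\triangleright w_j=q_{ij}w_j$ with $$q_{ii}=-1,\qquad q_{12}q_{21}=q_{34}q_{43}=-1,\qquad q_{ij}q_{ji}=1\ \text{ for all other pairs } i\ne j,$$ a map $J:H\times H\to\mathbb{k}^\times$ with $J(1,h)=J(h,1)=1$, and a linear isomorphism $F:B(V)\to B(W)$ that maps $V$ onto $W$ and satisfies $$F(ab)=F(a)\circ_J F(b),\qquad (F\otimes F)\Delta(a)=\Delta_J(F(a))$$ for all $a,b\in B(V)$, where $X\circ_J Y=J(x,y)\,XY$ for $X$, $Y$ homogeneous of $H$-degrees $x$, $y$, and $\Delta_J$ is $\Delta$ followed by $Y\otimes Z\mapsto J(y,z)^{-1}\,Y\otimes Z$ ($Y$, $Z$ homogeneous of $H$-degrees $y$, $z$). -/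

import Mathlib

open scoped TensorProduct DirectSum

universe u v w

noncomputable section

namespace TwistedNichols

/-- A normalized `3`-cocycle on the abelian group `G` with values in `kˣ`. -/
structure ThreeCocycle (k : Type u) [Field k] (G : Type v) [CommGroup G] where
  toFun : G → G → G → kˣ
  cocycle : ∀ e f g h : G,
    toFun (e * f) g h * toFun e f (g * h) = toFun e f g * toFun e (f * g) h * toFun f g h
  normalized : ∀ f g : G, toFun f 1 g = 1

section General

variable {k : Type u} [Field k] {G : Type v} [CommGroup G]

instance : CoeFun (ThreeCocycle k G) (fun _ => G → G → G → kˣ) := ⟨ThreeCocycle.toFun⟩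

/-- The trivial `3`-cocycle; it gives the usual Yetter-Drinfeld modules. -/
def ThreeCocycle.trivial (k : Type u) [Field k] (G : Type v) [CommGroup G] :
    ThreeCocycle k G where
  toFun _ _ _ := 1
  cocycle _ _ _ _ := by simp
  normalized _ _ := rfl

/-- The `2`-cocycle `Φ̃_g(x, y) = Φ(g, x, y) Φ(x, y, g) / Φ(x, g, y)`. -/
def ThreeCocycle.slant (Φ : ThreeCocycle k G) (g x y : G) : kˣ :=
  Φ g x y * Φ x y g / Φ x g y

theorem ThreeCocycle.one_left (Φ : ThreeCocycle k G) (g h : G) : Φ 1 g h = 1 := by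
  have := Φ.cocycle 1 1 g h
  simpa [Φ.normalized] using this

theorem ThreeCocycle.one_right (Φ : ThreeCocycle k G) (g h : G) : Φ g h 1 = 1 := by
  have := Φ.cocycle g h 1 1
  simpa [Φ.normalized] using this

theorem ThreeCocycle.slant_one (Φ : ThreeCocycle k G) (x y : G) : Φ.slant 1 x y = 1 := by
  simp [slant, Φ.one_left, Φ.one_right, Φ.normalized]

theorem ThreeCocycle.slant_mul (Φ : ThreeCocycle k G) (e f g h : G) :
    Φ.slant e g h * Φ.slant f g h * (Φ.slant g e f * Φ.slant h e f) =
      Φ.slant (g * h) e f * Φ.slant (e * f) g h := by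
  have h1 := Φ.cocycle g h e f
  have h2 := Φ.cocycle g e h f
  have h3 := Φ.cocycle g e f h
  have h4 := Φ.cocycle e g h f
  have h5 := Φ.cocycle e g f h
  have h6 := Φ.cocycle e f g h
  rw [mul_comm h e] at h1
  rw [mul_comm g e, mul_comm h f] at h2
  rw [mul_comm g e] at h3
  rw [mul_comm h f] at h4
  rw [mul_comm g f] at h5
  replace h1 := congrArg Additive.ofMul h1
  replace h2 := congrArg Additive.ofMul h2
  replace h3 := congrArg Additive.ofMul h3
  replace h4 := congrArg Additive.ofMul h4
  replace h5 := congrArg Additive.ofMul h5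
  replace h6 := congrArg Additive.ofMul h6
  apply Additive.ofMul.injective
  simp only [slant, ofMul_mul, ofMul_div] at *
  linear_combination (norm := module) h2 - h1 - h3 - h4 + h5 - h6

variable [Fintype G] [DecidableEq G]

/-- A twisted Yetter-Drinfeld module over `(kG, Φ)`: a `G`-graded vector space, the grading
`V = ⨁ V_g` being given by the projections `proj g` onto the components `V_g`, such that every
`V_g` is a projective `G`-representation with respect to the `2`-cocycle `Φ̃_g`. -/
structure TwistedYD (Φ : ThreeCocycle k G) where
  carrier : Type u
  [addCommGroup : AddCommGroup carrier]
  [module : Module k carrier]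
  proj : G → carrier →ₗ[k] carrier
  act : G → carrier →ₗ[k] carrier
  proj_proj : ∀ (g h : G) (x : carrier), proj g (proj h x) = if g = h then proj h x else 0
  sum_proj : ∀ x : carrier, ∑ g, proj g x = x
  act_proj : ∀ (e g : G) (x : carrier), act e (proj g x) = proj g (act e x)
  act_one : ∀ x : carrier, act 1 x = x
  act_act : ∀ (e f g : G) (x : carrier),
    act e (act f (proj g x)) = (Φ.slant g e f : k) • act (e * f) (proj g x)

namespace TwistedYD

variable {Φ : ThreeCocycle k G}

instance : CoeSort (TwistedYD Φ) (Type u) := ⟨TwistedYD.carrier⟩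

instance (V : TwistedYD Φ) : AddCommGroup V := V.addCommGroup

instance (V : TwistedYD Φ) : Module k V := V.module

/-- The homogeneous component `V_g`. -/
def homogeneous (V : TwistedYD Φ) (g : G) : Submodule k V := LinearMap.range (V.proj g)

/-- Subobjects: graded subspaces that are stable under the action. -/
structure IsSubobject (V : TwistedYD Φ) (W : Submodule k V) : Prop where
  proj_mem : ∀ (g : G) (x : V), x ∈ W → V.proj g x ∈ W
  act_mem : ∀ (g : G) (x : V), x ∈ W → V.act g x ∈ W

/-- Simple objects. -/
def IsSimple (V : TwistedYD Φ) : Prop :=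
  Nontrivial V ∧ ∀ W : Submodule k V, V.IsSubobject W → W = ⊥ ∨ W = ⊤

/-- The unit object `k`, in degree `1` with trivial action. -/
def unit (Φ : ThreeCocycle k G) : TwistedYD Φ where
  carrier := k
  proj g := if g = 1 then LinearMap.id else 0
  act _ := LinearMap.id
  proj_proj g h x := by
    by_cases h1 : h = 1 <;> by_cases h2 : g = 1 <;> simp [h1, h2, eq_comm]
  sum_proj x := by
    have (g : G) : (if g = 1 then (LinearMap.id : k →ₗ[k] k) else 0) x
      = if g = 1 then x else 0 := by split_ifs <;> rfl
    simp [this]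
  act_proj _ _ _ := rfl
  act_one _ := rfl
  act_act e f g x := by
    by_cases h : g = 1
    · simp [h, Φ.slant_one]
    · simp [h]

/-- The direct sum of two objects. -/
def prod (V W : TwistedYD Φ) : TwistedYD Φ where
  carrier := V × W
  proj g := (V.proj g).prodMap (W.proj g)
  act g := (V.act g).prodMap (W.act g)
  proj_proj g h x := by
    by_cases hg : g = h <;> simp [hg, V.proj_proj, W.proj_proj]
  sum_proj x := by
    ext
    · simp [Prod.fst_sum, V.sum_proj]
    · simp [Prod.snd_sum, W.sum_proj]
  act_proj e g x := by simp [V.act_proj, W.act_proj]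
  act_one x := by simp [V.act_one, W.act_one]
  act_act e f g x := by simp [V.act_act, W.act_act]

/-- The direct sum of a sequence of objects. -/
def directSum (V : ℕ → TwistedYD Φ) : TwistedYD Φ where
  carrier := ⨁ n, V n
  proj g := DirectSum.lmap fun n => (V n).proj g
  act g := DirectSum.lmap fun n => (V n).act g
  proj_proj g h x := by
    ext n
    by_cases hg : g = h <;> simp [hg, (V n).proj_proj]
  sum_proj x := by
    ext n
    rw [DFinsupp.finsetSum_apply]
    simp [(V n).sum_proj]
  act_proj e g x := by ext n; simp [(V n).act_proj]
  act_one x := by ext n; simp [(V n).act_one]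
  act_act e f g x := by
    ext n
    rw [DirectSum.smul_apply]
    simp [(V n).act_act]

theorem tensor_induction {V W : TwistedYD Φ} {p : V ⊗[k] W → Prop} (t : V ⊗[k] W)
    (h : ∀ (a b : G) (x : V) (y : W), p (V.proj a x ⊗ₜ W.proj b y))
    (h0 : p 0) (hadd : ∀ s t, p s → p t → p (s + t)) : p t := by
  have hsum : ∀ {ι : Type v} (s : Finset ι) (F : ι → V ⊗[k] W), (∀ i, p (F i)) →
      p (∑ i ∈ s, F i) := fun s F hF => Finset.sum_induction F p hadd h0 fun i _ => hF i
  induction t using TensorProduct.induction_on with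
  | zero => exact h0
  | tmul x y =>
    rw [← V.sum_proj x, ← W.sum_proj y, TensorProduct.sum_tmul]
    refine hsum _ _ fun a => ?_
    rw [TensorProduct.tmul_sum]
    exact hsum _ _ fun b => h a b x y
  | add s t hs ht => exact hadd s t hs ht

/-- The component of degree `g` of `V ⊗ W` is the sum of the `V_a ⊗ W_b` with `a b = g`. -/
def tensorProj (V W : TwistedYD Φ) (g : G) : V ⊗[k] W →ₗ[k] V ⊗[k] W :=
  ∑ a, TensorProduct.map (V.proj a) (W.proj (a⁻¹ * g))

/-- `e ▷ (X ⊗ Y) = Φ̃_e(g, h) (e ▷ X) ⊗ (e ▷ Y)` for `X ∈ V_g`, `Y ∈ W_h`. -/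
def tensorAct (V W : TwistedYD Φ) (e : G) : V ⊗[k] W →ₗ[k] V ⊗[k] W :=
  ∑ g, ∑ h, (Φ.slant e g h : k) •
    TensorProduct.map (V.act e ∘ₗ V.proj g) (W.act e ∘ₗ W.proj h)

theorem tensorProj_apply (V W : TwistedYD Φ) (g a b : G) (x : V) (y : W) :
    tensorProj V W g (V.proj a x ⊗ₜ W.proj b y) =
      if g = a * b then V.proj a x ⊗ₜ W.proj b y else 0 := by
  simp only [tensorProj, LinearMap.sum_apply, TensorProduct.map_tmul, V.proj_proj, W.proj_proj]
  rw [Finset.sum_eq_single a]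
  · by_cases h : g = a * b <;> simp [h, inv_mul_eq_iff_eq_mul]
  · intro c _ hc; simp [hc]
  · simp

theorem tensorAct_apply (V W : TwistedYD Φ) (e a b : G) (x : V) (y : W) :
    tensorAct V W e (V.proj a x ⊗ₜ W.proj b y) =
      (Φ.slant e a b : k) • (V.proj a (V.act e x) ⊗ₜ W.proj b (W.act e y)) := by
  simp only [tensorAct, LinearMap.sum_apply, LinearMap.smul_apply, TensorProduct.map_tmul,
    LinearMap.comp_apply, V.proj_proj, W.proj_proj]
  rw [Finset.sum_eq_single a, Finset.sum_eq_single b]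
  · simp [V.act_proj, W.act_proj]
  · intro c _ hc; simp [hc]
  · simp
  · intro c _ hc; simp [hc]
  · simp

/-- The tensor product of two objects. -/
def tensor (V W : TwistedYD Φ) : TwistedYD Φ where
  carrier := V ⊗[k] W
  proj := tensorProj V W
  act := tensorAct V W
  proj_proj g h t := by
    induction t using tensor_induction with
    | h a b x y =>
      rw [tensorProj_apply]
      by_cases h1 : h = a * b <;> by_cases h2 : g = h <;> simp_all [tensorProj_apply]
    | h0 => simp
    | hadd s t hs ht => rw [map_add, map_add, hs, ht]; split_ifs <;> simp
  sum_proj t := by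
    induction t using tensor_induction with
    | h a b x y => simp [tensorProj_apply]
    | h0 => simp
    | hadd s t hs ht => simp only [map_add, Finset.sum_add_distrib, hs, ht]
  act_proj e g t := by
    induction t using tensor_induction with
    | h a b x y =>
      rw [tensorProj_apply, tensorAct_apply, map_smul, tensorProj_apply]
      split_ifs <;> simp [tensorAct_apply]
    | h0 => simp
    | hadd s t hs ht => simp only [map_add, hs, ht]
  act_one t := by
    induction t using tensor_induction with
    | h a b x y => simp [tensorAct_apply, Φ.slant_one, V.act_one, W.act_one]
    | h0 => simp
    | hadd s t hs ht => simp only [map_add, hs, ht]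
  act_act e f g t := by
    induction t using tensor_induction with
    | h a b x y =>
      rw [tensorProj_apply]
      split_ifs with h
      · subst h
        rw [tensorAct_apply, map_smul, tensorAct_apply, tensorAct_apply]
        rw [← V.act_proj, ← V.act_proj, ← W.act_proj, ← W.act_proj, V.act_act, W.act_act,
          V.act_proj, W.act_proj, TensorProduct.smul_tmul_smul]
        simp only [smul_smul]
        congr 1
        have := congrArg (fun z : kˣ => (z : k)) (Φ.slant_mul e f a b)
        simp only [Units.val_mul] at this
        rw [← this]; ring
      · simp
    | h0 => simp
    | hadd s t hs ht => simp only [map_add, hs, ht, smul_add]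

/-- The inverse of the associativity constraint:
`X ⊗ (Y ⊗ Z) ↦ Φ(e, f, g) (X ⊗ Y) ⊗ Z` for `X`, `Y`, `Z` of degrees `e`, `f`, `g`. -/
def assocInv (U V W : TwistedYD Φ) : U ⊗[k] (V ⊗[k] W) →ₗ[k] (U ⊗[k] V) ⊗[k] W :=
  ∑ e, ∑ f, ∑ g, (Φ e f g : k) • ((TensorProduct.assoc k U V W).symm.toLinearMap ∘ₗ
    TensorProduct.map (U.proj e) (TensorProduct.map (V.proj f) (W.proj g)))

/-- The associativity constraint:
`(X ⊗ Y) ⊗ Z ↦ Φ(e, f, g)⁻¹ X ⊗ (Y ⊗ Z)` for `X`, `Y`, `Z` of degrees `e`, `f`, `g`. -/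
def assoc (U V W : TwistedYD Φ) : (U ⊗[k] V) ⊗[k] W →ₗ[k] U ⊗[k] (V ⊗[k] W) :=
  ∑ e, ∑ f, ∑ g, ((Φ e f g)⁻¹ : k) • ((TensorProduct.assoc k U V W).toLinearMap ∘ₗ
    TensorProduct.map (TensorProduct.map (U.proj e) (V.proj f)) (W.proj g))

/-- The braiding `X ⊗ Y ↦ (e ▷ Y) ⊗ X` for `X` of degree `e`. -/
def braiding (V W : TwistedYD Φ) : V ⊗[k] W →ₗ[k] W ⊗[k] V :=
  ∑ e, (TensorProduct.comm k V W).toLinearMap ∘ₗ TensorProduct.map (V.proj e) (W.act e)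

/-- The canonical map `(A ⊗ B) ⊗ (C ⊗ D) → (A ⊗ C) ⊗ (B ⊗ D)` of the braided category:
reassociate to `A ⊗ ((B ⊗ C) ⊗ D)`, braid `B` past `C`, and reassociate back. -/
def middleSwap (A B C D : TwistedYD Φ) :
    (A ⊗[k] B) ⊗[k] (C ⊗[k] D) →ₗ[k] (A ⊗[k] C) ⊗[k] (B ⊗[k] D) :=
  assocInv A C (B.tensor D) ∘ₗ
    (assoc C B D).lTensor A ∘ₗ
    ((braiding B C).rTensor D).lTensor A ∘ₗ
    (assocInv B C D).lTensor A ∘ₗ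
    assoc A B (C.tensor D)

/-! The tensor algebra -/

/-- `(⋯((V ⊗ V) ⊗ V) ⋯ ⊗ V)`, with `n` factors. -/
def tensorPow (V : TwistedYD Φ) : ℕ → TwistedYD Φ
  | 0 => unit Φ
  | n + 1 => (tensorPow V n).tensor V

/-- The tensor algebra `T_Φ(V)` as an object. -/
def tensorAlg (V : TwistedYD Φ) : TwistedYD Φ := directSum (tensorPow V)

/-- The inclusion of the `n`-th tensor power in the tensor algebra. -/
def incl (V : TwistedYD Φ) (n : ℕ) : V.tensorPow n →ₗ[k] V.tensorAlg :=
  DirectSum.lof k ℕ (fun n => V.tensorPow n) n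

/-- The component of degree `n` of an element of the tensor algebra. -/
def component (V : TwistedYD Φ) (n : ℕ) : V.tensorAlg →ₗ[k] V.tensorPow n :=
  DirectSum.component k ℕ (fun n => V.tensorPow n) n

/-- The linear map out of the tensor algebra with the given homogeneous parts. -/
def ofComponents (V : TwistedYD Φ) {M : Type w} [AddCommGroup M] [Module k M]
    (F : ∀ n, V.tensorPow n →ₗ[k] M) : V.tensorAlg →ₗ[k] M :=
  DirectSum.toModule k ℕ M F

/-- The unit of the tensor algebra. -/
def one (V : TwistedYD Φ) : V.tensorAlg := V.incl 0 (1 : k)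

/-- The inclusion of `V` in its tensor algebra. -/
def gen (V : TwistedYD Φ) : V →ₗ[k] V.tensorAlg :=
  V.incl 1 ∘ₗ (TensorProduct.lid k V).symm.toLinearMap

/-- The multiplication `V^{⊗ m} ⊗ V^{⊗ n} → V^{⊗ (m + n)}`: the rebracketing given by the
associativity constraint, `x (y ⊗ v) = Φ(|x|, |y|, |v|) (x y) ⊗ v`. -/
def mulPow (V : TwistedYD Φ) (m : ℕ) :
    ∀ n : ℕ, V.tensorPow m ⊗[k] V.tensorPow n →ₗ[k] V.tensorPow (m + n)
  | 0 => (TensorProduct.rid k (V.tensorPow m)).toLinearMap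
  | n + 1 => (mulPow V m n).rTensor V ∘ₗ assocInv (V.tensorPow m) (V.tensorPow n) V

/-- The multiplication of the tensor algebra. -/
def mul (V : TwistedYD Φ) : V.tensorAlg →ₗ[k] V.tensorAlg →ₗ[k] V.tensorAlg :=
  V.ofComponents fun m => LinearMap.flip (V.ofComponents fun n =>
    LinearMap.flip (TensorProduct.curry (V.incl (m + n) ∘ₗ V.mulPow m n)))

/-- The multiplication as a map on the tensor product. -/
def mulTensor (V : TwistedYD Φ) : V.tensorAlg ⊗[k] V.tensorAlg →ₗ[k] V.tensorAlg :=
  TensorProduct.lift V.mul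

/-- The multiplication of the braided tensor product algebra `T_Φ(V) ⊗ T_Φ(V)`. -/
def mulTwo (V : TwistedYD Φ) :
    (V.tensorAlg ⊗[k] V.tensorAlg) ⊗[k] (V.tensorAlg ⊗[k] V.tensorAlg) →ₗ[k]
      V.tensorAlg ⊗[k] V.tensorAlg :=
  TensorProduct.map V.mulTensor V.mulTensor ∘ₗ
    middleSwap V.tensorAlg V.tensorAlg V.tensorAlg V.tensorAlg

/-- `v ↦ v ⊗ 1 + 1 ⊗ v` on generators. -/
def comulGen (V : TwistedYD Φ) : V →ₗ[k] V.tensorAlg ⊗[k] V.tensorAlg :=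
  (TensorProduct.mk k V.tensorAlg V.tensorAlg).flip V.one ∘ₗ V.gen +
    TensorProduct.mk k V.tensorAlg V.tensorAlg V.one ∘ₗ V.gen

/-- The comultiplication on tensor powers: the multiplicative extension of `comulGen`. -/
def comulPow (V : TwistedYD Φ) :
    ∀ n : ℕ, V.tensorPow n →ₗ[k] V.tensorAlg ⊗[k] V.tensorAlg
  | 0 => LinearMap.toSpanSingleton k _ (V.one ⊗ₜ V.one)
  | n + 1 => V.mulTwo ∘ₗ TensorProduct.map (comulPow V n) V.comulGen

/-- The comultiplication of the tensor algebra. -/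
def comul (V : TwistedYD Φ) : V.tensorAlg →ₗ[k] V.tensorAlg ⊗[k] V.tensorAlg :=
  V.ofComponents V.comulPow

/-- The counit of the tensor algebra. -/
def counit (V : TwistedYD Φ) : V.tensorAlg →ₗ[k] k := V.component 0

/-- The antipode on tensor powers: the braided antimultiplicative extension of `v ↦ -v`, that is
`S(x ⊗ v) = (mul ∘ braiding) (S(x) ⊗ S(v))`. -/
def antipodePow (V : TwistedYD Φ) : ∀ n : ℕ, V.tensorPow n →ₗ[k] V.tensorAlg
  | 0 => LinearMap.toSpanSingleton k _ V.one
  | n + 1 => V.mulTensor ∘ₗ braiding V.tensorAlg V.tensorAlg ∘ₗ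
      TensorProduct.map (antipodePow V n) (-V.gen)

/-- The antipode of the tensor algebra. -/
def antipode (V : TwistedYD Φ) : V.tensorAlg →ₗ[k] V.tensorAlg :=
  V.ofComponents V.antipodePow

/-! The Nichols algebra -/

/-- The graded Hopf ideals of `T_Φ(V)` in the category of twisted Yetter-Drinfeld modules that are
generated by homogeneous elements of degree at least `2`. -/
structure IsHopfIdeal (V : TwistedYD Φ) (I : Submodule k V.tensorAlg) : Prop where
  isSubobject : V.tensorAlg.IsSubobject I
  graded : ∀ x ∈ I, ∀ n, V.incl n (V.component n x) ∈ I
  component_zero : ∀ x ∈ I, V.component 0 x = 0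
  component_one : ∀ x ∈ I, V.component 1 x = 0
  mul_left_mem : ∀ y, ∀ x ∈ I, V.mul y x ∈ I
  mul_right_mem : ∀ y, ∀ x ∈ I, V.mul x y ∈ I
  comul_mem : ∀ x ∈ I, V.comul x ∈
    LinearMap.range (I.subtype.rTensor V.tensorAlg) ⊔
      LinearMap.range (I.subtype.lTensor V.tensorAlg)
  counit_eq : ∀ x ∈ I, V.counit x = 0
  antipode_mem : ∀ x ∈ I, V.antipode x ∈ I

/-- The maximal graded Hopf ideal generated by homogeneous elements of degree at least `2`. -/
def nicholsIdeal (V : TwistedYD Φ) : Submodule k V.tensorAlg := sSup {I | V.IsHopfIdeal I}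

theorem range_tensor_mono {M : Type w} [AddCommGroup M] [Module k M] {I J : Submodule k M}
    (h : I ≤ J) :
    LinearMap.range (I.subtype.rTensor M) ⊔ LinearMap.range (I.subtype.lTensor M) ≤
      LinearMap.range (J.subtype.rTensor M) ⊔ LinearMap.range (J.subtype.lTensor M) := by
  refine sup_le_sup ?_ ?_
  · rw [← Submodule.subtype_comp_inclusion I J h, LinearMap.rTensor_comp]
    exact LinearMap.range_comp_le_range _ _
  · rw [← Submodule.subtype_comp_inclusion I J h, LinearMap.lTensor_comp]
    exact LinearMap.range_comp_le_range _ _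

theorem nicholsIdeal_isHopfIdeal (V : TwistedYD Φ) : V.IsHopfIdeal V.nicholsIdeal := by
  have key : ∀ {M : Type u} [AddCommGroup M] [Module k M] (F : V.tensorAlg →ₗ[k] M)
      (N : Submodule k M), (∀ I, V.IsHopfIdeal I → ∀ x ∈ I, F x ∈ N) →
      ∀ x ∈ V.nicholsIdeal, F x ∈ N := by
    intro M _ _ F N h x hx
    have : V.nicholsIdeal ≤ N.comap F := sSup_le fun I hI x hx => h I hI x hx
    exact this hx
  have le : ∀ {I}, V.IsHopfIdeal I → I ≤ V.nicholsIdeal := fun hI => le_sSup hI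
  refine ⟨⟨?_, ?_⟩, ?_, ?_, ?_, ?_, ?_, ?_, ?_, ?_⟩
  · exact fun g => key (V.tensorAlg.proj g) _
      fun I hI x hx => le hI (hI.isSubobject.proj_mem g x hx)
  · exact fun g => key (V.tensorAlg.act g) _
      fun I hI x hx => le hI (hI.isSubobject.act_mem g x hx)
  · exact fun x hx n => key (V.incl n ∘ₗ V.component n) _
      (fun I hI x hx => le hI (hI.graded x hx n)) x hx
  · exact key (V.component 0) ⊥ fun I hI x hx => hI.component_zero x hx
  · exact key (V.component 1) ⊥ fun I hI x hx => hI.component_one x hx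
  · exact fun y => key (V.mul y) _ fun I hI x hx => le hI (hI.mul_left_mem y x hx)
  · exact fun y => key (V.mul.flip y) _ fun I hI x hx => le hI (hI.mul_right_mem y x hx)
  · exact key V.comul _ fun I hI x hx => range_tensor_mono (le hI) (hI.comul_mem x hx)
  · exact key V.counit ⊥ fun I hI x hx => hI.counit_eq x hx
  · exact key V.antipode _ fun I hI x hx => le hI (hI.antipode_mem x hx)

/-- The quotient of an object by a subobject. -/
def quotient (V : TwistedYD Φ) (W : Submodule k V) (h : V.IsSubobject W) : TwistedYD Φ where
  carrier := V ⧸ W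
  proj g := W.mapQ W (V.proj g) (h.proj_mem g)
  act g := W.mapQ W (V.act g) (h.act_mem g)
  proj_proj g h x := by
    induction x using Submodule.Quotient.induction_on with
    | H x =>
      simp only [Submodule.mapQ_apply, V.proj_proj]
      split_ifs <;> simp
  sum_proj x := by
    induction x using Submodule.Quotient.induction_on with
    | H x =>
      have h2 := congrArg W.mkQ (V.sum_proj x)
      rw [map_sum] at h2
      exact h2
  act_proj e g x := by
    induction x using Submodule.Quotient.induction_on with
    | H x => simp only [Submodule.mapQ_apply, V.act_proj]
  act_one x := by
    induction x using Submodule.Quotient.induction_on with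
    | H x => simp only [Submodule.mapQ_apply, V.act_one]
  act_act e f g x := by
    induction x using Submodule.Quotient.induction_on with
    | H x => simp only [Submodule.mapQ_apply, V.act_act, Submodule.Quotient.mk_smul]

/-- The Nichols algebra `B(V) = T_Φ(V) / I`. -/
def nichols (V : TwistedYD Φ) : TwistedYD Φ :=
  V.tensorAlg.quotient V.nicholsIdeal V.nicholsIdeal_isHopfIdeal.isSubobject

/-- The canonical projection `T_Φ(V) → B(V)`. -/
def toNichols (V : TwistedYD Φ) : V.tensorAlg →ₗ[k] V.nichols := V.nicholsIdeal.mkQ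

theorem toNichols_eq_zero (V : TwistedYD Φ) {x : V.tensorAlg} (hx : x ∈ V.nicholsIdeal) :
    V.toNichols x = 0 := (Submodule.Quotient.mk_eq_zero _).2 hx

/-- The multiplication of `B(V)`, induced by that of `T_Φ(V)`. -/
def nicholsMul (V : TwistedYD Φ) : V.nichols →ₗ[k] V.nichols →ₗ[k] V.nichols :=
  V.nicholsIdeal.liftQ
    (LinearMap.flip (V.nicholsIdeal.liftQ (V.mul.compr₂ V.toNichols).flip fun y hy => by
      ext x
      exact V.toNichols_eq_zero (V.nicholsIdeal_isHopfIdeal.mul_left_mem x y hy)))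
    fun x hx => by
      ext y
      obtain ⟨y, rfl⟩ := V.nicholsIdeal.mkQ_surjective y
      exact V.toNichols_eq_zero (V.nicholsIdeal_isHopfIdeal.mul_right_mem y x hx)

/-- The comultiplication of `B(V)`, induced by that of `T_Φ(V)`. -/
def nicholsComul (V : TwistedYD Φ) : V.nichols →ₗ[k] V.nichols ⊗[k] V.nichols :=
  V.nicholsIdeal.liftQ (TensorProduct.map V.toNichols V.toNichols ∘ₗ V.comul) fun x hx => by
    have h : LinearMap.range (V.nicholsIdeal.subtype.rTensor V.tensorAlg) ⊔
        LinearMap.range (V.nicholsIdeal.subtype.lTensor V.tensorAlg) ≤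
        LinearMap.ker (TensorProduct.map V.toNichols V.toNichols) := by
      refine sup_le ?_ ?_ <;> rw [LinearMap.range_le_ker_iff] <;>
        refine TensorProduct.ext' fun a b => ?_
      · simp [V.toNichols_eq_zero a.2]
      · simp [V.toNichols_eq_zero b.2]
    exact h (V.nicholsIdeal_isHopfIdeal.comul_mem x hx)

end TwistedYD

/-! Twist equivalence and diagonal type -/

/-- The multiplication `X ∘ Y = J(x, y) X Y` of `B(W)^J`, for `X`, `Y` of degrees `x`, `y`. -/
def twistMul {Φ : ThreeCocycle k G} (W : TwistedYD Φ) (J : G → G → kˣ) :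
    W.nichols →ₗ[k] W.nichols →ₗ[k] W.nichols :=
  ∑ g, ∑ h, (J g h : k) • W.nicholsMul.compl₁₂ (W.nichols.proj g) (W.nichols.proj h)

/-- The comultiplication of `B(W)^J`: the comultiplication of `B(W)` followed by
`Y ⊗ Z ↦ J(y, z)⁻¹ Y ⊗ Z`. -/
def twistComul {Φ : ThreeCocycle k G} (W : TwistedYD Φ) (J : G → G → kˣ) :
    W.nichols →ₗ[k] W.nichols ⊗[k] W.nichols :=
  ∑ g, ∑ h, ((J g h)⁻¹ : k) •
    (TensorProduct.map (W.nichols.proj g) (W.nichols.proj h) ∘ₗ W.nicholsComul)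

/-- `B(V)` is twist equivalent to `B(W)`: for some normalized `2`-cochain `J` on the base group
of `W` there is a linear isomorphism from `B(V)` to `B(W)^J` that preserves the multiplication and
the comultiplication, and maps the generating space `V` onto `W` (so it is graded). The base groups
of `V` and `W` may differ. -/
def IsTwistEquivalent {Φ : ThreeCocycle k G} (V : TwistedYD Φ) {H : Type w} [CommGroup H]
    [Fintype H] [DecidableEq H] {Ψ : ThreeCocycle k H} (W : TwistedYD Ψ) : Prop :=
  ∃ J : H → H → kˣ, (∀ h, J 1 h = 1 ∧ J h 1 = 1) ∧
    ∃ (f : V ≃ₗ[k] W) (F : V.nichols ≃ₗ[k] W.nichols),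
      (∀ v, F (V.toNichols (V.gen v)) = W.toNichols (W.gen (f v))) ∧
      (∀ x y, F (V.nicholsMul x y) = twistMul W J (F x) (F y)) ∧
      (∀ x, TensorProduct.map F.toLinearMap F.toLinearMap (V.nicholsComul x) =
        twistComul W J (F x))

/-- `W` is of diagonal type with structure constants `q`: it has a basis `X_i`, `X_i` of degree
`h_i`, such that every `k X_i` is stable under the action and `h_i ▷ X_j = q_ij X_j`. -/
def IsDiagonal {Φ : ThreeCocycle k G} (W : TwistedYD Φ) {ι : Type} (q : ι → ι → k) : Prop :=
  ∃ (X : Module.Basis ι k W) (h : ι → G),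
    (∀ i, X i ∈ W.homogeneous (h i)) ∧
    (∀ g i, ∃ c : k, W.act g (X i) = c • X i) ∧
    (∀ i j, W.act (h i) (X j) = q i j • X j)

/-- The `3`-cocycle is abelian: all simple twisted Yetter-Drinfeld modules are one-dimensional. -/
def ThreeCocycle.IsAbelian (Φ : ThreeCocycle k G) : Prop :=
  ∀ V : TwistedYD Φ, V.IsSimple → Module.finrank k V = 1

end General

/-- A generalized Dynkin diagram with vertex set `ι`: labels of the vertices, and labels of the
edges (`none` means that there is no edge). -/
@[ext]
structure GenDynkinDiagram (k : Type u) (ι : Type) where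
  vertex : ι → k
  edge : ι → ι → Option k

open Classical in
/-- The generalized Dynkin diagram of structure constants `q`: the vertex `i` is labelled by
`q_ii`; there is an edge between `i ≠ j` if `q_ij q_ji ≠ 1`, labelled by `q_ij q_ji`. -/
def genDynkinDiagram {k : Type u} [Field k] {ι : Type} (q : ι → ι → k) : GenDynkinDiagram k ι where
  vertex i := q i i
  edge i j := if i = j ∨ q i j * q j i = 1 then none else some (q i j * q j i)

/-- Two disjoint copies (on `{0, 1}` and on `{2, 3}`) of the diagram of type `A₂` at `-1`: all
vertices and the two edges are labelled by `-1`. -/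
def twoCopiesA2 (k : Type u) [Field k] : GenDynkinDiagram k (Fin 4) where
  vertex _ := -1
  edge i j :=
    if (i, j) ∈ [((0 : Fin 4), (1 : Fin 4)), (1, 0), (2, 3), (3, 2)] then some (-1) else none

/-- `B(V)` is twist equivalent to a usual Nichols algebra of diagonal type over a finite abelian
group, with generalized Dynkin diagram `D`. -/
def IsTwistOfDiagonal {k : Type u} [Field k] {G : Type v} [CommGroup G] [Fintype G] [DecidableEq G]
    {Φ : ThreeCocycle k G} (V : TwistedYD Φ) {ι : Type} (D : GenDynkinDiagram k ι) : Prop :=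
  ∃ (H : Type) (_ : CommGroup H) (_ : Fintype H) (_ : DecidableEq H)
    (W : TwistedYD (ThreeCocycle.trivial k H)) (q : ι → ι → k),
    IsDiagonal W q ∧ genDynkinDiagram q = D ∧ IsTwistEquivalent V W

/-! The group `ℤ₂ × ℤ₂ × ℤ₂`, the cocycle, and the three modules -/

/-- The group `ℤ₂ × ℤ₂ × ℤ₂`, written multiplicatively. -/
abbrev Z23 : Type := Multiplicative (Fin 3 → ZMod 2)

/-- The generators `g_1, g_2, g_3` (indexed by `0, 1, 2`). -/
def gen (i : Fin 3) : Z23 := Multiplicative.ofAdd (Pi.single i 1)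

/-- The exponent, `0` or `1`, of the generator `gen i` in `x`. -/
def expo (x : Z23) (i : Fin 3) : ℕ := (Multiplicative.toAdd x i).val

section Example

variable (k : Type u) [Field k]

theorem zmod_two_cases (a : ZMod 2) : a = 0 ∨ a = 1 := by
  revert a
  decide

theorem neg_one_pow_val_add (a b : ZMod 2) (n : ℕ) :
    (-1 : kˣ) ^ ((a + b).val * n) = (-1) ^ (a.val * n) * (-1) ^ (b.val * n) := by
  simp only [pow_mul, ← mul_pow]
  congr 1
  have h1 : (1 : ZMod 2).val = 1 := rfl
  have h2 : (1 : ZMod 2) + 1 = 0 := rfl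
  rcases zmod_two_cases a with rfl | rfl <;> rcases zmod_two_cases b with rfl | rfl <;>
    simp [h1, h2]

/-- `Φ(x, y, z) = (-1)^{i₃ j₂ k₁}` for `x = g₁^{i₁} g₂^{i₂} g₃^{i₃}`, `y = g₁^{j₁} g₂^{j₂} g₃^{j₃}`
and `z = g₁^{k₁} g₂^{k₂} g₃^{k₃}`. -/
def Phi : ThreeCocycle k Z23 where
  toFun x y z := (-1) ^ (expo x 2 * expo y 1 * expo z 0)
  cocycle e f g h := by
    have h1 : (-1 : kˣ) ^ (expo (e * f) 2 * expo g 1 * expo h 0) =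
        (-1) ^ (expo e 2 * expo g 1 * expo h 0) * (-1) ^ (expo f 2 * expo g 1 * expo h 0) := by
      simp only [mul_assoc]
      exact neg_one_pow_val_add k _ _ _
    have h2 : (-1 : kˣ) ^ (expo e 2 * expo (f * g) 1 * expo h 0) =
        (-1) ^ (expo e 2 * expo f 1 * expo h 0) * (-1) ^ (expo e 2 * expo g 1 * expo h 0) := by
      simp only [mul_assoc, mul_left_comm (expo e 2)]
      exact neg_one_pow_val_add k _ _ _
    have h3 : (-1 : kˣ) ^ (expo e 2 * expo f 1 * expo (g * h) 0) =
        (-1) ^ (expo e 2 * expo f 1 * expo g 0) * (-1) ^ (expo e 2 * expo f 1 * expo h 0) := by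
      simp only [mul_comm (expo e 2 * expo f 1)]
      exact neg_one_pow_val_add k _ _ _
    rw [h1, h2, h3]
    generalize (-1 : kˣ) ^ (expo e 2 * expo g 1 * expo h 0) = a
    generalize (-1 : kˣ) ^ (expo f 2 * expo g 1 * expo h 0) = b
    generalize (-1 : kˣ) ^ (expo e 2 * expo f 1 * expo g 0) = c
    generalize (-1 : kˣ) ^ (expo e 2 * expo f 1 * expo h 0) = d
    rw [mul_comm (a * b), mul_assoc c, mul_assoc c, mul_assoc d]
  normalized f g := by simp [expo]

variable {k}

/-- The matrix of `g₁^a g₂^b g₃^c`, if `g₁, g₂, g₃` act by `A, B, C` and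
`g₁^a g₂^b g₃^c ▷ v = g₁^a ▷ (g₂^b ▷ (g₃^c ▷ v))`. -/
def actMatrix (A B C : Matrix (Fin 2) (Fin 2) k) (x : Z23) : Matrix (Fin 2) (Fin 2) k :=
  A ^ expo x 0 * B ^ expo x 1 * C ^ expo x 2

theorem actMatrix_gen (A B C : Matrix (Fin 2) (Fin 2) k) :
    actMatrix A B C (gen 0) = A ∧ actMatrix A B C (gen 1) = B ∧ actMatrix A B C (gen 2) = C := by
  have h : (1 : ZMod 2).val = 1 := rfl
  simp [actMatrix, expo, gen, h]

/-- The space `k²`, in degree `d`, on which `g₁, g₂, g₃` act by the matrices `A, B, C`. -/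
def ofMatrices (d : Z23) (A B C : Matrix (Fin 2) (Fin 2) k)
    (h : ∀ x y : Z23, actMatrix A B C x * actMatrix A B C y =
      ((Phi k).slant d x y : k) • actMatrix A B C (x * y)) : TwistedYD (Phi k) where
  carrier := Fin 2 → k
  proj g := if g = d then LinearMap.id else 0
  act x := Matrix.toLin' (actMatrix A B C x)
  proj_proj g h x := by
    by_cases h1 : g = d <;> by_cases h2 : h = d <;> simp [h1, h2]
  sum_proj x := by
    rw [Finset.sum_eq_single d] <;> simp +contextual
  act_proj e g x := by split_ifs <;> simp
  act_one x := by simp [actMatrix, expo]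
  act_act e f g x := by
    split_ifs with hg
    · subst hg
      simp only [LinearMap.id_apply, ← LinearMap.comp_apply, ← Matrix.toLin'_mul, h, map_smul,
        LinearMap.smul_apply]
    · simp

theorem expo_ofAdd (v : Fin 3 → ZMod 2) (i : Fin 3) :
    expo (Multiplicative.ofAdd v) i = (v i).val := rfl

theorem pow_expo_mul {A : Matrix (Fin 2) (Fin 2) k} (hA : A * A = 1) (x y : Z23) (i : Fin 3) :
    A ^ expo x i * A ^ expo y i = A ^ expo (x * y) i := by
  have h1 : (1 : ZMod 2).val = 1 := rfl
  have h2 : (1 : ZMod 2) + 1 = 0 := rfl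
  have h : expo (x * y) i = (Multiplicative.toAdd x i + Multiplicative.toAdd y i).val := rfl
  rw [h, expo, expo]
  rcases zmod_two_cases (Multiplicative.toAdd x i) with h3 | h3 <;>
    rcases zmod_two_cases (Multiplicative.toAdd y i) with h4 | h4 <;>
    simp [h1, h2, h3, h4, hA]

theorem pow_mul_pow_swap {A B : Matrix (Fin 2) (Fin 2) k} {c : k} (h : B * A = c • (A * B))
    (x y : Z23) (i j : Fin 3) :
    B ^ expo x i * A ^ expo y j = c ^ (expo x i * expo y j) • (A ^ expo y j * B ^ expo x i) := by
  have h1 : (1 : ZMod 2).val = 1 := rfl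
  rw [expo, expo]
  rcases zmod_two_cases (Multiplicative.toAdd x i) with h3 | h3 <;>
    rcases zmod_two_cases (Multiplicative.toAdd y j) with h4 | h4 <;>
    simp [h1, h3, h4, h]

theorem actMatrix_mul {A B C : Matrix (Fin 2) (Fin 2) k} {a b c : k}
    (hA : A * A = 1) (hB : B * B = 1) (hC : C * C = 1)
    (hBA : B * A = c • (A * B)) (hCA : C * A = b • (A * C)) (hCB : C * B = a • (B * C))
    (x y : Z23) :
    actMatrix A B C x * actMatrix A B C y =
      (c ^ (expo x 1 * expo y 0) * b ^ (expo x 2 * expo y 0) * a ^ (expo x 2 * expo y 1)) •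
        actMatrix A B C (x * y) := by
  simp only [actMatrix, ← pow_expo_mul hA, ← pow_expo_mul hB, ← pow_expo_mul hC]
  have e1 := pow_mul_pow_swap hBA x y 1 0
  have e2 := pow_mul_pow_swap hCA x y 2 0
  have e3 := pow_mul_pow_swap hCB x y 2 1
  generalize c ^ (expo x 1 * expo y 0) = c at *
  generalize b ^ (expo x 2 * expo y 0) = b at *
  generalize a ^ (expo x 2 * expo y 1) = a at *
  generalize A ^ expo x 0 = A1 at *
  generalize B ^ expo x 1 = B1 at *
  generalize C ^ expo x 2 = C1 at *
  generalize A ^ expo y 0 = A2 at *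
  generalize B ^ expo y 1 = B2 at *
  generalize C ^ expo y 2 = C2 at *
  calc A1 * B1 * C1 * (A2 * B2 * C2) = A1 * B1 * (C1 * A2) * B2 * C2 := by
        simp only [Matrix.mul_assoc]
    _ = b • (A1 * (B1 * A2) * (C1 * B2) * C2) := by
        rw [e2]; simp only [Matrix.mul_assoc, Matrix.mul_smul, Matrix.smul_mul]
    _ = _ := by
        rw [e1, e3]
        simp only [Matrix.mul_assoc, Matrix.mul_smul, Matrix.smul_mul, smul_smul]
        congr 1
        ring

variable (k)

theorem actMatrix_mul1 (x y : Z23) :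
    actMatrix (k := k) !![-1, 0; 0, -1] !![1, 0; 0, -1] !![0, 1; 1, 0] x *
      actMatrix !![-1, 0; 0, -1] !![1, 0; 0, -1] !![0, 1; 1, 0] y =
    ((Phi k).slant (gen 0) x y : k) •
      actMatrix !![-1, 0; 0, -1] !![1, 0; 0, -1] !![0, 1; 1, 0] (x * y) := by
  have h1 : (1 : ZMod 2).val = 1 := rfl
  rw [actMatrix_mul (a := -1) (b := 1) (c := 1)]
  · congr 1
    simp [ThreeCocycle.slant, Phi, gen, expo_ofAdd, h1]
  all_goals simp [Matrix.one_fin_two]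

theorem actMatrix_mul2 (x y : Z23) :
    actMatrix (k := k) !![1, 0; 0, -1] !![-1, 0; 0, -1] !![0, 1; 1, 0] x *
      actMatrix !![1, 0; 0, -1] !![-1, 0; 0, -1] !![0, 1; 1, 0] y =
    ((Phi k).slant (gen 1) x y : k) •
      actMatrix !![1, 0; 0, -1] !![-1, 0; 0, -1] !![0, 1; 1, 0] (x * y) := by
  have h1 : (1 : ZMod 2).val = 1 := rfl
  rw [actMatrix_mul (a := 1) (b := -1) (c := 1)]
  · congr 1
    simp [ThreeCocycle.slant, Phi, gen, expo_ofAdd, h1]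
    rw [← inv_pow, inv_neg, inv_one]
  all_goals simp [Matrix.one_fin_two]

theorem actMatrix_mul3 (x y : Z23) :
    actMatrix (k := k) !![0, 1; 1, 0] !![1, 0; 0, -1] !![-1, 0; 0, -1] x *
      actMatrix !![0, 1; 1, 0] !![1, 0; 0, -1] !![-1, 0; 0, -1] y =
    ((Phi k).slant (gen 2) x y : k) •
      actMatrix !![0, 1; 1, 0] !![1, 0; 0, -1] !![-1, 0; 0, -1] (x * y) := by
  have h1 : (1 : ZMod 2).val = 1 := rfl
  rw [actMatrix_mul (a := 1) (b := 1) (c := -1)]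
  · congr 1
    simp [ThreeCocycle.slant, Phi, gen, expo_ofAdd, h1]
  all_goals simp [Matrix.one_fin_two]

/-- `V₁ = k{X₁, X₂}` of degree `g₁`: `g₁ ▷ X₁ = -X₁`, `g₁ ▷ X₂ = -X₂`, `g₂ ▷ X₁ = X₁`,
`g₂ ▷ X₂ = -X₂`, `g₃ ▷ X₁ = X₂`, `g₃ ▷ X₂ = X₁`. -/
def V1 : TwistedYD (Phi k) :=
  ofMatrices (gen 0) !![-1, 0; 0, -1] !![1, 0; 0, -1] !![0, 1; 1, 0]
    (actMatrix_mul1 k)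

/-- `V₂ = k{Y₁, Y₂}` of degree `g₂`: `g₁ ▷ Y₁ = Y₁`, `g₁ ▷ Y₂ = -Y₂`, `g₂ ▷ Y₁ = -Y₁`,
`g₂ ▷ Y₂ = -Y₂`, `g₃ ▷ Y₁ = Y₂`, `g₃ ▷ Y₂ = Y₁`. -/
def V2 : TwistedYD (Phi k) :=
  ofMatrices (gen 1) !![1, 0; 0, -1] !![-1, 0; 0, -1] !![0, 1; 1, 0]
    (actMatrix_mul2 k)

/-- `V₃ = k{Z₁, Z₂}` of degree `g₃`: `g₁ ▷ Z₁ = Z₂`, `g₁ ▷ Z₂ = Z₁`, `g₂ ▷ Z₁ = Z₁`,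
`g₂ ▷ Z₂ = -Z₂`, `g₃ ▷ Z₁ = -Z₁`, `g₃ ▷ Z₂ = -Z₂`. -/
def V3 : TwistedYD (Phi k) :=
  ofMatrices (gen 2) !![0, 1; 1, 0] !![1, 0; 0, -1] !![-1, 0; 0, -1]
    (actMatrix_mul3 k)

end Example

end TwistedNichols

end

/-! Each of the three sums is supported on the subgroup S generated by two of the three generators.
The exponent of Φ multiplies one coordinate of each kind, so Φ is trivial on S. Hence all
associativity constraints of the tensor algebra are the bare ones (`assoc_eq`, `assocInv_eq`).
Product, coproduct and antipode use the action of group elements only through degrees of vectors,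
that is, through S, and S acts by an honest diagonalizable representation. Let W be the same graded
space with the action restricted along the projection onto S that kills the third generator. It is a
usual Yetter–Drinfeld module of diagonal type, and T(W) and T_Φ(V) have the same product, coproduct
and antipode, so J = 1 will do.

The delicate point is that the ideals defining B(V) must be stable under the third generator too,
which W does not see. `IsWeakHopfIdeal` drops this stability. Every group element respects product,
coproduct and antipode up to slant scalars (`act_mul`, `tensorAct_comul`, `act_antipode`), so the
translates of a weak Hopf ideal add up to a Hopf ideal (`isHopfIdeal_actSpan`). The Nichols ideal is
therefore the largest weak Hopf ideal for V and for W, and the two coincide (`map_nicholsIdeal`).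

For finiteness, let I be the ideal generated by the squares of an eigenbasis, the q-commutators
between the two copies of A₂, and the square of the root vector x_i x_j + x_j x_i in each copy.
Coproduct and antipode turn right multiplications by basis vectors into operators that satisfy the
same relations (`SatisfiesRelations.tensor`, `SatisfiesRelations.neg_mul_diagonal`), so I is a weak
Hopf ideal. The quotient by I is spanned by 8 · 8 monomials, and B(V) is a quotient of it. -/

noncomputable section

namespace TwistedNichols

namespace TwistedYD

/-! ### Associativity constraints and braiding over a subgroup where the cocycle is trivial. -/

section TensorAlgebra

variable {k : Type u} [Field k] {G : Type v} [CommGroup G] [Fintype G] [DecidableEq G]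
  {Φ : ThreeCocycle k G}

/-- All degrees that occur in `V` lie in the subgroup `S`. -/
def IsSupportedOn (V : TwistedYD Φ) (S : Subgroup G) : Prop := ∀ g ∉ S, V.proj g = 0

/-- The cocycle is trivial on the subgroup `S`. -/
def _root_.TwistedNichols.ThreeCocycle.IsTrivialOn (Φ : ThreeCocycle k G) (S : Subgroup G) : Prop :=
  ∀ x ∈ S, ∀ y ∈ S, ∀ z ∈ S, Φ x y z = 1

theorem tensor_proj (V W : TwistedYD Φ) (g : G) : (V.tensor W).proj g = tensorProj V W g := rfl

theorem proj_proj_self (V : TwistedYD Φ) (g : G) (x : V) : V.proj g (V.proj g x) = V.proj g x := by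
  simp [V.proj_proj]

namespace IsSupportedOn

variable {S : Subgroup G}

theorem tensor {V W : TwistedYD Φ} (hV : V.IsSupportedOn S) (hW : W.IsSupportedOn S) :
    (V.tensor W).IsSupportedOn S := by
  intro g hg
  rw [tensor_proj, tensorProj]
  refine Finset.sum_eq_zero fun a _ => ?_
  by_cases ha : a ∈ S
  · have : a⁻¹ * g ∉ S := fun h => hg (by simpa using S.mul_mem ha h)
    rw [hW _ this, TensorProduct.map_zero_right]; rfl
  · rw [hV _ ha, TensorProduct.map_zero_left]; rfl

theorem unit : (unit Φ).IsSupportedOn S := by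
  intro g hg
  have : g ≠ 1 := fun h => hg (h ▸ S.one_mem)
  exact if_neg this

theorem directSum {V : ℕ → TwistedYD Φ} (hV : ∀ n, (V n).IsSupportedOn S) :
    (directSum V).IsSupportedOn S := by
  intro g hg
  have : (fun n => (V n).proj g) = fun n => 0 := funext fun n => hV n g hg
  refine LinearMap.ext fun x => ?_
  change DirectSum.lmap (fun n => (V n).proj g) x = 0
  rw [this]
  refine DFinsupp.ext fun n => ?_
  exact DirectSum.lmap_apply (fun n => (0 : V n →ₗ[k] V n)) x n

theorem tensorPow {V : TwistedYD Φ} (hV : V.IsSupportedOn S) :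
    ∀ n, (V.tensorPow n).IsSupportedOn S
  | 0 => unit
  | n + 1 => (tensorPow hV n).tensor hV

theorem tensorAlg {V : TwistedYD Φ} (hV : V.IsSupportedOn S) : V.tensorAlg.IsSupportedOn S :=
  directSum hV.tensorPow

end IsSupportedOn

theorem sum_proj_tmul (V W : TwistedYD Φ) (x : V) (y : W) :
    x ⊗ₜ[k] y = ∑ a, ∑ b, V.proj a x ⊗ₜ[k] W.proj b y := by
  conv_lhs => rw [← V.sum_proj x, ← W.sum_proj y]
  simp only [TensorProduct.sum_tmul, TensorProduct.tmul_sum]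
  exact Finset.sum_comm

section Supported

variable {S : Subgroup G} (hΦ : Φ.IsTrivialOn S)
include hΦ

/-- Summands with a degree outside `S` vanish, the others have coefficient 1, and the projections
add up to the identity. -/
theorem assocInv_eq {U V W : TwistedYD Φ} (hU : U.IsSupportedOn S) (hV : V.IsSupportedOn S)
    (hW : W.IsSupportedOn S) :
    assocInv U V W = (TensorProduct.assoc k U V W).symm.toLinearMap := by
  have : assocInv U V W = ∑ e, ∑ f, ∑ g, ((TensorProduct.assoc k U V W).symm.toLinearMap ∘ₗ
    TensorProduct.map (U.proj e) (TensorProduct.map (V.proj f) (W.proj g))) := by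
    refine Finset.sum_congr rfl fun e _ => Finset.sum_congr rfl fun f _ =>
      Finset.sum_congr rfl fun g _ => ?_
    by_cases he : e ∈ S
    · by_cases hf : f ∈ S
      · by_cases hg : g ∈ S
        · rw [hΦ e he f hf g hg, Units.val_one, one_smul]
        · simp [hW g hg]
      · simp [hV f hf]
    · simp [hU e he]
  rw [this]
  refine TensorProduct.ext' fun x s => ?_
  induction s using TensorProduct.induction_on with
  | zero => simp
  | add s t hs ht => rw [TensorProduct.tmul_add, map_add, map_add, hs, ht]
  | tmul y z =>
    simp [← TensorProduct.sum_tmul, ← TensorProduct.tmul_sum, sum_proj]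

theorem assoc_eq {U V W : TwistedYD Φ} (hU : U.IsSupportedOn S) (hV : V.IsSupportedOn S)
    (hW : W.IsSupportedOn S) :
    assoc U V W = (TensorProduct.assoc k U V W).toLinearMap := by
  have : assoc U V W = ∑ e, ∑ f, ∑ g, ((TensorProduct.assoc k U V W).toLinearMap ∘ₗ
    TensorProduct.map (TensorProduct.map (U.proj e) (V.proj f)) (W.proj g)) := by
    refine Finset.sum_congr rfl fun e _ => Finset.sum_congr rfl fun f _ =>
      Finset.sum_congr rfl fun g _ => ?_
    by_cases he : e ∈ S
    · by_cases hf : f ∈ S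
      · by_cases hg : g ∈ S
        · rw [hΦ e he f hf g hg, Units.val_one, inv_one, one_smul]
        · simp [hW g hg]
      · simp [hV f hf]
    · simp [hU e he]
  rw [this]
  refine TensorProduct.ext' fun s z => ?_
  induction s using TensorProduct.induction_on with
  | zero => simp
  | add s t hs ht => rw [TensorProduct.add_tmul, map_add, map_add, hs, ht]
  | tmul x y =>
    simp [← TensorProduct.sum_tmul, ← TensorProduct.tmul_sum, sum_proj]

/-- All four rebracketings are bare, so only the braiding of the middle factors remains, expanded
over the degrees of `y`. -/
theorem middleSwap_tmul {A B C D : TwistedYD Φ} (hA : A.IsSupportedOn S) (hB : B.IsSupportedOn S)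
    (hC : C.IsSupportedOn S) (hD : D.IsSupportedOn S) (x : A) (y : B) (z : C) (w : D) :
    middleSwap A B C D ((x ⊗ₜ y) ⊗ₜ (z ⊗ₜ w)) =
      ∑ g, (x ⊗ₜ C.act g z) ⊗ₜ (B.proj g y ⊗ₜ w) := by
  have e1 (s : C.tensor D) : assoc A B (C.tensor D) ((x ⊗ₜ y) ⊗ₜ s) = x ⊗ₜ (y ⊗ₜ s) := by
    rw [assoc_eq hΦ hA hB (hC.tensor hD)]; rfl
  have e2 : assocInv B C D (y ⊗ₜ (z ⊗ₜ w)) = (y ⊗ₜ z) ⊗ₜ w := by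
    rw [assocInv_eq hΦ hB hC hD]; rfl
  have e3 (c : C) (b : B) : assoc C B D ((c ⊗ₜ b) ⊗ₜ w) = c ⊗ₜ (b ⊗ₜ w) := by
    rw [assoc_eq hΦ hC hB hD]; rfl
  have e4 (c : C) (s : B.tensor D) :
      assocInv A C (B.tensor D) (x ⊗ₜ (c ⊗ₜ s)) = (x ⊗ₜ c) ⊗ₜ s := by
    rw [assocInv_eq hΦ hA hC (hB.tensor hD)]; rfl
  have e5 : braiding B C (y ⊗ₜ z) = ∑ g, C.act g z ⊗ₜ B.proj g y := by
    simp [braiding]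
  have e6 : assoc C B D (((braiding B C).rTensor D) (assocInv B C D (y ⊗ₜ (z ⊗ₜ w)))) =
      ∑ g, C.act g z ⊗ₜ (B.proj g y ⊗ₜ w) := by
    rw [e2, LinearMap.rTensor_tmul, e5, TensorProduct.sum_tmul, map_sum]
    simp only [e3]
  refine (congrArg (fun s => assocInv A C (B.tensor D) (LinearMap.lTensor A (assoc C B D)
    (LinearMap.lTensor A ((braiding B C).rTensor D) (LinearMap.lTensor A (assocInv B C D) s))))
    (e1 (z ⊗ₜ w))).trans ?_
  change assocInv A C (B.tensor D)
    (x ⊗ₜ (assoc C B D (((braiding B C).rTensor D) (assocInv B C D (y ⊗ₜ (z ⊗ₜ w)))))) = _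
  rw [e6]
  refine (map_sum (assocInv A C (B.tensor D) ∘ₗ
    TensorProduct.mk k A (C ⊗[k] (B.tensor D).carrier) x) _ _).trans ?_
  exact Finset.sum_congr rfl fun g _ => e4 _ _

end Supported

end TensorAlgebra

end TwistedYD

namespace TwistedYD

/-! ### The tensor algebra described by right multiplication by generators. -/

section RightMul

variable {k : Type u} [Field k] {G : Type v} [CommGroup G] [Fintype G] [DecidableEq G]
  {Φ : ThreeCocycle k G}

theorem ofComponents_incl (V : TwistedYD Φ) {M : Type w} [AddCommGroup M] [Module k M]
    (F : ∀ n, V.tensorPow n →ₗ[k] M) (n : ℕ) (x : V.tensorPow n) :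
    V.ofComponents F (V.incl n x) = F n x :=
  DirectSum.toModule_lof (M := fun n => V.tensorPow n) (N := M) (φ := F) k n x

theorem mul_incl (V : TwistedYD Φ) {m n : ℕ} (x : V.tensorPow m) (y : V.tensorPow n) :
    V.mul (V.incl m x) (V.incl n y) = V.incl (m + n) (V.mulPow m n (x ⊗ₜ y)) := by
  have h1 : V.mul (V.incl m x) = LinearMap.flip (V.ofComponents fun n =>
      LinearMap.flip (TensorProduct.curry (V.incl (m + n) ∘ₗ V.mulPow m n))) x :=
    V.ofComponents_incl _ m x
  rw [h1, LinearMap.flip_apply, ofComponents_incl]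
  rfl

theorem component_incl_self (V : TwistedYD Φ) (n : ℕ) (x : V.tensorPow n) :
    V.component n (V.incl n x) = x :=
  DirectSum.component.lof_self (M := fun n => V.tensorPow n) k n x

theorem component_incl_of_ne (V : TwistedYD Φ) {m n : ℕ} (h : n ≠ m) (x : V.tensorPow n) :
    V.component m (V.incl n x) = 0 :=
  DFinsupp.single_eq_of_ne h.symm

theorem hom_ext_incl (V : TwistedYD Φ) {M : Type w} [AddCommGroup M] [Module k M]
    {f g : V.tensorAlg →ₗ[k] M} (h : ∀ n x, f (V.incl n x) = g (V.incl n x)) : f = g :=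
  DirectSum.linearMap_ext k fun n => LinearMap.ext fun x => h n x

theorem proj_incl (V : TwistedYD Φ) (g : G) (n : ℕ) (x : V.tensorPow n) :
    V.tensorAlg.proj g (V.incl n x) = V.incl n ((V.tensorPow n).proj g x) :=
  DirectSum.lmap_lof (fun n => (V.tensorPow n).proj g) n x

theorem act_incl (V : TwistedYD Φ) (g : G) (n : ℕ) (x : V.tensorPow n) :
    V.tensorAlg.act g (V.incl n x) = V.incl n ((V.tensorPow n).act g x) :=
  DirectSum.lmap_lof (fun n => (V.tensorPow n).act g) n x

theorem tensorProj_tmul (V W : TwistedYD Φ) (g : G) {b : G} (x : V) {y : W}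
    (hy : W.proj b y = y) : tensorProj V W g (x ⊗ₜ y) = V.proj (g * b⁻¹) x ⊗ₜ y := by
  rw [← hy]
  simp only [tensorProj, LinearMap.sum_apply, TensorProduct.map_tmul, proj_proj]
  rw [Finset.sum_eq_single (g * b⁻¹)]
  · simp
  · intro a _ ha
    rw [if_neg, TensorProduct.tmul_zero]
    rintro rfl
    simp at ha
  · simp

theorem tensorAct_tmul {V W : TwistedYD Φ} (e : G) {a b : G} {x : V} {y : W}
    (hx : V.proj a x = x) (hy : W.proj b y = y) :
    tensorAct V W e (x ⊗ₜ y) = (Φ.slant e a b : k) • (V.act e x ⊗ₜ W.act e y) := by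
  have := tensorAct_apply V W e a b x y
  rwa [hx, hy, ← V.act_proj, ← W.act_proj, hx, hy] at this

omit [Fintype G] [DecidableEq G] in
theorem _root_.TwistedNichols.ThreeCocycle.slant_one_middle (Φ : ThreeCocycle k G) (e a : G) :
    Φ.slant e 1 a = 1 := by
  simp [ThreeCocycle.slant, Φ.one_left, Φ.normalized]

omit [Fintype G] [DecidableEq G] in
theorem _root_.TwistedNichols.ThreeCocycle.slant_one_right (Φ : ThreeCocycle k G) (e a : G) :
    Φ.slant e a 1 = 1 := by
  simp [ThreeCocycle.slant, Φ.one_right, Φ.normalized]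

/-- The generator of the zeroth tensor power. -/
def unitPow (V : TwistedYD Φ) : V.tensorPow 0 := (1 : k)

/-- The map `(x, v) ↦ x ⊗ v`. -/
def snoc (V : TwistedYD Φ) (n : ℕ) : V.tensorPow n →ₗ[k] V →ₗ[k] V.tensorPow (n + 1) :=
  TensorProduct.mk k (V.tensorPow n) V

theorem incl_unitPow (V : TwistedYD Φ) : V.incl 0 V.unitPow = V.one := rfl

theorem incl_snoc_unitPow (V : TwistedYD Φ) (v : V) :
    V.incl 1 (V.snoc 0 V.unitPow v) = V.gen v := rfl

theorem proj_unitPow (V : TwistedYD Φ) (g : G) :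
    (V.tensorPow 0).proj g V.unitPow = if g = 1 then V.unitPow else 0 := by
  change (if g = 1 then (LinearMap.id : k →ₗ[k] k) else 0) (1 : k) = _
  split_ifs <;> rfl

theorem act_unitPow (V : TwistedYD Φ) (g : G) : (V.tensorPow 0).act g V.unitPow = V.unitPow := rfl

theorem proj_snoc (V : TwistedYD Φ) (n : ℕ) (g : G) {b : G} (x : V.tensorPow n) {v : V}
    (hv : V.proj b v = v) :
    (V.tensorPow (n + 1)).proj g (V.snoc n x v) =
      V.snoc n ((V.tensorPow n).proj (g * b⁻¹) x) v :=
  tensorProj_tmul _ _ g x hv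

theorem act_snoc (V : TwistedYD Φ) (n : ℕ) (e : G) {a b : G} {x : V.tensorPow n} {v : V}
    (hx : (V.tensorPow n).proj a x = x) (hv : V.proj b v = v) :
    (V.tensorPow (n + 1)).act e (V.snoc n x v) =
      (Φ.slant e a b : k) • V.snoc n ((V.tensorPow n).act e x) (V.act e v) :=
  tensorAct_tmul e hx hv

theorem tensorPow_zero_eq_smul (V : TwistedYD Φ) (x : V.tensorPow 0) : ∃ c : k, x = c • V.unitPow :=
  ⟨x, (mul_one (show k from x)).symm⟩

theorem mem_of_snoc_mem (V : TwistedYD Φ) {n : ℕ} (U : Submodule k (V.tensorPow (n + 1)))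
    (h : ∀ x v, V.snoc n x v ∈ U) (x : V.tensorPow (n + 1)) : x ∈ U := by
  induction x using TensorProduct.induction_on with
  | zero => exact U.zero_mem
  | tmul x v => exact h x v
  | add x y hx hy => exact U.add_mem hx hy

theorem mulPow_unitPow (V : TwistedYD Φ) (n : ℕ) (x : V.tensorPow n) :
    V.mulPow n 0 (x ⊗ₜ V.unitPow) = x :=
  (TensorProduct.rid_tmul _ _).trans (one_smul _ _)

theorem act_gen (V : TwistedYD Φ) (e : G) (v : V) :
    V.tensorAlg.act e (V.gen v) = V.gen (V.act e v) := by
  conv_lhs => rw [← V.sum_proj v]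
  conv_rhs => rw [← V.sum_proj v]
  simp only [map_sum]
  refine Finset.sum_congr rfl fun a _ => ?_
  have h1 : (V.tensorPow 0).proj 1 V.unitPow = V.unitPow := by rw [proj_unitPow, if_pos rfl]
  rw [← incl_snoc_unitPow, act_incl, V.act_snoc 0 e h1 (V.proj_proj_self a v),
    Φ.slant_one_middle, Units.val_one, one_smul, act_unitPow, incl_snoc_unitPow]

theorem act_one_tensorAlg (V : TwistedYD Φ) (e : G) : V.tensorAlg.act e V.one = V.one := by
  rw [← incl_unitPow, act_incl, act_unitPow]

theorem proj_one (V : TwistedYD Φ) (g : G) :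
    V.tensorAlg.proj g V.one = if g = 1 then V.one else 0 := by
  rw [← incl_unitPow, proj_incl, proj_unitPow]
  split_ifs <;> simp

/-- Right multiplication by a generator. -/
def rightMul (V : TwistedYD Φ) (v : V) : V.tensorAlg →ₗ[k] V.tensorAlg := V.mul.flip (V.gen v)

/-- Left multiplication by a generator. -/
def leftMul (V : TwistedYD Φ) (v : V) : V.tensorAlg →ₗ[k] V.tensorAlg := V.mul (V.gen v)

theorem rightMul_sum (V : TwistedYD Φ) {ι : Type*} (s : Finset ι) (v : ι → V) :
    V.rightMul (∑ i ∈ s, v i) = ∑ i ∈ s, V.rightMul (v i) := by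
  simp [rightMul, map_sum]

theorem rightMul_smul (V : TwistedYD Φ) (c : k) (v : V) :
    V.rightMul (c • v) = c • V.rightMul v := by
  simp [rightMul]

theorem leftMul_smul (V : TwistedYD Φ) (c : k) (v : V) :
    V.leftMul (c • v) = c • V.leftMul v := by
  simp [leftMul]

theorem mul_one_right (V : TwistedYD Φ) (t : V.tensorAlg) : V.mul t V.one = t := by
  have : V.mul.flip V.one = LinearMap.id := by
    refine V.hom_ext_incl fun n x => ?_
    rw [LinearMap.flip_apply, ← incl_unitPow, mul_incl, mulPow_unitPow]
    rfl
  exact LinearMap.congr_fun this t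

section Supported

variable {S : Subgroup G} (hΦ : Φ.IsTrivialOn S) {V : TwistedYD Φ} (hV : V.IsSupportedOn S)
include hΦ hV

/-- The rebracketing contributes no scalar, so the product is concatenation of words and its
properties follow by induction on the last letter. -/
theorem mulPow_snoc (m n : ℕ) (x : V.tensorPow m) (y : V.tensorPow n) (v : V) :
    V.mulPow m (n + 1) (x ⊗ₜ V.snoc n y v) = V.snoc (m + n) (V.mulPow m n (x ⊗ₜ y)) v := by
  change (V.mulPow m n).rTensor V
    (assocInv (V.tensorPow m) (V.tensorPow n) V (x ⊗ₜ (y ⊗ₜ v))) = _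
  rw [assocInv_eq hΦ (hV.tensorPow m) (hV.tensorPow n) hV]
  rfl

theorem rightMul_incl (v : V) (n : ℕ) (x : V.tensorPow n) :
    V.rightMul v (V.incl n x) = V.incl (n + 1) (V.snoc n x v) := by
  rw [rightMul, LinearMap.flip_apply, ← incl_snoc_unitPow, mul_incl, mulPow_snoc hΦ hV,
    mulPow_unitPow]
  rfl

theorem mul_rightMul (v : V) (s t : V.tensorAlg) :
    V.mul s (V.rightMul v t) = V.rightMul v (V.mul s t) := by
  have : (V.mul.compl₂ (V.rightMul v)) = V.mul.compr₂ (V.rightMul v) := by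
    refine V.hom_ext_incl fun m x => V.hom_ext_incl fun n y => ?_
    simp only [LinearMap.compl₂_apply, LinearMap.compr₂_apply]
    rw [rightMul_incl hΦ hV, mul_incl, mul_incl, rightMul_incl hΦ hV, mulPow_snoc hΦ hV]
    rfl
  exact LinearMap.congr_fun₂ this s t

/-- Words arise from the unit by appending letters on the right. This is the induction principle
behind most of the later identities. -/
theorem eq_top_of_one_mem {U : Submodule k V.tensorAlg} (h1 : V.one ∈ U)
    (h : ∀ v, ∀ t ∈ U, V.rightMul v t ∈ U) : U = ⊤ := by
  have key : ∀ n x, V.incl n x ∈ U := by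
    intro n
    induction n with
    | zero =>
      intro x
      obtain ⟨c, rfl⟩ := V.tensorPow_zero_eq_smul x
      rw [map_smul, incl_unitPow]
      exact U.smul_mem _ h1
    | succ n ih =>
      refine V.mem_of_snoc_mem (U.comap (V.incl (n + 1))) fun x v => ?_
      rw [Submodule.mem_comap, ← rightMul_incl hΦ hV]
      exact h v _ (ih x)
  rw [eq_top_iff]
  intro t _
  induction t using DirectSum.induction_on with
  | zero => exact U.zero_mem
  | of n x => exact key n x
  | add s t hs ht => exact U.add_mem (hs trivial) (ht trivial)

theorem hom_ext_rightMul {M : Type w} [AddCommGroup M] [Module k M] {f g : V.tensorAlg →ₗ[k] M}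
    (h1 : f V.one = g V.one)
    (h : ∀ v t, f t = g t → f (V.rightMul v t) = g (V.rightMul v t)) : f = g := by
  have : LinearMap.eqLocus f g = ⊤ := eq_top_of_one_mem hΦ hV h1 h
  exact LinearMap.eqLocus_eq_top.1 this

theorem one_mul_left (t : V.tensorAlg) : V.mul V.one t = t := by
  have : V.mul V.one = LinearMap.id := by
    refine hom_ext_rightMul hΦ hV (V.mul_one_right _) fun v t ht => ?_
    rw [mul_rightMul hΦ hV, ht]; rfl
  exact LinearMap.congr_fun this t

theorem rightMul_one (v : V) : V.rightMul v V.one = V.gen v := one_mul_left hΦ hV _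

theorem mul_assoc_tensorAlg (r s t : V.tensorAlg) :
    V.mul (V.mul r s) t = V.mul r (V.mul s t) := by
  have : V.mul (V.mul r s) = V.mul r ∘ₗ V.mul s := by
    refine hom_ext_rightMul hΦ hV ?_ fun v t ht => ?_
    · simp [mul_one_right]
    · rw [LinearMap.comp_apply] at ht ⊢
      simp only [mul_rightMul hΦ hV, ht]
  exact LinearMap.congr_fun this t

theorem proj_rightMul (g : G) {a : G} {v : V} (hv : V.proj a v = v) (t : V.tensorAlg) :
    V.tensorAlg.proj g (V.rightMul v t) = V.rightMul v (V.tensorAlg.proj (g * a⁻¹) t) := by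
  have : V.tensorAlg.proj g ∘ₗ V.rightMul v = V.rightMul v ∘ₗ V.tensorAlg.proj (g * a⁻¹) := by
    refine V.hom_ext_incl fun n x => ?_
    simp only [LinearMap.comp_apply]
    rw [proj_incl, rightMul_incl hΦ hV, rightMul_incl hΦ hV, proj_incl, V.proj_snoc n g x hv]
  exact LinearMap.congr_fun this t

/-- The element `e` is arbitrary: outside `S` the slant scalar need not be 1, even though the
degrees of `t` and `v` lie in `S` whenever these are nonzero. -/
theorem act_rightMul (e : G) {a g : G} {v : V} (hv : V.proj a v = v) {t : V.tensorAlg}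
    (ht : V.tensorAlg.proj g t = t) :
    V.tensorAlg.act e (V.rightMul v t) =
      (Φ.slant e g a : k) • V.rightMul (V.act e v) (V.tensorAlg.act e t) := by
  have : V.tensorAlg.act e ∘ₗ V.rightMul v ∘ₗ V.tensorAlg.proj g =
      (Φ.slant e g a : k) • V.rightMul (V.act e v) ∘ₗ V.tensorAlg.act e ∘ₗ V.tensorAlg.proj g := by
    refine V.hom_ext_incl fun n x => ?_
    simp only [LinearMap.comp_apply, LinearMap.smul_apply]
    rw [proj_incl, act_incl, rightMul_incl hΦ hV, rightMul_incl hΦ hV, act_incl,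
      V.act_snoc n e ((V.tensorPow n).proj_proj_self g x) hv, map_smul]
  have := LinearMap.congr_fun this t
  simpa [ht] using this

theorem incl_component_succ_rightMul (n : ℕ) (v : V) (t : V.tensorAlg) :
    V.incl (n + 1) (V.component (n + 1) (V.rightMul v t)) =
      V.rightMul v (V.incl n (V.component n t)) := by
  have : V.incl (n + 1) ∘ₗ V.component (n + 1) ∘ₗ V.rightMul v =
      V.rightMul v ∘ₗ V.incl n ∘ₗ V.component n := by
    refine V.hom_ext_incl fun m x => ?_
    simp only [LinearMap.comp_apply]
    by_cases h : m = n
    · subst h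
      rw [rightMul_incl hΦ hV, component_incl_self, component_incl_self, rightMul_incl hΦ hV]
    · rw [rightMul_incl hΦ hV, component_incl_of_ne _ h, component_incl_of_ne _ (by omega)]
      simp
  exact LinearMap.congr_fun this t

theorem component_zero_rightMul (v : V) (t : V.tensorAlg) :
    V.component 0 (V.rightMul v t) = 0 := by
  have : V.component 0 ∘ₗ V.rightMul v = 0 := by
    refine V.hom_ext_incl fun m x => ?_
    simp only [LinearMap.comp_apply]
    rw [rightMul_incl hΦ hV]
    rw [component_incl_of_ne _ (Nat.succ_ne_zero m)]
    rfl
  exact LinearMap.congr_fun this t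

end Supported

end RightMul

end TwistedYD

/-! ### Identities for the slant cochains. -/

namespace ThreeCocycle

variable {k : Type u} [Field k] {G : Type v} [CommGroup G]

/-- Alternating product of the four cocycle conditions in which `e` is inserted in each possible
position among `f`, `g`, `h`; commutativity of `G` lets `e` move through the products. -/
theorem slant_cocycle (Φ : ThreeCocycle k G) (e f g h : G) :
    Φ.slant e (f * g) h * Φ.slant e f g = Φ.slant e f (g * h) * Φ.slant e g h := by
  have h1 := Φ.cocycle e f g h
  have h2 := Φ.cocycle f e g h
  have h3 := Φ.cocycle f g e h
  have h4 := Φ.cocycle f g h e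
  rw [mul_comm f e] at h2
  rw [mul_comm g e] at h3
  rw [mul_comm h e] at h4
  replace h1 := congrArg Additive.ofMul h1
  replace h2 := congrArg Additive.ofMul h2
  replace h3 := congrArg Additive.ofMul h3
  replace h4 := congrArg Additive.ofMul h4
  apply Additive.ofMul.injective
  simp only [slant, ofMul_mul, ofMul_div] at *
  linear_combination (norm := module) -h1 + h2 - h3 + h4

/-- Both sides cancel to `Φ e g f * Φ f g e`, without the cocycle condition. The identity accounts
for exchanging two successive actions. -/
theorem slant_swap (Φ : ThreeCocycle k G) (e f g : G) :
    Φ.slant e f g * Φ.slant f e g = Φ.slant e g f * Φ.slant f g e := by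
  apply Additive.ofMul.injective
  simp only [slant, ofMul_mul, ofMul_div]
  module

end ThreeCocycle

namespace TwistedYD

/-! ### Compatibility of coproduct and antipode with grading and action. -/

section HopfStructure

variable {k : Type u} [Field k] {G : Type v} [CommGroup G] [Fintype G] [DecidableEq G]
  {Φ : ThreeCocycle k G}

theorem comul_one (V : TwistedYD Φ) : V.comul V.one = V.one ⊗ₜ V.one := by
  rw [comul, ← incl_unitPow, ofComponents_incl]
  exact one_smul _ _

theorem antipode_one (V : TwistedYD Φ) : V.antipode V.one = V.one := by
  rw [antipode, ← incl_unitPow, ofComponents_incl]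
  exact one_smul _ _

/-- Multiplication by `v ⊗ 1 + 1 ⊗ v` from the right in the braided tensor square. -/
def comulStep (V : TwistedYD Φ) (v : V) :
    V.tensorAlg ⊗[k] V.tensorAlg →ₗ[k] V.tensorAlg ⊗[k] V.tensorAlg :=
  ∑ g, TensorProduct.map (V.rightMul (V.act g v)) (V.tensorAlg.proj g) +
    TensorProduct.map LinearMap.id (V.rightMul v)

theorem comulStep_tmul (V : TwistedYD Φ) (v : V) {d : G} (x : V.tensorAlg) {y : V.tensorAlg}
    (hy : V.tensorAlg.proj d y = y) :
    V.comulStep v (x ⊗ₜ y) = V.rightMul (V.act d v) x ⊗ₜ y + x ⊗ₜ V.rightMul v y := by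
  simp only [comulStep, LinearMap.add_apply, LinearMap.sum_apply, TensorProduct.map_tmul,
    LinearMap.id_apply]
  congr 1
  rw [Finset.sum_eq_single d]
  · rw [hy]
  · intro b _ hb
    rw [← hy, proj_proj, if_neg hb, TensorProduct.tmul_zero]
  · simp

section Supported

variable {S : Subgroup G} (hΦ : Φ.IsTrivialOn S) {V : TwistedYD Φ} (hV : V.IsSupportedOn S)
include hΦ hV

theorem mulTwo_tmul (x y z w : V.tensorAlg) :
    V.mulTwo ((x ⊗ₜ y) ⊗ₜ (z ⊗ₜ w)) =
      ∑ g, V.mul x (V.tensorAlg.act g z) ⊗ₜ V.mul (V.tensorAlg.proj g y) w := by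
  rw [mulTwo, LinearMap.comp_apply,
    middleSwap_tmul hΦ hV.tensorAlg hV.tensorAlg hV.tensorAlg hV.tensorAlg, map_sum]
  simp [mulTensor]

theorem mulTwo_comulGen (v : V) (s : V.tensorAlg ⊗[k] V.tensorAlg) :
    V.mulTwo (s ⊗ₜ V.comulGen v) = V.comulStep v s := by
  induction s using TensorProduct.induction_on with
  | zero => simp
  | add s t hs ht => rw [TensorProduct.add_tmul, map_add, map_add, hs, ht]
  | tmul x y =>
    have h1 : V.comulGen v = V.gen v ⊗ₜ V.one + V.one ⊗ₜ V.gen v := rfl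
    rw [h1, TensorProduct.tmul_add, map_add, mulTwo_tmul hΦ hV, mulTwo_tmul hΦ hV]
    simp only [act_gen, act_one_tensorAlg, mul_one_right, comulStep, LinearMap.add_apply,
      LinearMap.sum_apply, TensorProduct.map_tmul, LinearMap.id_apply]
    congr 1
    rw [← TensorProduct.tmul_sum]
    conv_rhs => rw [← V.tensorAlg.sum_proj y, map_sum]
    rfl

/-- The multiplicativity of the coproduct in the one case that is needed: appending a letter. -/
theorem comul_rightMul (v : V) (t : V.tensorAlg) :
    V.comul (V.rightMul v t) = V.comulStep v (V.comul t) := by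
  have : V.comul ∘ₗ V.rightMul v = V.comulStep v ∘ₗ V.comul := by
    refine V.hom_ext_incl fun n x => ?_
    simp only [LinearMap.comp_apply]
    rw [rightMul_incl hΦ hV, comul, ofComponents_incl, ofComponents_incl,
      ← mulTwo_comulGen hΦ hV]
    rfl
  exact LinearMap.congr_fun this t

theorem antipode_rightMul (v : V) (t : V.tensorAlg) :
    V.antipode (V.rightMul v t) =
      -∑ g, V.leftMul (V.act g v) (V.tensorAlg.proj g (V.antipode t)) := by
  have : V.antipode ∘ₗ V.rightMul v =
      -(∑ g, V.leftMul (V.act g v) ∘ₗ V.tensorAlg.proj g) ∘ₗ V.antipode := by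
    refine V.hom_ext_incl fun n x => ?_
    simp only [LinearMap.comp_apply, LinearMap.neg_apply]
    rw [rightMul_incl hΦ hV, antipode, ofComponents_incl, ofComponents_incl]
    change V.mulTensor (braiding V.tensorAlg V.tensorAlg (V.antipodePow n x ⊗ₜ (-V.gen v))) = _
    simp [braiding, mulTensor, act_gen, leftMul]
  simpa using LinearMap.congr_fun this t

/-- Refines `eq_top_of_one_mem` by keeping track of the degree, on which the slant scalars depend.
-/
theorem homogeneous_induction {p : G → V.tensorAlg → Prop} (one : p 1 V.one)
    (zero : ∀ g, p g 0) (add : ∀ g s t, p g s → p g t → p g (s + t))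
    (smul : ∀ g (c : k) t, p g t → p g (c • t))
    (rightMul : ∀ g a v t, V.proj a v = v → V.tensorAlg.proj g t = t → p g t →
      p (g * a) (V.rightMul v t)) (g : G) (t : V.tensorAlg) (ht : V.tensorAlg.proj g t = t) :
    p g t := by
  -- A predicate on homogeneous elements does not itself define a subspace; imposing it on every
  -- component of `t` does.
  let U : Submodule k V.tensorAlg :=
    { carrier := {t | ∀ g, p g (V.tensorAlg.proj g t)}
      add_mem' := fun hs ht g => by rw [map_add]; exact add g _ _ (hs g) (ht g)
      zero_mem' := fun g => by rw [map_zero]; exact zero g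
      smul_mem' := fun c t ht g => by rw [map_smul]; exact smul g c _ (ht g) }
  have hU : U = ⊤ := by
    refine eq_top_of_one_mem hΦ hV (fun g => ?_) fun v t ht => ?_
    · rw [proj_one]
      split_ifs with h
      · exact h ▸ one
      · exact zero g
    · rw [← V.sum_proj v, rightMul_sum, LinearMap.sum_apply]
      refine U.sum_mem fun a _ g => ?_
      have hv := V.proj_proj_self a v
      rw [proj_rightMul hΦ hV g hv]
      have := rightMul (g * a⁻¹) a _ _ hv (V.tensorAlg.proj_proj_self _ t) (ht _)
      rwa [inv_mul_cancel_right] at this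
  have : t ∈ U := hU ▸ Submodule.mem_top
  exact ht ▸ this g

theorem proj_mul {g h : G} {s t : V.tensorAlg} (hs : V.tensorAlg.proj g s = s)
    (ht : V.tensorAlg.proj h t = t) : V.tensorAlg.proj (g * h) (V.mul s t) = V.mul s t := by
  refine homogeneous_induction hΦ hV
    (p := fun h t => V.tensorAlg.proj (g * h) (V.mul s t) = V.mul s t)
    ?_ (by simp) (fun g s t hs ht => by rw [map_add, map_add, hs, ht])
    (fun g c t ht => by rw [map_smul, map_smul, ht]) ?_ h t ht
  · rw [mul_one_right, mul_one, hs]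
  · intro h a v t hv _ ih
    rw [mul_rightMul hΦ hV, proj_rightMul hΦ hV _ hv, ← mul_assoc, mul_inv_cancel_right, ih]

theorem proj_gen {a : G} {v : V} (hv : V.proj a v = v) :
    V.tensorAlg.proj a (V.gen v) = V.gen v := by
  rw [← rightMul_one hΦ hV, proj_rightMul hΦ hV a hv, mul_inv_cancel, proj_one, if_pos rfl]

omit hΦ hV in
theorem proj_act (W : TwistedYD Φ) (e : G) {g : G} {t : W} (ht : W.proj g t = t) :
    W.proj g (W.act e t) = W.act e t := by
  rw [← W.act_proj, ht]

omit hΦ hV in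
theorem act_act_of_proj_eq (W : TwistedYD Φ) (e f : G) {g : G} {t : W} (ht : W.proj g t = t) :
    W.act e (W.act f t) = (Φ.slant g e f : k) • W.act (e * f) t := by
  have := W.act_act e f g t
  rwa [ht] at this

/-- By induction on the last letter of `t`; the scalars match because the slant of `e` is a
2-cocycle. -/
theorem act_mul (e : G) {g h : G} {s t : V.tensorAlg} (hs : V.tensorAlg.proj g s = s)
    (ht : V.tensorAlg.proj h t = t) : V.tensorAlg.act e (V.mul s t) =
      (Φ.slant e g h : k) • V.mul (V.tensorAlg.act e s) (V.tensorAlg.act e t) := by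
  refine homogeneous_induction hΦ hV
    (p := fun h t => V.tensorAlg.act e (V.mul s t) =
      (Φ.slant e g h : k) • V.mul (V.tensorAlg.act e s) (V.tensorAlg.act e t))
    ?_ (by simp) (fun g s t hs ht => by simp only [map_add, smul_add, hs, ht])
    (fun g c t ht => by simp only [map_smul, ht]; rw [smul_comm]) ?_ h t ht
  · rw [mul_one_right, act_one_tensorAlg, mul_one_right, Φ.slant_one_right, Units.val_one, one_smul]
  · intro h a v t hv ht ih
    rw [mul_rightMul hΦ hV, act_rightMul hΦ hV e hv (proj_mul hΦ hV hs ht), ih,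
      act_rightMul hΦ hV e hv ht, map_smul, map_smul, mul_rightMul hΦ hV, smul_smul, smul_smul]
    congr 1
    exact_mod_cast Φ.slant_cocycle e g h a

theorem comulStep_tensorProj {a : G} {v : V} (hv : V.proj a v = v) {g : G}
    {s : V.tensorAlg ⊗[k] V.tensorAlg} (hs : tensorProj V.tensorAlg V.tensorAlg g s = s) :
    tensorProj V.tensorAlg V.tensorAlg (g * a) (V.comulStep v s) = V.comulStep v s := by
  rw [← hs]
  clear hs
  induction s using tensor_induction with
  | h0 => simp
  | hadd s t hs ht => simp only [map_add, hs, ht]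
  | h c d x y =>
    rw [tensorProj_apply]
    split_ifs with hg
    · subst hg
      have hx := V.tensorAlg.proj_proj_self c x
      have hy := V.tensorAlg.proj_proj_self d y
      generalize V.tensorAlg.proj c x = x at *
      generalize V.tensorAlg.proj d y = y at *
      rw [comulStep_tmul _ _ _ hy, map_add, tensorProj_tmul _ _ _ _ hy]
      have h1 : V.tensorAlg.proj (d * a) (V.rightMul v y) = V.rightMul v y := by
        rw [proj_rightMul hΦ hV _ hv, mul_inv_cancel_right, hy]
      rw [tensorProj_tmul _ _ _ _ h1, proj_rightMul hΦ hV _ (V.proj_act d hv),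
        mul_right_comm c d a, mul_inv_cancel_right, mul_inv_cancel_right, hx, mul_right_comm c a d,
        mul_assoc c d a, mul_inv_cancel_right, hx]
    · simp

theorem tensorAct_comulStep (e : G) {a : G} {v : V} (hv : V.proj a v = v) {g : G}
    {s : V.tensorAlg ⊗[k] V.tensorAlg} (hs : tensorProj V.tensorAlg V.tensorAlg g s = s) :
    tensorAct V.tensorAlg V.tensorAlg e (V.comulStep v s) =
      (Φ.slant e g a : k) •
        V.comulStep (V.act e v) (tensorAct V.tensorAlg V.tensorAlg e s) := by
  rw [← hs]
  clear hs
  induction s using tensor_induction with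
  | h0 => simp
  | hadd s t hs ht => simp only [map_add, hs, ht, smul_add]
  | h c d x y =>
    rw [tensorProj_apply]
    split_ifs with hg
    · subst hg
      have hx := V.tensorAlg.proj_proj_self c x
      have hy := V.tensorAlg.proj_proj_self d y
      generalize V.tensorAlg.proj c x = x at *
      generalize V.tensorAlg.proj d y = y at *
      have hdv := V.proj_act d hv
      have h1 : V.tensorAlg.proj (d * a) (V.rightMul v y) = V.rightMul v y := by
        rw [proj_rightMul hΦ hV _ hv, mul_inv_cancel_right, hy]
      have h2 : V.tensorAlg.proj (c * a) (V.rightMul (V.act d v) x) =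
          V.rightMul (V.act d v) x := by
        rw [proj_rightMul hΦ hV _ hdv, mul_inv_cancel_right, hx]
      rw [comulStep_tmul _ _ _ hy, map_add, tensorAct_tmul e h2 hy, tensorAct_tmul e hx h1,
        tensorAct_tmul e hx hy, map_smul, comulStep_tmul _ _ _ (V.tensorAlg.proj_act e hy),
        act_rightMul hΦ hV e hdv hx, act_rightMul hΦ hV e hv hy, V.act_act_of_proj_eq e d hv,
        V.act_act_of_proj_eq d e hv, mul_comm d e]
      simp only [rightMul_smul, LinearMap.smul_apply, TensorProduct.smul_tmul',
        TensorProduct.tmul_smul, smul_add, smul_smul]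
      -- In the first summand the letter passes `y`, so its scalars combine two instances of the
      -- cocycle identity with the exchange of the actions of `d` and `e`. In the second summand one
      -- cocycle identity is enough.
      congr 3
      · have h3 := Φ.slant_cocycle e c a d
        have h4 := Φ.slant_cocycle e c d a
        have h5 := Φ.slant_swap e a d
        rw [mul_comm a d] at h3
        have : Φ.slant e (c * a) d * Φ.slant e c a * Φ.slant a e d =
            Φ.slant e (c * d) a * Φ.slant e c d * Φ.slant a d e := by
          rw [h3, h4, mul_assoc, h5, mul_assoc]
        rw [← mul_assoc, ← mul_assoc]
        exact_mod_cast this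
      · exact_mod_cast (Φ.slant_cocycle e c d a).symm
    · simp

theorem tensorProj_comul {g : G} {t : V.tensorAlg} (ht : V.tensorAlg.proj g t = t) :
    tensorProj V.tensorAlg V.tensorAlg g (V.comul t) = V.comul t := by
  refine homogeneous_induction hΦ hV
    (p := fun g t => tensorProj V.tensorAlg V.tensorAlg g (V.comul t) = V.comul t)
    ?_ (by simp) (fun g s t hs ht => by rw [map_add, map_add, hs, ht])
    (fun g c t ht => by rw [map_smul, map_smul, ht]) ?_ g t ht
  · have h1 : V.tensorAlg.proj 1 V.one = V.one := by rw [proj_one, if_pos rfl]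
    rw [comul_one, tensorProj_tmul _ _ _ _ h1, inv_one, mul_one, h1]
  · intro g a v t hv _ ih
    rw [comul_rightMul hΦ hV, comulStep_tensorProj hΦ hV hv ih]

/-- Equivariance is needed for every `e` in `G`, not only in `S`: it carries coideals to coideals
under the third generator. -/
theorem tensorAct_comul (e : G) (t : V.tensorAlg) :
    tensorAct V.tensorAlg V.tensorAlg e (V.comul t) = V.comul (V.tensorAlg.act e t) := by
  rw [← V.tensorAlg.sum_proj t]
  simp only [map_sum]
  refine Finset.sum_congr rfl fun g _ => ?_
  refine homogeneous_induction hΦ hV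
    (p := fun g t => tensorAct V.tensorAlg V.tensorAlg e (V.comul t) =
      V.comul (V.tensorAlg.act e t))
    ?_ (by simp) (fun g s t hs ht => by simp only [map_add, hs, ht])
    (fun g c t ht => by simp only [map_smul, ht]) ?_ g _ (V.tensorAlg.proj_proj_self g t)
  · have h1 : V.tensorAlg.proj 1 V.one = V.one := by rw [proj_one, if_pos rfl]
    rw [comul_one, tensorAct_tmul e h1 h1, act_one_tensorAlg, comul_one, Φ.slant_one_right,
      Units.val_one, one_smul]
  · intro g a v t hv ht ih
    rw [comul_rightMul hΦ hV, tensorAct_comulStep hΦ hV e hv (tensorProj_comul hΦ hV ht), ih,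
      act_rightMul hΦ hV e hv ht, map_smul, comul_rightMul hΦ hV]

theorem proj_antipode {g : G} {t : V.tensorAlg} (ht : V.tensorAlg.proj g t = t) :
    V.tensorAlg.proj g (V.antipode t) = V.antipode t := by
  refine homogeneous_induction hΦ hV
    (p := fun g t => V.tensorAlg.proj g (V.antipode t) = V.antipode t)
    ?_ (by simp) (fun g s t hs ht => by rw [map_add, map_add, hs, ht])
    (fun g c t ht => by rw [map_smul, map_smul, ht]) ?_ g t ht
  · rw [antipode_one, proj_one, if_pos rfl]
  · intro g a v t hv ht ih
    rw [antipode_rightMul hΦ hV, map_neg, map_sum]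
    congr 1
    refine Finset.sum_congr rfl fun b _ => ?_
    by_cases hb : b = g
    · subst hb
      rw [ih, mul_comm]
      exact proj_mul hΦ hV (proj_gen hΦ hV (V.proj_act b hv)) ih
    · rw [← ih, proj_proj, if_neg hb, map_zero, map_zero]

theorem antipode_rightMul_of_proj_eq {g : G} (v : V) {t : V.tensorAlg}
    (ht : V.tensorAlg.proj g t = t) :
    V.antipode (V.rightMul v t) = -V.leftMul (V.act g v) (V.antipode t) := by
  have h := proj_antipode hΦ hV ht
  rw [antipode_rightMul hΦ hV, Finset.sum_eq_single g]
  · rw [h]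
  · intro b _ hb
    rw [← h, proj_proj, if_neg hb, map_zero]
  · simp

/-- The antipode puts `g ▷ v` in front of the image of a word of degree `g`; the scalars produced by
the reversed order and by `e ▷ (g ▷ v)` agree by `slant_swap`. -/
theorem act_antipode (e : G) (t : V.tensorAlg) :
    V.tensorAlg.act e (V.antipode t) = V.antipode (V.tensorAlg.act e t) := by
  rw [← V.tensorAlg.sum_proj t]
  simp only [map_sum]
  refine Finset.sum_congr rfl fun g _ => ?_
  refine homogeneous_induction hΦ hV
    (p := fun g t => V.tensorAlg.act e (V.antipode t) = V.antipode (V.tensorAlg.act e t))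
    ?_ (by simp) (fun g s t hs ht => by simp only [map_add, hs, ht])
    (fun g c t ht => by simp only [map_smul, ht]) ?_ g _ (V.tensorAlg.proj_proj_self g t)
  · rw [antipode_one, act_one_tensorAlg, antipode_one]
  · intro g a v t hv ht ih
    have hgv := proj_gen hΦ hV (V.proj_act g hv)
    rw [antipode_rightMul_of_proj_eq hΦ hV v ht, map_neg, leftMul,
      act_mul hΦ hV e hgv (proj_antipode hΦ hV ht), ih, act_rightMul hΦ hV e hv ht, map_smul,
      antipode_rightMul_of_proj_eq hΦ hV _ (V.tensorAlg.proj_act e ht), act_gen,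
      V.act_act_of_proj_eq e g hv, V.act_act_of_proj_eq g e hv, mul_comm g e, leftMul_smul,
      map_smul, map_smul, LinearMap.smul_apply, LinearMap.smul_apply, smul_neg, smul_smul,
      smul_smul]
    congr 2
    exact_mod_cast Φ.slant_swap e a g

end Supported

/-! ### Hopf ideals without stability under the action. -/

/-- The graded Hopf ideals with zero components in degrees `0` and `1` that are stable under the
projections onto the homogeneous components, but not necessarily under the action. -/
structure IsWeakHopfIdeal (V : TwistedYD Φ) (I : Submodule k V.tensorAlg) : Prop where
  proj_mem : ∀ (g : G), ∀ x ∈ I, V.tensorAlg.proj g x ∈ I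
  graded : ∀ x ∈ I, ∀ n, V.incl n (V.component n x) ∈ I
  component_zero : ∀ x ∈ I, V.component 0 x = 0
  component_one : ∀ x ∈ I, V.component 1 x = 0
  mul_left_mem : ∀ y, ∀ x ∈ I, V.mul y x ∈ I
  mul_right_mem : ∀ y, ∀ x ∈ I, V.mul x y ∈ I
  comul_mem : ∀ x ∈ I, V.comul x ∈
    LinearMap.range (I.subtype.rTensor V.tensorAlg) ⊔
      LinearMap.range (I.subtype.lTensor V.tensorAlg)
  antipode_mem : ∀ x ∈ I, V.antipode x ∈ I

theorem IsHopfIdeal.isWeakHopfIdeal {V : TwistedYD Φ} {I : Submodule k V.tensorAlg}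
    (h : V.IsHopfIdeal I) : V.IsWeakHopfIdeal I where
  proj_mem := h.isSubobject.proj_mem
  graded := h.graded
  component_zero := h.component_zero
  component_one := h.component_one
  mul_left_mem := h.mul_left_mem
  mul_right_mem := h.mul_right_mem
  comul_mem := h.comul_mem
  antipode_mem := h.antipode_mem

theorem component_act (V : TwistedYD Φ) (e : G) (n : ℕ) (x : V.tensorAlg) :
    V.component n (V.tensorAlg.act e x) = (V.tensorPow n).act e (V.component n x) :=
  DirectSum.lmap_apply (fun n => (V.tensorPow n).act e) x n

/-- The sum of the translates of a subspace of the tensor algebra under the action. -/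
def actSpan (V : TwistedYD Φ) (I : Submodule k V.tensorAlg) : Submodule k V.tensorAlg :=
  ⨆ g, I.map (V.tensorAlg.act g)

theorem act_mem_actSpan (V : TwistedYD Φ) {I : Submodule k V.tensorAlg} (g : G) {x : V.tensorAlg}
    (hx : x ∈ I) : V.tensorAlg.act g x ∈ V.actSpan I :=
  Submodule.mem_iSup_of_mem g (Submodule.mem_map_of_mem hx)

/-- Stability under the projections reduces statements about the span of translates to translates of
homogeneous elements, for which the slant scalars are defined. -/
theorem actSpan_induction {V : TwistedYD Φ} {I : Submodule k V.tensorAlg}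
    (hI : ∀ (g : G), ∀ x ∈ I, V.tensorAlg.proj g x ∈ I) {M : Type u} [AddCommGroup M] [Module k M]
    (F : V.tensorAlg →ₗ[k] M) (N : Submodule k M)
    (h : ∀ g a x, x ∈ I → V.tensorAlg.proj a x = x → F (V.tensorAlg.act g x) ∈ N) :
    ∀ x ∈ V.actSpan I, F x ∈ N := by
  have : V.actSpan I ≤ N.comap F := by
    refine iSup_le fun g => ?_
    rw [Submodule.map_le_iff_le_comap]
    intro x hx
    rw [Submodule.mem_comap, Submodule.mem_comap, ← V.tensorAlg.sum_proj x, map_sum, map_sum]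
    exact N.sum_mem fun a _ => h g a _ (hI a x hx) (V.tensorAlg.proj_proj_self a x)
  exact this

/-- On a homogeneous component `e` and `e⁻¹` act inversely up to a unit, so every homogeneous factor
can be written as a translate. -/
theorem exists_act_eq (W : TwistedYD Φ) (e : G) {b : G} {y : W} (hy : W.proj b y = y) :
    ∃ z, W.proj b z = z ∧ W.act e z = y := by
  refine ⟨((Φ.slant b e e⁻¹)⁻¹ : kˣ) • W.act e⁻¹ y, ?_, ?_⟩
  · rw [Units.smul_def, map_smul, W.proj_act e⁻¹ hy]
  · rw [Units.smul_def, map_smul, W.act_act_of_proj_eq _ _ hy, mul_inv_cancel, W.act_one,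
      smul_smul, Units.inv_mul, one_smul]

theorem tmul_mem_sup_left {M : Type u} [AddCommGroup M] [Module k M] {I : Submodule k M}
    {x : M} (hx : x ∈ I) (y : M) : x ⊗ₜ[k] y ∈ LinearMap.range (I.subtype.rTensor M) ⊔
      LinearMap.range (I.subtype.lTensor M) :=
  Submodule.mem_sup_left ⟨(⟨x, hx⟩ : I) ⊗ₜ y, rfl⟩

theorem tmul_mem_sup_right {M : Type u} [AddCommGroup M] [Module k M] {I : Submodule k M}
    {y : M} (hy : y ∈ I) (x : M) : x ⊗ₜ[k] y ∈ LinearMap.range (I.subtype.rTensor M) ⊔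
      LinearMap.range (I.subtype.lTensor M) :=
  Submodule.mem_sup_right ⟨x ⊗ₜ (⟨y, hy⟩ : I), rfl⟩

theorem tensorAct_mem_sup (V : TwistedYD Φ) {I : Submodule k V.tensorAlg}
    (hI : ∀ (g : G), ∀ x ∈ I, V.tensorAlg.proj g x ∈ I) (g : G) :
    LinearMap.range (I.subtype.rTensor V.tensorAlg) ⊔
        LinearMap.range (I.subtype.lTensor V.tensorAlg) ≤
      (LinearMap.range ((V.actSpan I).subtype.rTensor V.tensorAlg) ⊔
        LinearMap.range ((V.actSpan I).subtype.lTensor V.tensorAlg)).comap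
          (tensorAct V.tensorAlg V.tensorAlg g) := by
  refine sup_le ?_ ?_
  · rintro _ ⟨s, rfl⟩
    induction s using TensorProduct.induction_on with
    | zero => rw [map_zero]; exact Submodule.zero_mem _
    | add s t hs ht => rw [map_add]; exact Submodule.add_mem _ hs ht
    | tmul x y =>
      simp only [Submodule.mem_comap, LinearMap.rTensor_tmul, Submodule.subtype_apply, tensorAct,
        LinearMap.sum_apply, LinearMap.smul_apply, TensorProduct.map_tmul, LinearMap.comp_apply]
      exact Submodule.sum_mem _ fun a _ => Submodule.sum_mem _ fun b _ => Submodule.smul_mem _ _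
        (tmul_mem_sup_left (V.act_mem_actSpan g (hI a _ x.2)) _)
  · rintro _ ⟨s, rfl⟩
    induction s using TensorProduct.induction_on with
    | zero => rw [map_zero]; exact Submodule.zero_mem _
    | add s t hs ht => rw [map_add]; exact Submodule.add_mem _ hs ht
    | tmul x y =>
      simp only [Submodule.mem_comap, LinearMap.lTensor_tmul, Submodule.subtype_apply, tensorAct,
        LinearMap.sum_apply, LinearMap.smul_apply, TensorProduct.map_tmul, LinearMap.comp_apply]
      exact Submodule.sum_mem _ fun a _ => Submodule.sum_mem _ fun b _ => Submodule.smul_mem _ _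
        (tmul_mem_sup_right (V.act_mem_actSpan g (hI b _ y.2)) _)

/-- Group elements commute with all structure maps up to units, so each closure property of `I`
passes to its translates. The composite of two actions is again one action up to a unit, which gives
the missing stability. -/
theorem IsWeakHopfIdeal.isHopfIdeal_actSpan {S : Subgroup G} (hΦ : Φ.IsTrivialOn S)
    {V : TwistedYD Φ} (hV : V.IsSupportedOn S) {I : Submodule k V.tensorAlg}
    (hI : V.IsWeakHopfIdeal I) : V.IsHopfIdeal (V.actSpan I) := by
  have hzero : ∀ x ∈ V.actSpan I, V.component 0 x = 0 := by
    refine actSpan_induction hI.proj_mem (V.component 0) ⊥ fun g a x hx _ => ?_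
    rw [component_act, hI.component_zero x hx, map_zero]
    exact Submodule.zero_mem _
  refine ⟨⟨fun b => ?_, fun e => ?_⟩, fun x hx n => ?_, hzero, ?_, fun y => ?_, fun y => ?_, ?_,
    hzero, ?_⟩
  · refine actSpan_induction hI.proj_mem (V.tensorAlg.proj b) _ fun g a x hx _ => ?_
    rw [← V.tensorAlg.act_proj]
    exact V.act_mem_actSpan g (hI.proj_mem b x hx)
  · refine actSpan_induction hI.proj_mem (V.tensorAlg.act e) _ fun g a x hx ha => ?_
    rw [V.tensorAlg.act_act_of_proj_eq e g ha]
    exact Submodule.smul_mem _ _ (V.act_mem_actSpan _ hx)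
  · refine actSpan_induction hI.proj_mem (V.incl n ∘ₗ V.component n) _ (fun g a x hx ha => ?_) x hx
    rw [LinearMap.comp_apply, component_act, ← act_incl]
    exact V.act_mem_actSpan g (hI.graded x hx n)
  · refine actSpan_induction hI.proj_mem (V.component 1) ⊥ fun g a x hx _ => ?_
    rw [component_act, hI.component_one x hx, map_zero]
    exact Submodule.zero_mem _
  · refine actSpan_induction hI.proj_mem (V.mul y) _ fun g a x hx ha => ?_
    rw [← V.tensorAlg.sum_proj y, map_sum, LinearMap.sum_apply]
    refine Submodule.sum_mem _ fun b _ => ?_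
    -- With `y_b = g ▷ z`, the product `y_b (g ▷ x)` is a nonzero multiple of `g ▷ (z x)`.
    obtain ⟨z, hz, hzy⟩ := V.tensorAlg.exists_act_eq g (V.tensorAlg.proj_proj_self b y)
    have h := act_mul hΦ hV g hz ha
    rw [← hzy, ← Submodule.smul_mem_iff _ (Units.ne_zero (Φ.slant g b a)), ← h]
    exact V.act_mem_actSpan g (hI.mul_left_mem z x hx)
  · refine actSpan_induction hI.proj_mem (V.mul.flip y) _ fun g a x hx ha => ?_
    rw [LinearMap.flip_apply, ← V.tensorAlg.sum_proj y, map_sum]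
    refine Submodule.sum_mem _ fun b _ => ?_
    obtain ⟨z, hz, hzy⟩ := V.tensorAlg.exists_act_eq g (V.tensorAlg.proj_proj_self b y)
    have h := act_mul hΦ hV g ha hz
    rw [← hzy, ← Submodule.smul_mem_iff _ (Units.ne_zero (Φ.slant g a b)), ← h]
    exact V.act_mem_actSpan g (hI.mul_right_mem z x hx)
  · refine actSpan_induction hI.proj_mem V.comul _ fun g a x hx ha => ?_
    rw [← tensorAct_comul hΦ hV]
    exact V.tensorAct_mem_sup hI.proj_mem g (hI.comul_mem x hx)
  · refine actSpan_induction hI.proj_mem V.antipode _ fun g a x hx ha => ?_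
    rw [← act_antipode hΦ hV]
    exact V.act_mem_actSpan g (hI.antipode_mem x hx)

/-- The Nichols ideal can thus be detected without testing the action, which is what makes modules
with different actions comparable. -/
theorem IsWeakHopfIdeal.le_nicholsIdeal {S : Subgroup G} (hΦ : Φ.IsTrivialOn S)
    {V : TwistedYD Φ} (hV : V.IsSupportedOn S) {I : Submodule k V.tensorAlg}
    (hI : V.IsWeakHopfIdeal I) : I ≤ V.nicholsIdeal := by
  refine le_trans (fun x hx => ?_) (le_sSup (hI.isHopfIdeal_actSpan hΦ hV))
  have := V.act_mem_actSpan 1 hx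
  rwa [V.tensorAlg.act_one] at this

end HopfStructure

end TwistedYD

namespace TwistedYD

/-! ### Comparison of Nichols algebras over two cocycles. -/

section Comparison

variable {k : Type u} [Field k] {G : Type v} [CommGroup G] [Fintype G] [DecidableEq G]
  {Φ Ψ : ThreeCocycle k G}

/-- The isomorphism of tensor powers induced by a linear isomorphism. -/
def tensorPowCongr {V : TwistedYD Φ} {W : TwistedYD Ψ} (f : V ≃ₗ[k] W) :
    ∀ n, V.tensorPow n ≃ₗ[k] W.tensorPow n
  | 0 => LinearEquiv.refl k k
  | n + 1 => TensorProduct.congr (tensorPowCongr f n) f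

/-- The isomorphism of tensor algebras induced by a linear isomorphism. -/
def tensorAlgCongr {V : TwistedYD Φ} {W : TwistedYD Ψ} (f : V ≃ₗ[k] W) :
    V.tensorAlg ≃ₗ[k] W.tensorAlg :=
  LinearEquiv.ofLinearMap (V.ofComponents fun n => W.incl n ∘ₗ (tensorPowCongr f n).toLinearMap)
    (W.ofComponents fun n => V.incl n ∘ₗ (tensorPowCongr f n).symm.toLinearMap)
    (W.hom_ext_incl fun n x => by simp [ofComponents_incl])
    (V.hom_ext_incl fun n x => by simp [ofComponents_incl])

/-- Linear isomorphisms of tensor algebras that are compatible with all structure maps except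
possibly the action. -/
structure IsTensorAlgIso {V : TwistedYD Φ} {W : TwistedYD Ψ} (E : V.tensorAlg ≃ₗ[k] W.tensorAlg) :
    Prop where
  proj : ∀ g x, E (V.tensorAlg.proj g x) = W.tensorAlg.proj g (E x)
  incl_component : ∀ n x, E (V.incl n (V.component n x)) = W.incl n (W.component n (E x))
  mul : ∀ x y, E (V.mul x y) = W.mul (E x) (E y)
  comul : ∀ x, TensorProduct.map E.toLinearMap E.toLinearMap (V.comul x) = W.comul (E x)
  antipode : ∀ x, E (V.antipode x) = W.antipode (E x)

theorem incl_injective (V : TwistedYD Φ) (n : ℕ) : Function.Injective (V.incl n) :=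
  Function.LeftInverse.injective (g := V.component n) (V.component_incl_self n)

namespace IsTensorAlgIso

variable {V : TwistedYD Φ} {W : TwistedYD Ψ} {E : V.tensorAlg ≃ₗ[k] W.tensorAlg}

theorem symm (hE : IsTensorAlgIso E) : IsTensorAlgIso E.symm where
  proj g x := by rw [E.symm_apply_eq, hE.proj, E.apply_symm_apply]
  incl_component n x := by rw [E.symm_apply_eq, hE.incl_component, E.apply_symm_apply]
  mul x y := by rw [E.symm_apply_eq, hE.mul, E.apply_symm_apply, E.apply_symm_apply]
  comul x := by
    have h := hE.comul (E.symm x)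
    rw [E.apply_symm_apply] at h
    rw [← h, ← LinearMap.comp_apply, ← TensorProduct.map_comp]
    simp
  antipode x := by rw [E.symm_apply_eq, hE.antipode, E.apply_symm_apply]

theorem component_eq_zero (hE : IsTensorAlgIso E) {n : ℕ} {x : V.tensorAlg}
    (hx : V.component n x = 0) : W.component n (E x) = 0 := by
  apply W.incl_injective n
  rw [← hE.incl_component, hx, map_zero, map_zero, map_zero]

theorem isWeakHopfIdeal_map (hE : IsTensorAlgIso E) {I : Submodule k V.tensorAlg}
    (hI : V.IsWeakHopfIdeal I) : W.IsWeakHopfIdeal (I.map E.toLinearMap) where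
  proj_mem := by
    rintro g _ ⟨x, hx, rfl⟩
    exact ⟨_, hI.proj_mem g x hx, hE.proj g x⟩
  graded := by
    rintro _ ⟨x, hx, rfl⟩ n
    exact ⟨_, hI.graded x hx n, hE.incl_component n x⟩
  component_zero := by
    rintro _ ⟨x, hx, rfl⟩
    exact hE.component_eq_zero (hI.component_zero x hx)
  component_one := by
    rintro _ ⟨x, hx, rfl⟩
    exact hE.component_eq_zero (hI.component_one x hx)
  mul_left_mem := by
    rintro y _ ⟨x, hx, rfl⟩
    obtain ⟨y, rfl⟩ := E.surjective y
    exact ⟨_, hI.mul_left_mem y x hx, hE.mul y x⟩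
  mul_right_mem := by
    rintro y _ ⟨x, hx, rfl⟩
    obtain ⟨y, rfl⟩ := E.surjective y
    exact ⟨_, hI.mul_right_mem y x hx, hE.mul x y⟩
  comul_mem := by
    rintro _ ⟨x, hx, rfl⟩
    have key : LinearMap.range (I.subtype.rTensor V.tensorAlg) ⊔
        LinearMap.range (I.subtype.lTensor V.tensorAlg) ≤
        (LinearMap.range ((I.map E.toLinearMap).subtype.rTensor W.tensorAlg) ⊔
          LinearMap.range ((I.map E.toLinearMap).subtype.lTensor W.tensorAlg)).comap
            (TensorProduct.map E.toLinearMap E.toLinearMap) := by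
      refine sup_le ?_ ?_ <;> rintro _ ⟨s, rfl⟩ <;> induction s using TensorProduct.induction_on with
      | zero => rw [map_zero]; exact Submodule.zero_mem _
      | add s t hs ht => rw [map_add]; exact Submodule.add_mem _ hs ht
      | tmul x y => ?_
      · exact tmul_mem_sup_left (Submodule.mem_map_of_mem x.2) _
      · exact tmul_mem_sup_right (Submodule.mem_map_of_mem y.2) _
    have := key (hI.comul_mem x hx)
    rw [Submodule.mem_comap, hE.comul] at this
    exact this
  antipode_mem := by
    rintro _ ⟨x, hx, rfl⟩
    exact ⟨_, hI.antipode_mem x hx, hE.antipode x⟩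

/-- The Nichols ideal is the largest weak Hopf ideal on either side, and `E` matches the weak Hopf
ideals; equivariance of `E` is not required. -/
theorem map_nicholsIdeal {S T : Subgroup G} (hΦ : Φ.IsTrivialOn S) (hΨ : Ψ.IsTrivialOn T)
    (hV : V.IsSupportedOn S) (hW : W.IsSupportedOn T) (hE : IsTensorAlgIso E) :
    V.nicholsIdeal.map E.toLinearMap = W.nicholsIdeal := by
  apply le_antisymm
  · exact (hE.isWeakHopfIdeal_map V.nicholsIdeal_isHopfIdeal.isWeakHopfIdeal).le_nicholsIdeal hΨ hW
  · intro x hx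
    exact ⟨E.symm x, (hE.symm.isWeakHopfIdeal_map
      W.nicholsIdeal_isHopfIdeal.isWeakHopfIdeal).le_nicholsIdeal hΦ hV ⟨x, hx, rfl⟩,
      E.apply_symm_apply x⟩

end IsTensorAlgIso

section Congr

variable {V : TwistedYD Φ} {W : TwistedYD Ψ} (f : V ≃ₗ[k] W)

theorem tensorAlgCongr_incl (n : ℕ) (x : V.tensorPow n) :
    tensorAlgCongr f (V.incl n x) = W.incl n (tensorPowCongr f n x) :=
  V.ofComponents_incl _ n x

theorem tensorAlgCongr_one : tensorAlgCongr f V.one = W.one :=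
  tensorAlgCongr_incl f 0 V.unitPow

theorem tensorAlgCongr_gen (v : V) : tensorAlgCongr f (V.gen v) = W.gen (f v) :=
  tensorAlgCongr_incl f 1 (V.snoc 0 V.unitPow v)

variable {S : Subgroup G} (hΦ : Φ.IsTrivialOn S) (hΨ : Ψ.IsTrivialOn S) (hV : V.IsSupportedOn S)
  (hW : W.IsSupportedOn S)
include hΦ hΨ hV hW

theorem tensorAlgCongr_rightMul (v : V) (t : V.tensorAlg) :
    tensorAlgCongr f (V.rightMul v t) = W.rightMul (f v) (tensorAlgCongr f t) := by
  have : (tensorAlgCongr f).toLinearMap ∘ₗ V.rightMul v =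
      W.rightMul (f v) ∘ₗ (tensorAlgCongr f).toLinearMap := by
    refine V.hom_ext_incl fun n x => ?_
    simp only [LinearMap.comp_apply, LinearEquiv.coe_coe]
    rw [rightMul_incl hΦ hV, tensorAlgCongr_incl, tensorAlgCongr_incl, rightMul_incl hΨ hW]
    rfl
  exact LinearMap.congr_fun this t

theorem tensorAlgCongr_mul (s t : V.tensorAlg) :
    tensorAlgCongr f (V.mul s t) = W.mul (tensorAlgCongr f s) (tensorAlgCongr f t) := by
  have : (tensorAlgCongr f).toLinearMap ∘ₗ V.mul s =
      W.mul (tensorAlgCongr f s) ∘ₗ (tensorAlgCongr f).toLinearMap := by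
    refine hom_ext_rightMul hΦ hV ?_ fun v t ht => ?_
    · simp [mul_one_right, tensorAlgCongr_one]
    · simp only [LinearMap.comp_apply, LinearEquiv.coe_coe] at ht ⊢
      rw [mul_rightMul hΦ hV, tensorAlgCongr_rightMul f hΦ hΨ hV hW,
        tensorAlgCongr_rightMul f hΦ hΨ hV hW, ht, mul_rightMul hΨ hW]
  exact LinearMap.congr_fun this t

/-- Braidings act only by degrees of vectors, and components of degree outside `S` vanish; hence `f`
has to commute with the action of `S` alone. -/
theorem isTensorAlgIso_congr (hproj : ∀ g v, f (V.proj g v) = W.proj g (f v))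
    (hact : ∀ g ∈ S, ∀ v, f (V.act g v) = W.act g (f v)) :
    IsTensorAlgIso (tensorAlgCongr f) := by
  have hp : ∀ g x, tensorAlgCongr f (V.tensorAlg.proj g x) =
      W.tensorAlg.proj g (tensorAlgCongr f x) := by
    intro g x
    rw [← V.tensorAlg.sum_proj x]
    simp only [map_sum]
    refine Finset.sum_congr rfl fun b _ => ?_
    have : W.tensorAlg.proj b (tensorAlgCongr f (V.tensorAlg.proj b x)) =
        tensorAlgCongr f (V.tensorAlg.proj b x) := by
      refine homogeneous_induction hΦ hV
        (p := fun b t => W.tensorAlg.proj b (tensorAlgCongr f t) = tensorAlgCongr f t)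
        ?_ (by simp) (fun g s t hs ht => by simp only [map_add, hs, ht])
        (fun g c t ht => by simp only [map_smul, ht]) ?_ b _ (V.tensorAlg.proj_proj_self b x)
      · rw [tensorAlgCongr_one, W.proj_one, if_pos rfl]
      · intro g a v t hv ht ih
        have hfv : W.proj a (f v) = f v := by rw [← hproj, hv]
        rw [tensorAlgCongr_rightMul f hΦ hΨ hV hW, proj_rightMul hΨ hW _ hfv,
          mul_inv_cancel_right, ih]
    rw [← this, W.tensorAlg.proj_proj, V.tensorAlg.proj_proj]
    split_ifs with h
    · rw [this]
    · rw [map_zero]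
  refine ⟨hp, ?_, tensorAlgCongr_mul f hΦ hΨ hV hW, ?_, ?_⟩
  · intro n x
    have : (tensorAlgCongr f).toLinearMap ∘ₗ V.incl n ∘ₗ V.component n =
        W.incl n ∘ₗ W.component n ∘ₗ (tensorAlgCongr f).toLinearMap := by
      refine V.hom_ext_incl fun m x => ?_
      simp only [LinearMap.comp_apply, LinearEquiv.coe_coe]
      by_cases h : m = n
      · subst h
        rw [component_incl_self, tensorAlgCongr_incl, component_incl_self]
      · rw [V.component_incl_of_ne h, tensorAlgCongr_incl f m, W.component_incl_of_ne h]
        simp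
    exact LinearMap.congr_fun this x
  · intro x
    have hstep : ∀ v s, TensorProduct.map (tensorAlgCongr f).toLinearMap
        (tensorAlgCongr f).toLinearMap (V.comulStep v s) = W.comulStep (f v)
          (TensorProduct.map (tensorAlgCongr f).toLinearMap (tensorAlgCongr f).toLinearMap s) := by
      intro v s
      induction s using TensorProduct.induction_on with
      | zero => simp
      | add s t hs ht => simp only [map_add, hs, ht]
      | tmul x y =>
        simp only [comulStep, LinearMap.add_apply, LinearMap.sum_apply, TensorProduct.map_tmul,
          LinearMap.id_apply, map_add, map_sum, LinearEquiv.coe_coe,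
          tensorAlgCongr_rightMul f hΦ hΨ hV hW, hp]
        congr 1
        refine Finset.sum_congr rfl fun g _ => ?_
        by_cases hg : g ∈ S
        · rw [hact g hg]
        · rw [hW.tensorAlg g hg]
          simp
    have : TensorProduct.map (tensorAlgCongr f).toLinearMap (tensorAlgCongr f).toLinearMap ∘ₗ
        V.comul = W.comul ∘ₗ (tensorAlgCongr f).toLinearMap := by
      refine hom_ext_rightMul hΦ hV ?_ fun v t ht => ?_
      · simp [comul_one, tensorAlgCongr_one]
      · simp only [LinearMap.comp_apply, LinearEquiv.coe_coe] at ht ⊢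
        rw [comul_rightMul hΦ hV, hstep, ht, tensorAlgCongr_rightMul f hΦ hΨ hV hW,
          comul_rightMul hΨ hW]
    exact LinearMap.congr_fun this x
  · intro x
    have : (tensorAlgCongr f).toLinearMap ∘ₗ V.antipode =
        W.antipode ∘ₗ (tensorAlgCongr f).toLinearMap := by
      refine hom_ext_rightMul hΦ hV ?_ fun v t ht => ?_
      · simp [antipode_one, tensorAlgCongr_one]
      · simp only [LinearMap.comp_apply, LinearEquiv.coe_coe] at ht ⊢
        rw [antipode_rightMul hΦ hV, tensorAlgCongr_rightMul f hΦ hΨ hV hW,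
          antipode_rightMul hΨ hW, map_neg, map_sum]
        congr 1
        refine Finset.sum_congr rfl fun g _ => ?_
        rw [leftMul, tensorAlgCongr_mul f hΦ hΨ hV hW, tensorAlgCongr_gen, hp, ht]
        by_cases hg : g ∈ S
        · rw [hact g hg, leftMul]
        · rw [hW.tensorAlg g hg]
          simp
    exact LinearMap.congr_fun this x

end Congr

theorem twistMul_one (W : TwistedYD Ψ) (x y : W.nichols) :
    twistMul W (fun _ _ => 1) x y = W.nicholsMul x y := by
  conv_rhs => rw [← W.nichols.sum_proj x, ← W.nichols.sum_proj y]
  simp only [twistMul, LinearMap.sum_apply, LinearMap.compl₁₂_apply,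
    Units.val_one, one_smul, map_sum]
  exact Finset.sum_comm

theorem twistComul_one (W : TwistedYD Ψ) (x : W.nichols) :
    twistComul W (fun _ _ => 1) x = W.nicholsComul x := by
  simp only [twistComul, LinearMap.sum_apply, LinearMap.comp_apply,
    Units.val_one, inv_one, one_smul]
  generalize W.nicholsComul x = s
  induction s using TensorProduct.induction_on with
  | zero => simp
  | add s t hs ht => simp only [map_add, Finset.sum_add_distrib, hs, ht]
  | tmul x y =>
    simp only [TensorProduct.map_tmul]
    exact (sum_proj_tmul _ _ x y).symm

theorem isTwistEquivalent_of_equiv {V : TwistedYD Φ} {W : TwistedYD Ψ} (f : V ≃ₗ[k] W)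
    {S : Subgroup G} (hΦ : Φ.IsTrivialOn S) (hΨ : Ψ.IsTrivialOn S) (hV : V.IsSupportedOn S)
    (hW : W.IsSupportedOn S) (hproj : ∀ g v, f (V.proj g v) = W.proj g (f v))
    (hact : ∀ g ∈ S, ∀ v, f (V.act g v) = W.act g (f v)) : IsTwistEquivalent V W := by
  have hE := isTensorAlgIso_congr f hΦ hΨ hV hW hproj hact
  let F : V.nichols ≃ₗ[k] W.nichols := Submodule.Quotient.equiv V.nicholsIdeal W.nicholsIdeal
    (tensorAlgCongr f) (hE.map_nicholsIdeal hΦ hΨ hV hW)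
  have hF : ∀ t, F (V.toNichols t) = W.toNichols (tensorAlgCongr f t) := fun _ => rfl
  -- The constant cochain is enough, since both cocycles are trivial where the modules live.
  refine ⟨fun _ _ => 1, fun _ => ⟨rfl, rfl⟩, f, F, fun v => ?_, fun x y => ?_, fun x => ?_⟩
  · rw [hF, tensorAlgCongr_gen]
  · obtain ⟨x, rfl⟩ := V.nicholsIdeal.mkQ_surjective x
    obtain ⟨y, rfl⟩ := V.nicholsIdeal.mkQ_surjective y
    rw [twistMul_one]
    exact congrArg W.toNichols (hE.mul x y)
  · obtain ⟨x, rfl⟩ := V.nicholsIdeal.mkQ_surjective x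
    rw [twistComul_one]
    have h1 : W.nicholsComul (F (V.toNichols x)) =
      TensorProduct.map W.toNichols W.toNichols (W.comul (tensorAlgCongr f x)) := rfl
    have h2 : V.nicholsComul (V.toNichols x) =
      TensorProduct.map V.toNichols V.toNichols (V.comul x) := rfl
    refine Eq.trans ?_ h1.symm
    refine (congrArg (TensorProduct.map F.toLinearMap F.toLinearMap) h2).trans ?_
    rw [← hE.comul]
    generalize V.comul x = s
    induction s using TensorProduct.induction_on with
    | zero => simp
    | add s t hs ht => simp only [map_add, hs, ht]
    | tmul x y => rfl

end Comparison

end TwistedYD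

/-! ### Algebras with the relations of type A₂ at −1. -/

section SkewCommutingRelations

theorem mul_mul_eq_neg {A : Type*} [Ring A] {x y z w : A} (h : x * y = -(z * w)) (t : A) :
    x * (y * t) = -(z * (w * t)) := by
  rw [← mul_assoc, h, neg_mul, mul_assoc]

theorem mul_mul_eq {A : Type*} [Ring A] {x y z w : A} (h : x * y = z * w) (t : A) :
    x * (y * t) = z * (w * t) := by
  rw [← mul_assoc, h, mul_assoc]

theorem mul_mul_eq_zero {A : Type*} [Ring A] {x y : A} (h : x * y = 0) (t : A) :
    x * (y * t) = 0 := by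
  rw [← mul_assoc, h, zero_mul]

theorem quartic_relation_mul {A : Type*} [Ring A] {x y : A}
    (h : y * x * y * x = -(x * y * x * y)) (t : A) :
    y * (x * (y * (x * t))) = -(x * (y * (x * (y * t)))) := by
  simpa only [mul_assoc, neg_mul] using congrArg (· * t) h

/-- The quartic relation of type `A₂` at `-1` is compatible with the comultiplication. -/
theorem quartic_relation_add {A : Type*} [Ring A] {x y z w : A}
    (hx : x * x = 0) (hy : y * y = 0) (hz : z * z = 0) (hw : w * w = 0)
    (hxy : y * x * y * x = -(x * y * x * y)) (hzw : w * z * w * z = -(z * w * z * w))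
    (hxz : x * z = -(z * x)) (hyw : y * w = -(w * y)) (hyz : y * z = -(z * y))
    (hxw : x * w = w * x) :
    (y + w) * (x + z) * (y + w) * (x + z) = -((x + z) * (y + w) * (x + z) * (y + w)) := by
  have hxy' : y * (x * (y * x)) = -(x * (y * (x * y))) := by simpa only [mul_assoc] using hxy
  have hzw' : w * (z * (w * z)) = -(z * (w * (z * w))) := by simpa only [mul_assoc] using hzw
  -- The rules move `z` and `w` to the left of `x` and `y`; the sums are then compared in normal
  -- form.
  simp only [mul_assoc, add_mul, mul_add, hx, hy, hxy', hzw', hxz, hyw, hyz, hxw,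
    mul_mul_eq_zero hz, mul_mul_eq_zero hw,
    mul_mul_eq_neg hxz, mul_mul_eq_neg hyw, mul_mul_eq_neg hyz, mul_mul_eq hxw,
    mul_neg, neg_mul, mul_zero, zero_mul, neg_zero, neg_neg]
  abel

/-- The quartic relation of type `A₂` at `-1` is compatible with the antipode. -/
theorem quartic_relation_mul_diagonal {A : Type*} [Ring A] {x y s t : A}
    (hxy : y * x * y * x = -(x * y * x * y)) (hst : t * s = s * t)
    (hsx : s * x = -(x * s)) (hty : t * y = -(y * t)) (htx : t * x = -(x * t))
    (hsy : s * y = y * s) :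
    (y * t) * (x * s) * (y * t) * (x * s) = -((x * s) * (y * t) * (x * s) * (y * t)) := by
  simp only [mul_assoc, hst, mul_mul_eq_neg hsx, mul_mul_eq_neg hty,
    mul_mul_eq_neg htx, mul_mul_eq hsy, mul_mul_eq hst, quartic_relation_mul hxy,
    mul_neg, neg_mul, neg_neg]

variable {k : Type*} [Field k] {A : Type*} [Ring A] [Algebra k A]

/-- The eight alternating monomials in `a` and `b` that span the algebra with the relations
`a² = b² = 0`, `b a b a = -a b a b`. -/
def alternatingMonomials (a b : A) : Set A :=
  {1, a, b, a * b, b * a, a * b * a, b * a * b, a * b * a * b}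

theorem mul_mem_span_alternatingMonomials {a b : A} (ha : a * a = 0) (hb : b * b = 0)
    (hab : b * a * b * a = -(a * b * a * b)) :
    ∀ m ∈ Submodule.span k (alternatingMonomials a b),
      a * m ∈ Submodule.span k (alternatingMonomials a b) ∧
      b * m ∈ Submodule.span k (alternatingMonomials a b) := by
  have hab' : b * (a * (b * a)) = -(a * (b * (a * b))) := by simpa only [mul_assoc] using hab
  -- Left multiplication by `b` kills the longest monomial: `babab = -(abab) b` contains `b²`.
  have h1 : b * (a * (b * (a * b))) = 0 := by
    rw [quartic_relation_mul hab, hb]; simp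
  have mem : ∀ w ∈ alternatingMonomials a b, w ∈ Submodule.span k (alternatingMonomials a b) :=
    fun w hw => Submodule.subset_span hw
  intro m hm
  induction hm using Submodule.span_induction with
  | zero => simp
  | add x y _ _ hx hy =>
    rw [mul_add, mul_add]
    exact ⟨Submodule.add_mem _ hx.1 hy.1, Submodule.add_mem _ hx.2 hy.2⟩
  | smul c x _ hx =>
    rw [mul_smul_comm, mul_smul_comm]
    exact ⟨Submodule.smul_mem _ c hx.1, Submodule.smul_mem _ c hx.2⟩
  | mem w hw =>
    simp only [alternatingMonomials, Set.mem_insert_iff, Set.mem_singleton_iff] at hw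
    rcases hw with rfl | rfl | rfl | rfl | rfl | rfl | rfl | rfl <;>
      simp only [mul_assoc, mul_one, ha, hb, mul_mul_eq_zero ha, mul_mul_eq_zero hb, hab', h1] <;>
      refine ⟨?_, ?_⟩ <;>
      first
      | exact Submodule.zero_mem _
      | exact Submodule.neg_mem _ (mem _ (by simp [alternatingMonomials, mul_assoc]))
      | exact mem _ (by simp [alternatingMonomials, mul_assoc])

/-- An element that skew-commutes with the letters skew-commutes with every word, with the product
of the scalars. -/
theorem exists_mul_eq_of_skew {a b x : A} (ha : ∃ c : k, x * a = c • (a * x))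
    (hb : ∃ c : k, x * b = c • (b * x)) :
    ∀ m ∈ Submodule.span k (alternatingMonomials a b),
      ∃ m' ∈ Submodule.span k (alternatingMonomials a b), x * m = m' * x := by
  have hmul : ∀ {u v : A}, (∃ c : k, x * u = c • (u * x)) → (∃ c : k, x * v = c • (v * x)) →
      ∃ c : k, x * (u * v) = c • (u * v * x) := by
    rintro u v ⟨c, hc⟩ ⟨d, hd⟩
    refine ⟨c * d, ?_⟩
    rw [← mul_assoc, hc, smul_mul_assoc, mul_assoc, hd, mul_smul_comm, smul_smul, mul_assoc]
  intro m hm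
  induction hm using Submodule.span_induction with
  | zero => exact ⟨0, Submodule.zero_mem _, by simp⟩
  | add u v _ _ hu hv =>
    obtain ⟨u', hu', hu⟩ := hu
    obtain ⟨v', hv', hv⟩ := hv
    exact ⟨u' + v', Submodule.add_mem _ hu' hv', by rw [mul_add, add_mul, hu, hv]⟩
  | smul c u _ hu =>
    obtain ⟨u', hu', hu⟩ := hu
    exact ⟨c • u', Submodule.smul_mem _ c hu', by rw [mul_smul_comm, smul_mul_assoc, hu]⟩
  | mem w hw =>
    have : ∃ c : k, x * w = c • (w * x) := by
      simp only [alternatingMonomials, Set.mem_insert_iff, Set.mem_singleton_iff] at hw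
      rcases hw with rfl | rfl | rfl | rfl | rfl | rfl | rfl | rfl
      · exact ⟨1, by simp⟩
      · exact ha
      · exact hb
      · exact hmul ha hb
      · exact hmul hb ha
      · exact hmul (hmul ha hb) ha
      · exact hmul (hmul hb ha) hb
      · exact hmul (hmul (hmul ha hb) ha) hb
    obtain ⟨c, hc⟩ := this
    exact ⟨c • w, Submodule.smul_mem _ c (Submodule.subset_span hw), by rw [hc, smul_mul_assoc]⟩

/-- The algebra generated by two skew-commuting pairs of elements that satisfy the relations of
type `A₂` at `-1` is finite-dimensional. -/
theorem exists_fg_submodule_of_two_pairs (r : Fin 4 → A) (hsq : ∀ i, r i * r i = 0)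
    (h01 : r 1 * r 0 * r 1 * r 0 = -(r 0 * r 1 * r 0 * r 1))
    (h23 : r 3 * r 2 * r 3 * r 2 = -(r 2 * r 3 * r 2 * r 3))
    (hskew : ∀ i ∈ ({0, 1} : Set (Fin 4)), ∀ j ∈ ({2, 3} : Set (Fin 4)),
      ∃ c : k, r i * r j = c • (r j * r i)) :
    ∃ M : Submodule k A, M.FG ∧ 1 ∈ M ∧ ∀ i, ∀ m ∈ M, r i * m ∈ M := by
  -- In `P * Q` the operators `r 2`, `r 3` act on the left factor `P`, while `r 0`, `r 1` first pass
  -- through `P` and then act on `Q`.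
  let P := Submodule.span k (alternatingMonomials (r 2) (r 3))
  let Q := Submodule.span k (alternatingMonomials (r 0) (r 1))
  have fg : ∀ a b : A, (Submodule.span k (alternatingMonomials a b)).FG := fun a b =>
    Submodule.fg_span (by simp [alternatingMonomials])
  have one : ∀ a b : A, 1 ∈ Submodule.span k (alternatingMonomials a b) := fun a b =>
    Submodule.subset_span (by simp [alternatingMonomials])
  have hP := mul_mem_span_alternatingMonomials (k := k) (hsq 2) (hsq 3) h23
  have hQ := mul_mem_span_alternatingMonomials (k := k) (hsq 0) (hsq 1) h01
  have left : ∀ x : A, (∀ m ∈ P, x * m ∈ P) → ∀ m ∈ P * Q, x * m ∈ P * Q := by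
    intro x hx m hm
    induction hm using Submodule.mul_induction_on' with
    | mem_mul_mem m hm n hn => rw [← mul_assoc]; exact Submodule.mul_mem_mul (hx m hm) hn
    | add u _ v _ hu hv => rw [mul_add]; exact Submodule.add_mem _ hu hv
  have right : ∀ x : A, (∀ m ∈ P, ∃ m' ∈ P, x * m = m' * x) → (∀ m ∈ Q, x * m ∈ Q) →
      ∀ m ∈ P * Q, x * m ∈ P * Q := by
    intro x hx hx' m hm
    induction hm using Submodule.mul_induction_on' with
    | mem_mul_mem m hm n hn =>
      obtain ⟨m', hm', h⟩ := hx m hm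
      rw [← mul_assoc, h, mul_assoc]
      exact Submodule.mul_mem_mul hm' (hx' n hn)
    | add u _ v _ hu hv => rw [mul_add]; exact Submodule.add_mem _ hu hv
  have skew : ∀ i ∈ ({0, 1} : Set (Fin 4)), ∀ m ∈ P, ∃ m' ∈ P, r i * m = m' * r i := fun i hi =>
    exists_mul_eq_of_skew (hskew i hi 2 (by simp)) (hskew i hi 3 (by simp))
  refine ⟨P * Q, (fg _ _).mul (fg _ _), ?_, fun i => ?_⟩
  · have := Submodule.mul_mem_mul (one (r 2) (r 3)) (one (r 0) (r 1))
    rwa [mul_one] at this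
  · fin_cases i
    · exact right _ (skew 0 (by simp)) fun m hm => (hQ m hm).1
    · exact right _ (skew 1 (by simp)) fun m hm => (hQ m hm).2
    · exact left _ fun m hm => (hP m hm).1
    · exact left _ fun m hm => (hP m hm).2

end SkewCommutingRelations

/-! ### The relations for operators, and their behaviour under coproduct and antipode. -/

section Relations

/-- The indices `i`, `j` are joined by an edge of the diagram. -/
def IsLinked (i j : Fin 4) : Prop := (i = 0 ∧ j = 1) ∨ (i = 2 ∧ j = 3)

/-- The indices `i`, `j` belong to the first and to the second copy of `A₂`. -/
def IsSeparated (i j : Fin 4) : Prop := (i = 0 ∨ i = 1) ∧ (j = 2 ∨ j = 3)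

/-- Structure constants with diagram two copies of `A₂` at `-1`. -/
structure IsTwoA2 {k : Type*} [Field k] (q : Fin 4 → Fin 4 → k) : Prop where
  diag : ∀ i, q i i = -1
  linked : ∀ i j, IsLinked i j → q i j = -1 ∧ q j i = 1
  separated : ∀ i j, IsSeparated i j → q i j * q j i = 1

/-- The relations of the Nichols algebra, for operators of right multiplication. -/
structure SatisfiesRelations {k : Type*} [Field k] {A : Type*} [Ring A] [Algebra k A]
    (q : Fin 4 → Fin 4 → k) (r : Fin 4 → A) : Prop where
  sq : ∀ i, r i * r i = 0
  separated : ∀ i j, IsSeparated i j → r j * r i = q i j • (r i * r j)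
  linked : ∀ i j, IsLinked i j → r j * r i * r j * r i = -(r i * r j * r i * r j)

variable {k : Type*} [Field k] {q : Fin 4 → Fin 4 → k}

theorem map_neg_left {M : Type*} [AddCommGroup M] [Module k M] (f g : Module.End k M) :
    (TensorProduct.map (-f) g : Module.End k (M ⊗[k] M)) = -TensorProduct.map f g :=
  TensorProduct.ext' fun x y => by simp [TensorProduct.neg_tmul]

theorem map_neg_right {M : Type*} [AddCommGroup M] [Module k M] (f g : Module.End k M) :
    (TensorProduct.map f (-g) : Module.End k (M ⊗[k] M)) = -TensorProduct.map f g :=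
  TensorProduct.ext' fun x y => by simp [TensorProduct.tmul_neg]

/-- These operators describe multiplication by `x_i ⊗ 1 + 1 ⊗ x_i` in the braided tensor square,
where `κ i` records the braiding. Both summands satisfy the relations, and moving one past the other
costs `q j i`; for squares the mixed terms cancel because `q i i = -1`, for separated indices they
match because `q i j * q j i = 1`. The quartic relation is `quartic_relation_add`. -/
theorem SatisfiesRelations.tensor {M : Type*} [AddCommGroup M] [Module k M]
    {r κ : Fin 4 → Module.End k M} (hq : IsTwoA2 q) (hr : SatisfiesRelations q r)
    (hκ : ∀ i j, κ i * κ j = κ j * κ i) (hκr : ∀ i j, κ i * r j = q j i • (r j * κ i)) :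
    SatisfiesRelations (A := Module.End k (M ⊗[k] M)) q
      (fun i => TensorProduct.map (r i) (κ i) + TensorProduct.map 1 (r i)) := by
  have h0 : ∀ i, (TensorProduct.map (r i) (κ i) : Module.End k (M ⊗[k] M)) *
      TensorProduct.map (r i) (κ i) = 0 := fun i => by
    rw [← TensorProduct.map_mul, hr.sq, TensorProduct.map_zero_left]
  have h0' : ∀ i, (TensorProduct.map 1 (r i) : Module.End k (M ⊗[k] M)) *
      TensorProduct.map 1 (r i) = 0 := fun i => by
    rw [← TensorProduct.map_mul, hr.sq, TensorProduct.map_zero_right]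
  have hXY : ∀ i j, (TensorProduct.map (r i) (κ i) : Module.End k (M ⊗[k] M)) *
      TensorProduct.map 1 (r j) =
        q j i • (TensorProduct.map 1 (r j) * TensorProduct.map (r i) (κ i)) := fun i j => by
    rw [← TensorProduct.map_mul, ← TensorProduct.map_mul, hκr, TensorProduct.map_smul_right,
      one_mul, mul_one]
  have neg_one_smul' : ∀ f : Module.End k (M ⊗[k] M), (-1 : k) • f = -f := fun f =>
    LinearMap.ext fun x => neg_one_smul k (f x)
  refine ⟨fun i => ?_, fun i j hij => ?_, fun i j hij => ?_⟩
  · rw [add_mul, mul_add, mul_add, h0, h0', hXY, hq.diag, zero_add, add_zero,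
      neg_one_smul', neg_add_cancel]
  · have h1 : (TensorProduct.map (r j) (κ j) : Module.End k (M ⊗[k] M)) *
        TensorProduct.map (r i) (κ i) =
          q i j • (TensorProduct.map (r i) (κ i) * TensorProduct.map (r j) (κ j)) := by
      rw [← TensorProduct.map_mul, ← TensorProduct.map_mul, hr.separated i j hij,
        TensorProduct.map_smul_left, hκ j i]
    have h2 : (TensorProduct.map 1 (r j) : Module.End k (M ⊗[k] M)) * TensorProduct.map 1 (r i) =
          q i j • (TensorProduct.map 1 (r i) * TensorProduct.map 1 (r j)) := by
      rw [← TensorProduct.map_mul, ← TensorProduct.map_mul, hr.separated i j hij,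
        TensorProduct.map_smul_right]
    simp only [add_mul, mul_add, h1, h2, hXY, smul_add, smul_smul, hq.separated i j hij, one_smul]
    abel
  · obtain ⟨h1, h2⟩ := hq.linked i j hij
    refine quartic_relation_add (h0 i) (h0 j) (h0' i) (h0' j) ?_ ?_ ?_ ?_ ?_ ?_
    · simp only [← TensorProduct.map_mul]
      have h3 : κ j * κ i * κ j * κ i = κ i * κ j * κ i * κ j := by
        rw [mul_assoc, hκ j i, ← mul_assoc]
      rw [hr.linked i j hij, h3, map_neg_left]
    · simp only [← TensorProduct.map_mul]
      rw [hr.linked i j hij, map_neg_right]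
    · rw [hXY, hq.diag, neg_one_smul']
    · rw [hXY, hq.diag, neg_one_smul']
    · rw [hXY, h1, neg_one_smul']
    · rw [hXY, h2, one_smul]

/-- The operators `-(l i * κ i)` describe the antipode on an appended letter. The hypotheses on `l`
are in the opposite order because left multiplications compose in the opposite order to right ones.
-/
theorem SatisfiesRelations.neg_mul_diagonal {A : Type*} [Ring A] [Algebra k A] {l κ : Fin 4 → A}
    (hq : IsTwoA2 q) (hsq : ∀ i, l i * l i = 0)
    (hsep : ∀ i j, IsSeparated i j → l i * l j = q i j • (l j * l i))
    (hlink : ∀ i j, IsLinked i j → l i * l j * l i * l j = -(l j * l i * l j * l i))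
    (hκ : ∀ i j, κ i * κ j = κ j * κ i) (hκl : ∀ i j, κ i * l j = q j i • (l j * κ i)) :
    SatisfiesRelations q (fun i => -(l i * κ i)) := by
  refine ⟨fun i => ?_, fun i j hij => ?_, fun i j hij => ?_⟩
  · rw [neg_mul_neg, mul_assoc, ← mul_assoc (κ i), hκl, smul_mul_assoc, mul_smul_comm, mul_assoc,
      ← mul_assoc, hsq, zero_mul, smul_zero]
  · rw [neg_mul_neg, neg_mul_neg, mul_assoc, ← mul_assoc (κ j), hκl, mul_assoc (l i),
      ← mul_assoc (κ i), hκl]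
    simp only [smul_mul_assoc, mul_smul_comm, smul_smul, hq.separated i j hij, one_smul]
    rw [mul_assoc (l i), ← mul_assoc, mul_assoc (l j) (κ i), ← mul_assoc (l i), hsep i j hij,
      smul_mul_assoc, hκ i j]
  · obtain ⟨h1, h2⟩ := hq.linked i j hij
    have := quartic_relation_mul_diagonal (x := l i) (y := l j) (s := κ i) (t := κ j)
      (by rw [hlink i j hij, neg_neg]) (hκ j i) (by rw [hκl, hq.diag, neg_one_smul])
      (by rw [hκl, hq.diag, neg_one_smul]) (by rw [hκl, h1, neg_one_smul])
      (by rw [hκl, h2, one_smul])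
    simpa only [neg_mul_neg, neg_mul, mul_neg, neg_neg] using this

end Relations

namespace TwistedYD

/-! ### Diagonal bases and the ideal of relations. -/

section DiagonalBasis

variable {k : Type u} [Field k] {G : Type v} [CommGroup G] [Fintype G] [DecidableEq G]
  {Φ : ThreeCocycle k G}

/-- A homogeneous basis, of degrees in the subgroup `S`, that diagonalizes the action of `S`. -/
structure DiagonalBasis (V : TwistedYD Φ) (S : Subgroup G) (q : Fin 4 → Fin 4 → k) where
  basis : Module.Basis (Fin 4) k V
  deg : Fin 4 → G
  deg_mem : ∀ i, deg i ∈ S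
  proj_basis : ∀ i, V.proj (deg i) (basis i) = basis i
  exists_act : ∀ g ∈ S, ∀ i, ∃ c : k, V.act g (basis i) = c • basis i
  act_basis : ∀ i j, V.act (deg i) (basis j) = q i j • basis j

namespace DiagonalBasis

variable {V : TwistedYD Φ} {S : Subgroup G} {q : Fin 4 → Fin 4 → k} (D : V.DiagonalBasis S q)

/-- Right multiplication by a basis element. -/
def right (i : Fin 4) : Module.End k V.tensorAlg := V.rightMul (D.basis i)

/-- Left multiplication by a basis element. -/
def left (i : Fin 4) : Module.End k V.tensorAlg := V.leftMul (D.basis i)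

/-- The character by which `S` acts on a basis element. -/
def char (i : Fin 4) (g : G) : k := D.basis.repr (V.act g (D.basis i)) i

/-- The diagonal operator with values of the character `char i`. -/
def diag (i : Fin 4) : Module.End k V.tensorAlg := ∑ g, D.char i g • V.tensorAlg.proj g

theorem act_basis_eq (i : Fin 4) {g : G} (hg : g ∈ S) :
    V.act g (D.basis i) = D.char i g • D.basis i := by
  obtain ⟨c, hc⟩ := D.exists_act g hg i
  simp [char, hc]

/-- On `S` the action has no slant scalar, so its eigenvalues multiply. -/
theorem char_mul (hΦ : Φ.IsTrivialOn S) (i j : Fin 4) {g : G} (hg : g ∈ S) :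
    D.char i (g * D.deg j) = D.char i g * q j i := by
  have h1 := V.act_act_of_proj_eq g (D.deg j) (D.proj_basis i)
  have h2 : Φ.slant (D.deg i) g (D.deg j) = 1 := by
    simp only [ThreeCocycle.slant, hΦ _ (D.deg_mem i) _ hg _ (D.deg_mem j),
      hΦ _ hg _ (D.deg_mem j) _ (D.deg_mem i), hΦ _ hg _ (D.deg_mem i) _ (D.deg_mem j)]
    simp
  rw [h2, Units.val_one, one_smul, D.act_basis, map_smul, D.act_basis_eq i hg] at h1
  rw [char, ← h1]
  simp [mul_comm]

theorem diag_mul_diag (i j : Fin 4) : D.diag i * D.diag j = D.diag j * D.diag i := by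
  refine LinearMap.ext fun x => ?_
  have h : ∀ i j, (D.diag i * D.diag j) x =
      ∑ g, (D.char i g * D.char j g) • V.tensorAlg.proj g x := fun i j => by
    rw [Module.End.mul_apply, diag, diag, LinearMap.sum_apply, LinearMap.sum_apply]
    refine Finset.sum_congr rfl fun g _ => ?_
    rw [LinearMap.smul_apply, map_sum, Finset.sum_eq_single g]
    · rw [LinearMap.smul_apply, map_smul, V.tensorAlg.proj_proj, if_pos rfl, smul_smul]
    · intro b _ hb
      rw [LinearMap.smul_apply, map_smul, V.tensorAlg.proj_proj, if_neg hb.symm, smul_zero]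
    · simp
  rw [h, h]
  simp [mul_comm]

theorem diag_apply_of_proj_eq (i : Fin 4) {g : G} {x : V.tensorAlg}
    (hx : V.tensorAlg.proj g x = x) : D.diag i x = D.char i g • x := by
  simp only [diag, LinearMap.sum_apply, LinearMap.smul_apply]
  rw [Finset.sum_eq_single g, hx]
  · intro b _ hb
    rw [← hx, V.tensorAlg.proj_proj, if_neg hb, smul_zero]
  · simp

theorem end_ext_proj {f g : Module.End k V.tensorAlg}
    (h : ∀ a x, V.tensorAlg.proj a x = x → f x = g x) : f = g := by
  refine LinearMap.ext fun x => ?_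
  rw [← V.tensorAlg.sum_proj x, map_sum, map_sum]
  exact Finset.sum_congr rfl fun a _ => h a _ (V.tensorAlg.proj_proj_self a x)

theorem mem_or_eq_zero (hV : V.IsSupportedOn S) {a : G} {x : V.tensorAlg}
    (hx : V.tensorAlg.proj a x = x) : a ∈ S ∨ x = 0 := by
  by_cases ha : a ∈ S
  · exact Or.inl ha
  · rw [hV.tensorAlg a ha] at hx
    exact Or.inr hx.symm

section Supported

variable (hΦ : Φ.IsTrivialOn S) (hV : V.IsSupportedOn S)
include hΦ hV

/-- Appending `x_j` shifts the degree by `deg j`, which multiplies the character of `x_i` by `q j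
i`. -/
theorem diag_mul_right (i j : Fin 4) : D.diag i * D.right j = q j i • (D.right j * D.diag i) := by
  refine end_ext_proj fun a x hx => ?_
  have h1 : V.tensorAlg.proj (a * D.deg j) (D.right j x) = D.right j x := by
    rw [right, proj_rightMul hΦ hV _ (D.proj_basis j), mul_inv_cancel_right, hx]
  rcases mem_or_eq_zero hV hx with ha | rfl
  · rw [Module.End.mul_apply, D.diag_apply_of_proj_eq i h1, LinearMap.smul_apply,
      Module.End.mul_apply, D.diag_apply_of_proj_eq i hx, map_smul, smul_smul,
      D.char_mul hΦ i j ha, mul_comm]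
  · simp

theorem diag_mul_left (i j : Fin 4) : D.diag i * D.left j = q j i • (D.left j * D.diag i) := by
  refine end_ext_proj fun a x hx => ?_
  have h1 : V.tensorAlg.proj (a * D.deg j) (D.left j x) = D.left j x := by
    rw [mul_comm]
    exact proj_mul hΦ hV (proj_gen hΦ hV (D.proj_basis j)) hx
  rcases mem_or_eq_zero hV hx with ha | rfl
  · rw [Module.End.mul_apply, D.diag_apply_of_proj_eq i h1, LinearMap.smul_apply,
      Module.End.mul_apply, D.diag_apply_of_proj_eq i hx, map_smul, smul_smul,
      D.char_mul hΦ i j ha, mul_comm]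
  · simp

theorem comul_right (i : Fin 4) (t : V.tensorAlg) : V.comul (D.right i t) =
    (TensorProduct.map (D.right i) (D.diag i) + TensorProduct.map 1 (D.right i) :
      Module.End k (V.tensorAlg ⊗[k] V.tensorAlg)) (V.comul t) := by
  rw [right, comul_rightMul hΦ hV]
  refine LinearMap.congr_fun ?_ _
  rw [comulStep, diag]
  congr 1
  refine TensorProduct.ext' fun x y => ?_
  simp only [LinearMap.sum_apply, TensorProduct.map_tmul, TensorProduct.tmul_sum]
  refine Finset.sum_congr rfl fun g _ => ?_
  by_cases hg : g ∈ S
  · rw [D.act_basis_eq i hg, rightMul_smul, LinearMap.smul_apply, LinearMap.smul_apply,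
      TensorProduct.tmul_smul, TensorProduct.smul_tmul']
  · rw [hV.tensorAlg g hg]
    simp

theorem antipode_right (i : Fin 4) (t : V.tensorAlg) :
    V.antipode (D.right i t) = -(D.left i * D.diag i) (V.antipode t) := by
  rw [right, antipode_rightMul hΦ hV, Module.End.mul_apply, diag, LinearMap.sum_apply, map_sum]
  congr 1
  refine Finset.sum_congr rfl fun g _ => ?_
  by_cases hg : g ∈ S
  · rw [D.act_basis_eq i hg, leftMul_smul, LinearMap.smul_apply, LinearMap.smul_apply, map_smul]
    rfl
  · rw [hV.tensorAlg g hg]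
    simp

end Supported

theorem rightMul_mem {U : Submodule k V.tensorAlg} (hU : ∀ i, ∀ t ∈ U, D.right i t ∈ U) (v : V)
    {t : V.tensorAlg} (ht : t ∈ U) : V.rightMul v t ∈ U := by
  rw [← D.basis.sum_repr v, rightMul_sum, LinearMap.sum_apply]
  refine Submodule.sum_mem _ fun i _ => ?_
  rw [rightMul_smul]
  exact U.smul_mem _ (hU i t ht)

/-- The right ideals of the tensor algebra that contain all left multiples of the relations. -/
structure ContainsRelations (U : Submodule k V.tensorAlg) : Prop where
  sq : ∀ i t, D.right i (D.right i t) ∈ U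
  separated : ∀ i j, IsSeparated i j → ∀ t,
    D.right j (D.right i t) - q i j • D.right i (D.right j t) ∈ U
  linked : ∀ i j, IsLinked i j → ∀ t,
    D.right j (D.right i (D.right j (D.right i t))) +
      D.right i (D.right j (D.right i (D.right j t))) ∈ U
  right_mem : ∀ i, ∀ t ∈ U, D.right i t ∈ U

/-- The ideal generated by the relations. -/
def relationIdeal : Submodule k V.tensorAlg := sInf {U | D.ContainsRelations U}

theorem containsRelations_relationIdeal : D.ContainsRelations D.relationIdeal where
  sq i t := Submodule.mem_sInf.2 fun _ hU => hU.sq i t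
  separated i j hij t := Submodule.mem_sInf.2 fun _ hU => hU.separated i j hij t
  linked i j hij t := Submodule.mem_sInf.2 fun _ hU => hU.linked i j hij t
  right_mem i t ht := Submodule.mem_sInf.2 fun U hU =>
    hU.right_mem i t (Submodule.mem_sInf.1 ht U hU)

/-- With `relationIdeal_le` this is a universal property: a map that carries right multiplications
to operators with the same relations kills the whole ideal of relations. Right multiplications
reverse order, so `r j * r i` stands for the word `x_i x_j`. -/
theorem containsRelations_ker {M : Type*} [AddCommGroup M] [Module k M] {r : Fin 4 → Module.End k M}
    (hr : SatisfiesRelations q r) (F : V.tensorAlg →ₗ[k] M)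
    (hF : ∀ i t, F (D.right i t) = r i (F t)) : D.ContainsRelations (LinearMap.ker F) where
  sq i t := by
    rw [LinearMap.mem_ker, hF, hF, ← Module.End.mul_apply, hr.sq, LinearMap.zero_apply]
  separated i j hij t := by
    rw [LinearMap.mem_ker, map_sub, map_smul, hF, hF, hF, hF, ← Module.End.mul_apply,
      hr.separated i j hij, LinearMap.smul_apply, Module.End.mul_apply, sub_self]
  linked i j hij t := by
    have := LinearMap.congr_fun (hr.linked i j hij) (F t)
    simp only [Module.End.mul_apply, LinearMap.neg_apply] at this
    rw [LinearMap.mem_ker, map_add]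
    simp only [hF]
    rw [this, neg_add_cancel]
  right_mem i t ht := by
    rw [LinearMap.mem_ker] at ht ⊢
    rw [hF, ht, map_zero]

theorem relationIdeal_le {U : Submodule k V.tensorAlg} (hU : D.ContainsRelations U) :
    D.relationIdeal ≤ U := sInf_le hU

end DiagonalBasis

end DiagonalBasis

end TwistedYD

namespace TwistedYD

/-! ### The ideal of relations is a weak Hopf ideal of finite codimension. -/

namespace DiagonalBasis

variable {k : Type u} [Field k] {G : Type v} [CommGroup G] [Fintype G] [DecidableEq G]
  {Φ : ThreeCocycle k G} {V : TwistedYD Φ} {S : Subgroup G} {q : Fin 4 → Fin 4 → k}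
  (D : V.DiagonalBasis S q) (hΦ : Φ.IsTrivialOn S) (hV : V.IsSupportedOn S)
include hΦ hV

theorem proj_mem_relationIdeal (g : G) : ∀ x ∈ D.relationIdeal,
    V.tensorAlg.proj g x ∈ D.relationIdeal := by
  have hI := D.containsRelations_relationIdeal
  have hR : ∀ g i t, V.tensorAlg.proj g (D.right i t) =
      D.right i (V.tensorAlg.proj (g * (D.deg i)⁻¹) t) := fun g i t =>
    proj_rightMul hΦ hV g (D.proj_basis i) t
  -- Right multiplication shifts degrees, so only the condition for all `g` together is stable under
  -- it.
  have key : D.ContainsRelations (⨅ g, D.relationIdeal.comap (V.tensorAlg.proj g)) := by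
    refine ⟨fun i t => ?_, fun i j hij t => ?_, fun i j hij t => ?_, fun i t ht => ?_⟩ <;>
      simp only [Submodule.mem_iInf, Submodule.mem_comap, map_sub, map_add, map_smul, hR] at * <;>
      intro g
    · exact hI.sq i _
    · rw [mul_right_comm g (D.deg j)⁻¹]
      exact hI.separated i j hij _
    · have : g * (D.deg j)⁻¹ * (D.deg i)⁻¹ * (D.deg j)⁻¹ * (D.deg i)⁻¹ =
        g * (D.deg i)⁻¹ * (D.deg j)⁻¹ * (D.deg i)⁻¹ * (D.deg j)⁻¹ := by ac_rfl
      rw [this]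
      exact hI.linked i j hij _
    · exact hI.right_mem i _ (ht _)
  intro x hx
  exact Submodule.mem_iInf _ |>.1 (D.relationIdeal_le key hx) g

theorem incl_component_mem_relationIdeal (n : ℕ) : ∀ x ∈ D.relationIdeal,
    V.incl n (V.component n x) ∈ D.relationIdeal := by
  have hI := D.containsRelations_relationIdeal
  have h0 : ∀ i t, V.incl 0 (V.component 0 (D.right i t)) = 0 := fun i t => by
    rw [right, component_zero_rightMul hΦ hV, map_zero]
  have hS : ∀ n i t, V.incl (n + 1) (V.component (n + 1) (D.right i t)) =
      D.right i (V.incl n (V.component n t)) := fun n i t =>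
    incl_component_succ_rightMul hΦ hV n _ t
  have key : D.ContainsRelations (⨅ n, D.relationIdeal.comap (V.incl n ∘ₗ V.component n)) := by
    refine ⟨fun i t => ?_, fun i j hij t => ?_, fun i j hij t => ?_, fun i t ht => ?_⟩ <;>
      simp only [Submodule.mem_iInf, Submodule.mem_comap, map_sub, map_add, map_smul,
        LinearMap.comp_apply] at * <;>
      intro n
    -- The quadratic relations have no components in degrees 0 and 1; the quartic ones below have
    -- none in degrees 0 to 3.
    · rcases n with _ | _ | n <;> simp only [h0, hS, map_zero, Submodule.zero_mem]
      exact hI.sq i _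
    · rcases n with _ | _ | n <;>
        simp only [h0, hS, map_zero, smul_zero, sub_zero, Submodule.zero_mem]
      exact hI.separated i j hij _
    · rcases n with _ | _ | _ | _ | n <;>
        simp only [h0, hS, map_zero, add_zero, Submodule.zero_mem]
      exact hI.linked i j hij _
    · rcases n with _ | n <;> simp only [h0, hS, Submodule.zero_mem]
      exact hI.right_mem i _ (ht _)
  intro x hx
  exact Submodule.mem_iInf _ |>.1 (D.relationIdeal_le key hx) n

theorem component_eq_zero_of_mem_relationIdeal : ∀ x ∈ D.relationIdeal,
    V.component 0 x = 0 ∧ V.component 1 x = 0 := by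
  have h0 : ∀ i t, V.component 0 (D.right i t) = 0 := fun i t => component_zero_rightMul hΦ hV _ t
  have h1 : ∀ i t, V.component 0 t = 0 → V.component 1 (D.right i t) = 0 := fun i t ht => by
    apply V.incl_injective 1
    refine (incl_component_succ_rightMul hΦ hV 0 (D.basis i) t).trans ?_
    rw [ht, map_zero, map_zero, map_zero]
  -- The kernel of the first component alone is not stable under right multiplication: its image
  -- involves the component of degree 0.
  have key : D.ContainsRelations (LinearMap.ker (V.component 0) ⊓ LinearMap.ker (V.component 1)) := by
    refine ⟨fun i t => ?_, fun i j hij t => ?_, fun i j hij t => ?_, fun i t ht => ?_⟩ <;>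
      simp only [Submodule.mem_inf, LinearMap.mem_ker, map_sub, map_add, map_smul] at *
    · simp [h0, h1]
    · simp [h0, h1]
    · simp [h0, h1]
    · exact ⟨h0 _ _, h1 _ _ ht.1⟩
  exact fun x hx => D.relationIdeal_le key hx

theorem mul_left_mem_relationIdeal (y : V.tensorAlg) : ∀ x ∈ D.relationIdeal,
    V.mul y x ∈ D.relationIdeal := by
  have hI := D.containsRelations_relationIdeal
  have hR : ∀ i t, V.mul y (D.right i t) = D.right i (V.mul y t) := fun i t =>
    mul_rightMul hΦ hV _ y t
  have key : D.ContainsRelations (D.relationIdeal.comap (V.mul y)) := by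
    refine ⟨fun i t => ?_, fun i j hij t => ?_, fun i j hij t => ?_, fun i t ht => ?_⟩ <;>
      simp only [Submodule.mem_comap, map_sub, map_add, map_smul, hR] at *
    · exact hI.sq i _
    · exact hI.separated i j hij _
    · exact hI.linked i j hij _
    · exact hI.right_mem i _ ht
  exact fun x hx => D.relationIdeal_le key hx

theorem mul_right_mem_relationIdeal (y : V.tensorAlg) : ∀ x ∈ D.relationIdeal,
    V.mul x y ∈ D.relationIdeal := by
  intro x hx
  have : D.relationIdeal.comap (V.mul x) = ⊤ := by
    refine eq_top_of_one_mem hΦ hV ?_ fun v t ht => ?_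
    · rwa [Submodule.mem_comap, mul_one_right]
    · rw [Submodule.mem_comap] at ht ⊢
      rw [mul_rightMul hΦ hV]
      exact D.rightMul_mem D.containsRelations_relationIdeal.right_mem v ht
  have hy : y ∈ D.relationIdeal.comap (V.mul x) := this ▸ Submodule.mem_top
  exact hy

/-- Right multiplication by a basis element on the quotient by the relations. -/
def rightBar (i : Fin 4) : Module.End k (V.tensorAlg ⧸ D.relationIdeal) :=
  D.relationIdeal.mapQ D.relationIdeal (D.right i) (D.containsRelations_relationIdeal.right_mem i)

/-- Left multiplication by a basis element on the quotient by the relations. -/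
def leftBar (i : Fin 4) : Module.End k (V.tensorAlg ⧸ D.relationIdeal) :=
  D.relationIdeal.mapQ D.relationIdeal (D.left i) (D.mul_left_mem_relationIdeal hΦ hV _)

theorem diag_mem_relationIdeal (i : Fin 4) : ∀ x ∈ D.relationIdeal,
    D.diag i x ∈ D.relationIdeal := by
  intro x hx
  rw [diag, LinearMap.sum_apply]
  exact Submodule.sum_mem _ fun g _ =>
    Submodule.smul_mem _ _ (D.proj_mem_relationIdeal hΦ hV g x hx)

/-- The diagonal operators on the quotient by the relations. -/
def diagBar (i : Fin 4) : Module.End k (V.tensorAlg ⧸ D.relationIdeal) :=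
  D.relationIdeal.mapQ D.relationIdeal (D.diag i) (D.diag_mem_relationIdeal hΦ hV i)

omit hΦ hV in
theorem mk_mem_eq_zero {x : V.tensorAlg} (hx : x ∈ D.relationIdeal) :
    D.relationIdeal.mkQ x = 0 := (Submodule.Quotient.mk_eq_zero _).2 hx

omit hΦ hV in
theorem end_ext_mkQ {f g : Module.End k (V.tensorAlg ⧸ D.relationIdeal)}
    (h : ∀ x, f (D.relationIdeal.mkQ x) = g (D.relationIdeal.mkQ x)) : f = g :=
  Submodule.linearMap_qext _ (LinearMap.ext h)

omit hΦ hV in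
theorem satisfiesRelations_rightBar : SatisfiesRelations q D.rightBar := by
  have hI := D.containsRelations_relationIdeal
  refine ⟨fun i => D.end_ext_mkQ fun x => ?_, fun i j hij => D.end_ext_mkQ fun x => ?_,
    fun i j hij => D.end_ext_mkQ fun x => ?_⟩
  · exact D.mk_mem_eq_zero (hI.sq i x)
  · have := D.mk_mem_eq_zero (hI.separated i j hij x)
    rw [map_sub, sub_eq_zero, map_smul] at this
    exact this
  · have := D.mk_mem_eq_zero (hI.linked i j hij x)
    rw [map_add, add_eq_zero_iff_eq_neg] at this
    exact this

theorem diagBar_mul_diagBar (i j : Fin 4) :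
    D.diagBar hΦ hV i * D.diagBar hΦ hV j = D.diagBar hΦ hV j * D.diagBar hΦ hV i :=
  D.end_ext_mkQ fun x => congrArg D.relationIdeal.mkQ (LinearMap.congr_fun (D.diag_mul_diag i j) x)

theorem diagBar_mul_rightBar (i j : Fin 4) :
    D.diagBar hΦ hV i * D.rightBar j = q j i • (D.rightBar j * D.diagBar hΦ hV i) :=
  D.end_ext_mkQ fun x =>
    (congrArg D.relationIdeal.mkQ (LinearMap.congr_fun (D.diag_mul_right hΦ hV i j) x)).trans
      (map_smul D.relationIdeal.mkQ _ _)

theorem diagBar_mul_leftBar (i j : Fin 4) :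
    D.diagBar hΦ hV i * D.leftBar hΦ hV j = q j i • (D.leftBar hΦ hV j * D.diagBar hΦ hV i) :=
  D.end_ext_mkQ fun x =>
    (congrArg D.relationIdeal.mkQ (LinearMap.congr_fun (D.diag_mul_left hΦ hV i j) x)).trans
      (map_smul D.relationIdeal.mkQ _ _)

theorem left_mul (i : Fin 4) (s t : V.tensorAlg) :
    D.left i (V.mul s t) = V.mul (D.left i s) t := (mul_assoc_tensorAlg hΦ hV _ s t).symm

theorem left_right (i j : Fin 4) (t : V.tensorAlg) :
    D.left i (D.right j t) = D.right j (D.left i t) := mul_rightMul hΦ hV _ _ t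

theorem left_one (i : Fin 4) : D.left i V.one = D.right i V.one :=
  (V.mul_one_right _).trans (rightMul_one hΦ hV _).symm

theorem comul_mem_relationIdeal (hq : IsTwoA2 q) : ∀ x ∈ D.relationIdeal,
    V.comul x ∈ LinearMap.range (D.relationIdeal.subtype.rTensor V.tensorAlg) ⊔
      LinearMap.range (D.relationIdeal.subtype.lTensor V.tensorAlg) := by
  -- Membership in `I ⊗ T + T ⊗ I` becomes vanishing in `T/I ⊗ T/I`, where the universal property of
  -- `I` applies.
  have hker : LinearMap.ker (TensorProduct.map D.relationIdeal.mkQ D.relationIdeal.mkQ) =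
      LinearMap.range (D.relationIdeal.subtype.lTensor V.tensorAlg) ⊔
        LinearMap.range (D.relationIdeal.subtype.rTensor V.tensorAlg) :=
    TensorProduct.map_ker (LinearMap.exact_subtype_mkQ D.relationIdeal) D.relationIdeal.mkQ_surjective
      (LinearMap.exact_subtype_mkQ D.relationIdeal) D.relationIdeal.mkQ_surjective
  rw [sup_comm, ← hker]
  have hr := D.satisfiesRelations_rightBar.tensor hq (D.diagBar_mul_diagBar hΦ hV)
    (D.diagBar_mul_rightBar hΦ hV)
  refine D.relationIdeal_le (D.containsRelations_ker hr
    (TensorProduct.map D.relationIdeal.mkQ D.relationIdeal.mkQ ∘ₗ V.comul) fun i t => ?_)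
  rw [LinearMap.comp_apply, LinearMap.comp_apply, D.comul_right hΦ hV]
  generalize V.comul t = s
  induction s using TensorProduct.induction_on with
  | zero => simp only [map_zero]
  | add s t hs ht => simp only [map_add] at hs ht ⊢; rw [hs, ht]
  | tmul x y =>
    simp only [LinearMap.add_apply, TensorProduct.map_tmul, map_add]
    rfl

theorem antipode_mem_relationIdeal (hq : IsTwoA2 q) : ∀ x ∈ D.relationIdeal,
    V.antipode x ∈ D.relationIdeal := by
  have hI := D.containsRelations_relationIdeal
  have hl : ∀ x, x ∈ D.relationIdeal → ∀ t, D.relationIdeal.mkQ (V.mul x t) = 0 := fun x hx t =>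
    D.mk_mem_eq_zero (D.mul_right_mem_relationIdeal hΦ hV t x hx)
  have hone : ∀ i t, D.left i t = V.mul (D.right i V.one) t := fun i t => by
    rw [← D.left_one hΦ hV, ← D.left_mul hΦ hV, one_mul_left hΦ hV]
  -- Associativity turns left multiplication by two letters into left multiplication by one word,
  -- written with right multiplications applied to the unit; so relations between words yield
  -- relations between left multiplications.
  have h2 : ∀ i j t, D.left i (D.left j t) = V.mul (D.right j (D.right i V.one)) t :=
    fun i j t => by
      rw [hone j, D.left_mul hΦ hV, D.left_right hΦ hV, D.left_one hΦ hV]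
  have hr := SatisfiesRelations.neg_mul_diagonal (l := D.leftBar hΦ hV) (κ := D.diagBar hΦ hV) hq
    (fun i => D.end_ext_mkQ fun x => ?_) (fun i j hij => D.end_ext_mkQ fun x => ?_)
    (fun i j hij => D.end_ext_mkQ fun x => ?_) (D.diagBar_mul_diagBar hΦ hV)
    (D.diagBar_mul_leftBar hΦ hV)
  · have hF := D.relationIdeal_le (D.containsRelations_ker hr
      (D.relationIdeal.mkQ ∘ₗ V.antipode) fun i t => ?_)
    · exact fun x hx => (Submodule.Quotient.mk_eq_zero _).1 (hF hx)
    · rw [LinearMap.comp_apply, D.antipode_right hΦ hV]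
      exact map_neg _ _
  · change D.relationIdeal.mkQ (D.left i (D.left i x)) = 0
    rw [h2]
    exact hl _ (hI.sq i _) x
  · change D.relationIdeal.mkQ (D.left i (D.left j x)) =
      q i j • D.relationIdeal.mkQ (D.left j (D.left i x))
    have := hl _ (hI.separated i j hij V.one) x
    rw [h2, h2, ← map_smul, ← sub_eq_zero, ← map_sub, ← this]
    simp
  · change D.relationIdeal.mkQ (D.left i (D.left j (D.left i (D.left j x)))) =
      -D.relationIdeal.mkQ (D.left j (D.left i (D.left j (D.left i x))))
    have := hl _ (hI.linked i j hij V.one) x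
    rw [eq_neg_iff_add_eq_zero, ← map_add, ← this]
    congr 1
    simp only [h2, D.left_mul hΦ hV, D.left_right hΦ hV, D.left_one hΦ hV, map_add,
      LinearMap.add_apply]

theorem isWeakHopfIdeal_relationIdeal (hq : IsTwoA2 q) : V.IsWeakHopfIdeal D.relationIdeal where
  proj_mem := D.proj_mem_relationIdeal hΦ hV
  graded x hx n := D.incl_component_mem_relationIdeal hΦ hV n x hx
  component_zero x hx := (D.component_eq_zero_of_mem_relationIdeal hΦ hV x hx).1
  component_one x hx := (D.component_eq_zero_of_mem_relationIdeal hΦ hV x hx).2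
  mul_left_mem := D.mul_left_mem_relationIdeal hΦ hV
  mul_right_mem := D.mul_right_mem_relationIdeal hΦ hV
  comul_mem := D.comul_mem_relationIdeal hΦ hV hq
  antipode_mem := D.antipode_mem_relationIdeal hΦ hV hq

theorem finiteDimensional_quotient (hq : IsTwoA2 q) :
    FiniteDimensional k (V.tensorAlg ⧸ D.relationIdeal) := by
  have hr := D.satisfiesRelations_rightBar
  obtain ⟨M, hM, h1, hmul⟩ := exists_fg_submodule_of_two_pairs (k := k) D.rightBar hr.sq
    (hr.linked 0 1 (Or.inl ⟨rfl, rfl⟩)) (hr.linked 2 3 (Or.inr ⟨rfl, rfl⟩)) (by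
      intro i hi j hj
      have hij : IsSeparated i j := ⟨by simpa using hi, by simpa using hj⟩
      refine ⟨q j i, ?_⟩
      rw [hr.separated i j hij, smul_smul, mul_comm, hq.separated i j hij, one_smul])
  -- Evaluating a finite-dimensional space of operators at the class of 1 gives a subspace that
  -- contains 1 and is stable under right multiplication, hence the whole quotient.
  let ev : Module.End k (V.tensorAlg ⧸ D.relationIdeal) →ₗ[k] V.tensorAlg ⧸ D.relationIdeal :=
    LinearMap.applyₗ (D.relationIdeal.mkQ V.one)
  have htop : (M.map ev).comap D.relationIdeal.mkQ = ⊤ := by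
    refine eq_top_of_one_mem hΦ hV ⟨1, h1, rfl⟩ fun v t ht => D.rightMul_mem ?_ v ht
    rintro i t ⟨m, hm, h⟩
    exact ⟨D.rightBar i * m, hmul i m hm, congrArg (D.rightBar i) h⟩
  have htop' : M.map ev = ⊤ := by
    rw [eq_top_iff]
    intro x _
    obtain ⟨x, rfl⟩ := D.relationIdeal.mkQ_surjective x
    have : x ∈ (M.map ev).comap D.relationIdeal.mkQ := htop ▸ Submodule.mem_top
    exact this
  exact ⟨htop' ▸ hM.map ev⟩

include D in
-- The ideal of relations lies in the Nichols ideal; that they are equal is not needed.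
theorem finiteDimensional_nichols (hq : IsTwoA2 q) : FiniteDimensional k V.nichols := by
  have := D.finiteDimensional_quotient hΦ hV hq
  have hle := (D.isWeakHopfIdeal_relationIdeal hΦ hV hq).le_nicholsIdeal hΦ hV
  exact Module.Finite.of_surjective (Submodule.factor hle) (Submodule.factor_surjective hle)

end DiagonalBasis

end TwistedYD

namespace TwistedYD

/-! ### The module over the trivial cocycle. -/

section Untwist

variable {k : Type u} [Field k] {G : Type v} [CommGroup G] [Fintype G] [DecidableEq G]
  {Φ : ThreeCocycle k G}

omit [Fintype G] [DecidableEq G] in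
theorem _root_.TwistedNichols.ThreeCocycle.IsTrivialOn.slant {S : Subgroup G}
    (hΦ : Φ.IsTrivialOn S) {x y z : G} (hx : x ∈ S) (hy : y ∈ S) (hz : z ∈ S) :
    Φ.slant x y z = 1 := by
  simp only [ThreeCocycle.slant, hΦ _ hx _ hy _ hz, hΦ _ hy _ hz _ hx, hΦ _ hy _ hx _ hz]
  simp

/-- A Yetter-Drinfeld module supported on a subgroup on which the cocycle is trivial, regarded as
a Yetter-Drinfeld module over the trivial cocycle by restricting the action along an endomorphism
with values in the subgroup. -/
def untwist (V : TwistedYD Φ) {S : Subgroup G} (hΦ : Φ.IsTrivialOn S) (hV : V.IsSupportedOn S)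
    (π : G →* G) (hπ : ∀ g, π g ∈ S) : TwistedYD (ThreeCocycle.trivial k G) where
  carrier := V
  proj := V.proj
  act g := V.act (π g)
  proj_proj := V.proj_proj
  sum_proj := V.sum_proj
  act_proj e := V.act_proj (π e)
  act_one x := by rw [map_one, V.act_one]
  act_act e f g x := by
    have h1 : (ThreeCocycle.trivial k G).slant g e f = 1 := by
      simp [ThreeCocycle.slant, ThreeCocycle.trivial]
    rw [V.act_act, map_mul, h1]
    by_cases hg : g ∈ S
    · rw [hΦ.slant hg (hπ e) (hπ f)]
    · simp [hV g hg]

/-- The identity map works: `π` fixes `S`, so the two actions differ only by elements outside `S`.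
-/
theorem isTwistEquivalent_untwist (V : TwistedYD Φ) {S : Subgroup G} (hΦ : Φ.IsTrivialOn S)
    (hV : V.IsSupportedOn S) (π : G →* G) (hπ : ∀ g, π g ∈ S) (hπ' : ∀ g ∈ S, π g = g) :
    IsTwistEquivalent V (V.untwist hΦ hV π hπ) := by
  let f : V ≃ₗ[k] V.untwist hΦ hV π hπ := LinearEquiv.refl k V
  refine isTwistEquivalent_of_equiv f hΦ (fun _ _ _ _ _ _ => rfl) hV hV (fun _ _ => rfl)
    fun g hg v => ?_
  change V.act g v = V.act (π g) v
  rw [hπ' g hg]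

namespace DiagonalBasis

variable {V : TwistedYD Φ} {S : Subgroup G} {q : Fin 4 → Fin 4 → k} (D : V.DiagonalBasis S q)
include D

theorem isSupportedOn : V.IsSupportedOn S := by
  intro g hg
  refine D.basis.ext fun i => ?_
  have : g ≠ D.deg i := fun h => hg (h ▸ D.deg_mem i)
  rw [← D.proj_basis, V.proj_proj, if_neg this, LinearMap.zero_apply]

theorem isDiagonal_untwist (hΦ : Φ.IsTrivialOn S) (π : G →* G) (hπ : ∀ g, π g ∈ S)
    (hπ' : ∀ g ∈ S, π g = g) : IsDiagonal (V.untwist hΦ D.isSupportedOn π hπ) q := by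
  refine ⟨D.basis, D.deg, fun i => ⟨D.basis i, D.proj_basis i⟩,
    fun g i => D.exists_act (π g) (hπ g) i, fun i j => ?_⟩
  change V.act (π (D.deg i)) (D.basis j) = _
  rw [hπ' _ (D.deg_mem i)]
  exact D.act_basis i j

end DiagonalBasis

end Untwist

/-! ### Structure constants of a sum of two modules. -/

section Pairs

variable {k : Type u} [Field k] {G : Type v} [CommGroup G] [Fintype G] [DecidableEq G]
  {Φ : ThreeCocycle k G}

/-- The structure constants of the sums of two of the modules, in a suitable basis. -/
def pairConstants (k : Type u) [Field k] : Fin 4 → Fin 4 → k :=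
  !![-1, -1, 1, -1; 1, -1, -1, -1; 1, -1, -1, -1; -1, -1, 1, -1]

theorem isTwoA2_pairConstants : IsTwoA2 (pairConstants k) where
  diag i := by fin_cases i <;> rfl
  linked := by
    rintro i j (⟨rfl, rfl⟩ | ⟨rfl, rfl⟩) <;> exact ⟨rfl, rfl⟩
  separated := by
    rintro i j ⟨rfl | rfl, rfl | rfl⟩ <;> simp [pairConstants]

theorem genDynkinDiagram_pairConstants [CharZero k] :
    genDynkinDiagram (pairConstants k) = twoCopiesA2 k := by
  -- In characteristic 2 the label `-1` would be 1 and the edges would disappear.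
  have h : (-1 : k) ≠ 1 := by norm_num
  ext1
  · funext i
    exact isTwoA2_pairConstants.diag i
  · funext i j
    fin_cases i <;> fin_cases j <;> simp [genDynkinDiagram, twoCopiesA2, pairConstants, h]

/-- The ordering of the union of two bases with two elements. -/
def pairEquiv : Fin 2 ⊕ Fin 2 ≃ Fin 4 where
  -- The order is `a 0, b 1, b 0, a 1`. The cross eigenvalue of index 0 is 1 and that of index 1 is
  -- `-1`, so `a r` and `b s` are linked exactly when `r ≠ s`.
  toFun := Sum.elim ![0, 3] ![2, 1]
  invFun := ![Sum.inl 0, Sum.inr 1, Sum.inr 0, Sum.inl 1]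
  left_inv := by decide
  right_inv := by decide

/-- The basis of a product obtained from two bases with two elements. -/
def pairBasis {M N : Type u} [AddCommGroup M] [Module k M] [AddCommGroup N] [Module k N]
    (a : Module.Basis (Fin 2) k M) (b : Module.Basis (Fin 2) k N) :
    Module.Basis (Fin 4) k (M × N) := (a.prod b).reindex pairEquiv

theorem pairBasis_apply {M N : Type u} [AddCommGroup M] [Module k M] [AddCommGroup N] [Module k N]
    (a : Module.Basis (Fin 2) k M) (b : Module.Basis (Fin 2) k N) (i : Fin 4) :
    pairBasis a b i = ![(a 0, 0), (0, b 1), (0, b 0), (a 1, 0)] i := by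
  fin_cases i <;> simp [pairBasis, pairEquiv]

/-- The diagonal basis of a direct sum, of degrees `d` and `e`, if `d` and `e` act by `-1` on the
components of their degree and with eigenvalues `1`, `-1` on the other component. -/
def diagonalBasisProd {V W : TwistedYD Φ} {S : Subgroup G} (hΦ : Φ.IsTrivialOn S) {d e : G}
    (hd : d ∈ S) (he : e ∈ S) (hS : ∀ g ∈ S, g = 1 ∨ g = d ∨ g = e ∨ g = d * e)
    (a : Module.Basis (Fin 2) k V) (b : Module.Basis (Fin 2) k W)
    (ha : ∀ i, V.proj d (a i) = a i) (hb : ∀ i, W.proj e (b i) = b i)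
    (hda : ∀ i, V.act d (a i) = (-1 : k) • a i) (heb : ∀ i, W.act e (b i) = (-1 : k) • b i)
    (hea : ∀ i, V.act e (a i) = (![1, -1] i : k) • a i)
    (hdb : ∀ i, W.act d (b i) = (![1, -1] i : k) • b i) :
    (V.prod W).DiagonalBasis S (pairConstants k) where
  basis := pairBasis a b
  deg := ![d, e, e, d]
  deg_mem i := by fin_cases i <;> assumption
  proj_basis := by
    have : ∀ i, (V.proj (![d, e, e, d] i)).prodMap (W.proj (![d, e, e, d] i)) (pairBasis a b i) =
        pairBasis a b i := by
      intro i
      rw [pairBasis_apply]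
      fin_cases i <;> simp [ha, hb]
    exact this
  exists_act g hg := by
    have key : ∀ (U : TwistedYD Φ) (u : U) (g : G), g ∈ S → U.proj g u = u →
        (∃ c : k, U.act d u = c • u) → (∃ c : k, U.act e u = c • u) →
        ∀ g ∈ S, ∃ c : k, U.act g u = c • u := by
      rintro U u g' hg' hu ⟨c, hc⟩ ⟨c', hc'⟩ g hg
      rcases hS g hg with rfl | rfl | rfl | rfl
      · exact ⟨1, by rw [U.act_one, one_smul]⟩
      · exact ⟨c, hc⟩
      · exact ⟨c', hc'⟩
      · have := U.act_act_of_proj_eq d e hu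
        rw [hΦ.slant hg' hd he, Units.val_one, one_smul, hc', map_smul, hc, smul_smul] at this
        exact ⟨_, this.symm⟩
    have hV : ∀ j, ∃ c : k, V.act g (a j) = c • a j := fun j =>
      key V (a j) d hd (ha j) ⟨_, hda j⟩ ⟨_, hea j⟩ g hg
    have hW : ∀ j, ∃ c : k, W.act g (b j) = c • b j := fun j =>
      key W (b j) e he (hb j) ⟨_, hdb j⟩ ⟨_, heb j⟩ g hg
    choose c hc using hV
    choose c' hc' using hW
    have : ∀ i, ∃ x : k, (V.act g).prodMap (W.act g) (pairBasis a b i) = x • pairBasis a b i := by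
      intro i
      refine ⟨![c 0, c' 1, c' 0, c 1] i, ?_⟩
      rw [pairBasis_apply]
      fin_cases i <;> simp [hc, hc']
    exact this
  act_basis := by
    have : ∀ i j, (V.act (![d, e, e, d] i)).prodMap (W.act (![d, e, e, d] i)) (pairBasis a b j) =
        pairConstants k i j • pairBasis a b j := by
      intro i j
      rw [pairBasis_apply]
      fin_cases i <;> fin_cases j <;> simp [pairConstants, hda, hdb, hea, heb]
    exact this

end Pairs

end TwistedYD

/-! ### The subgroups generated by two of the three generators. -/

section Example

variable {k : Type u} [Field k]

/-- The endomorphism of `ℤ₂ × ℤ₂ × ℤ₂` that kills the generator with index `c`. -/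
def killGen (c : Fin 3) : Z23 →* Z23 where
  toFun x := Multiplicative.ofAdd fun i => if i = c then 0 else Multiplicative.toAdd x i
  map_one' := by
    apply Multiplicative.toAdd.injective
    funext i
    simp
  map_mul' x y := by
    apply Multiplicative.toAdd.injective
    funext i
    by_cases h : i = c <;> simp [h]

theorem killGen_killGen (c : Fin 3) (x : Z23) : killGen c (killGen c x) = killGen c x := by
  apply Multiplicative.toAdd.injective
  funext i
  by_cases h : i = c <;> simp [killGen, h]

theorem expo_killGen_self (c : Fin 3) (x : Z23) : expo (killGen c x) c = 0 := by
  simp [expo, killGen]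

/-- The exponent of Φ contains one coordinate of each kind, and the factor with index `c` is zero.
-/
theorem Phi_isTrivialOn_range (c : Fin 3) : (Phi k).IsTrivialOn (killGen c).range := by
  rintro _ ⟨x, rfl⟩ _ ⟨y, rfl⟩ _ ⟨z, rfl⟩
  have h : expo (killGen c x) 2 * expo (killGen c y) 1 * expo (killGen c z) 0 = 0 := by
    fin_cases c
    · have := expo_killGen_self 0 z
      simp_all
    · have := expo_killGen_self 1 y
      simp_all
    · have := expo_killGen_self 2 x
      simp_all
  simp [Phi, h]

theorem killGen_eq (c i j : Fin 3) (hi : i ≠ c) (hj : j ≠ c) (hij : i ≠ j) (x : Z23) :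
    killGen c x = 1 ∨ killGen c x = gen i ∨ killGen c x = gen j ∨ killGen c x = gen i * gen j := by
  revert c i j x
  decide

theorem gen_mem_range {c i : Fin 3} (h : i ≠ c) : gen i ∈ (killGen c).range := by
  refine ⟨gen i, ?_⟩
  revert c i
  decide

/-- The common form of the three cases: `c` is the index of the absent generator, and the base group
of the usual module is again `Z23`, acting through `killGen c`. -/
theorem finiteDimensional_and_isTwistOfDiagonal [CharZero k] {c i j : Fin 3} (hi : i ≠ c)
    (hj : j ≠ c) (hij : i ≠ j) {V W : TwistedYD (Phi k)}
    (a : Module.Basis (Fin 2) k V) (b : Module.Basis (Fin 2) k W)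
    (ha : ∀ r, V.proj (gen i) (a r) = a r) (hb : ∀ r, W.proj (gen j) (b r) = b r)
    (hda : ∀ r, V.act (gen i) (a r) = (-1 : k) • a r)
    (heb : ∀ r, W.act (gen j) (b r) = (-1 : k) • b r)
    (hea : ∀ r, V.act (gen j) (a r) = (![1, -1] r : k) • a r)
    (hdb : ∀ r, W.act (gen i) (b r) = (![1, -1] r : k) • b r) :
    FiniteDimensional k (V.prod W).nichols ∧ IsTwistOfDiagonal (V.prod W) (twoCopiesA2 k) := by
  have hΦ := Phi_isTrivialOn_range (k := k) c
  have hS : ∀ g ∈ (killGen c).range,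
      g = 1 ∨ g = gen i ∨ g = gen j ∨ g = gen i * gen j := by
    rintro _ ⟨x, rfl⟩
    exact killGen_eq c i j hi hj hij x
  let D := TwistedYD.diagonalBasisProd hΦ (gen_mem_range hi) (gen_mem_range hj) hS a b ha hb hda
    heb hea hdb
  have hπ : ∀ g, killGen c g ∈ (killGen c).range := fun g => ⟨g, rfl⟩
  have hπ' : ∀ g ∈ (killGen c).range, killGen c g = g := by
    rintro _ ⟨x, rfl⟩
    exact killGen_killGen c x
  exact ⟨D.finiteDimensional_nichols hΦ D.isSupportedOn TwistedYD.isTwoA2_pairConstants,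
    Z23, inferInstance, inferInstance, inferInstance, (V.prod W).untwist hΦ D.isSupportedOn _ hπ,
    TwistedYD.pairConstants k, D.isDiagonal_untwist hΦ _ hπ hπ',
    TwistedYD.genDynkinDiagram_pairConstants,
    (V.prod W).isTwistEquivalent_untwist hΦ D.isSupportedOn _ hπ hπ'⟩

end Example

/-! ### Simplicity and eigenbases of the three modules. -/

section Modules

variable {k : Type u} [Field k]

/-- The plane `k²` is irreducible under the reflection `(x, y) ↦ (x, -y)` and the swap. -/
theorem eq_bot_or_eq_top_of_reflection_of_swap [CharZero k] (U : Submodule k (Fin 2 → k))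
    (hd : ∀ x ∈ U, Matrix.toLin' !![1, 0; 0, -1] x ∈ U)
    (hs : ∀ x ∈ U, Matrix.toLin' !![0, 1; 1, 0] x ∈ U) : U = ⊥ ∨ U = ⊤ := by
  rw [or_iff_not_imp_left]
  intro hU
  obtain ⟨x, hx, hx0⟩ := U.ne_bot_iff.1 hU
  have key : ∀ x ∈ U, x 0 ≠ 0 → U = ⊤ := by
    intro x hx hx0
    have h0 : ![1, 0] ∈ U := by
      -- Averaging with the reflection projects onto the first coordinate; this divides by 2.
      have : ![1, 0] = (2 * x 0)⁻¹ • (x + Matrix.toLin' !![1, 0; 0, -1] x) := by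
        funext i
        fin_cases i
        · simp [Matrix.vecHead]
          field_simp
          norm_num
        · simp [Matrix.vecHead, Matrix.vecTail]
      rw [this]
      exact U.smul_mem _ (U.add_mem hx (hd x hx))
    have h1 : ![0, 1] ∈ U := by
      have : Matrix.toLin' !![0, 1; 1, 0] ![1, 0] = (![0, 1] : Fin 2 → k) := by
        funext i
        fin_cases i <;> simp [Matrix.vecHead]
      exact this ▸ hs _ h0
    rw [eq_top_iff]
    intro y _
    have : y = y 0 • ![1, 0] + y 1 • ![0, 1] := by
      funext i
      fin_cases i <;> simp
    rw [this]
    exact U.add_mem (U.smul_mem _ h0) (U.smul_mem _ h1)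
  by_cases h : x 0 = 0
  · refine key _ (hs x hx) fun h' => hx0 ?_
    have h1 : x 1 = 0 := by simpa [Matrix.vecHead, Matrix.vecTail] using h'
    funext i
    fin_cases i <;> assumption
  · exact key x hx h

theorem ofMatrices_isSimple [CharZero k] {d : Z23} {A B C : Matrix (Fin 2) (Fin 2) k}
    (h : ∀ x y : Z23, actMatrix A B C x * actMatrix A B C y =
      ((Phi k).slant d x y : k) • actMatrix A B C (x * y)) (x y : Z23)
    (hx : actMatrix A B C x = !![1, 0; 0, -1]) (hy : actMatrix A B C y = !![0, 1; 1, 0]) :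
    (ofMatrices d A B C h).IsSimple := by
  refine ⟨inferInstanceAs (Nontrivial (Fin 2 → k)), fun U hU => ?_⟩
  refine eq_bot_or_eq_top_of_reflection_of_swap U (fun v hv => ?_) fun v hv => ?_
  · rw [← hx]
    exact hU.act_mem x v hv
  · rw [← hy]
    exact hU.act_mem y v hv

theorem V1_isSimple [CharZero k] : (V1 k).IsSimple :=
  ofMatrices_isSimple _ (gen 1) (gen 2) (actMatrix_gen _ _ _).2.1 (actMatrix_gen _ _ _).2.2

theorem V2_isSimple [CharZero k] : (V2 k).IsSimple :=
  ofMatrices_isSimple _ (gen 0) (gen 2) (actMatrix_gen _ _ _).1 (actMatrix_gen _ _ _).2.2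

theorem V3_isSimple [CharZero k] : (V3 k).IsSimple :=
  ofMatrices_isSimple _ (gen 1) (gen 0) (actMatrix_gen _ _ _).2.1 (actMatrix_gen _ _ _).1

theorem Phi_not_isAbelian [CharZero k] : ¬ (Phi k).IsAbelian := by
  intro h
  have h1 : Module.finrank k (Fin 2 → k) = 1 := h (V1 k) V1_isSimple
  simp at h1

/-- The eigenvectors `(1, 1)` and `(1, -1)` of the swap. -/
def swapBasis (k : Type u) [Field k] [CharZero k] : Module.Basis (Fin 2) k (Fin 2 → k) :=
  (Pi.basisFun k (Fin 2)).map (LinearEquiv.ofLinearMap (Matrix.toLin' !![1, 1; 1, -1])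
    (Matrix.toLin' !![1 / 2, 1 / 2; 1 / 2, -1 / 2])
    (by rw [← Matrix.toLin'_mul, ← Matrix.toLin'_one]; congr 1; ext i j
        fin_cases i <;> fin_cases j <;> norm_num)
    (by rw [← Matrix.toLin'_mul, ← Matrix.toLin'_one]; congr 1; ext i j
        fin_cases i <;> fin_cases j <;> norm_num))

theorem swapBasis_apply [CharZero k] (i : Fin 2) : swapBasis k i = ![![1, 1], ![1, -1]] i := by
  funext j
  fin_cases i <;> fin_cases j <;> simp [swapBasis]

theorem toLin'_neg_one (v : Fin 2 → k) :
    Matrix.toLin' !![-1, 0; 0, -1] v = (-1 : k) • v := by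
  funext j
  fin_cases j <;> simp [Matrix.vecHead, Matrix.vecTail]

theorem toLin'_swap_swapBasis [CharZero k] (i : Fin 2) :
    Matrix.toLin' !![0, 1; 1, 0] (swapBasis k i) = (![1, -1] i : k) • swapBasis k i := by
  rw [swapBasis_apply]
  funext j
  fin_cases i <;> fin_cases j <;> simp

theorem toLin'_reflection_basisFun (i : Fin 2) :
    Matrix.toLin' !![1, 0; 0, -1] (Pi.basisFun k (Fin 2) i) =
      (![1, -1] i : k) • Pi.basisFun k (Fin 2) i := by
  funext j
  fin_cases i <;> fin_cases j <;> simp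

section Action

variable {d : Z23} {A B C : Matrix (Fin 2) (Fin 2) k}
  {h : ∀ x y : Z23, actMatrix A B C x * actMatrix A B C y =
    ((Phi k).slant d x y : k) • actMatrix A B C (x * y)} (v : Fin 2 → k)

theorem ofMatrices_proj : (ofMatrices d A B C h).proj d v = v :=
  LinearMap.congr_fun (if_pos rfl : (if d = d then (LinearMap.id : (Fin 2 → k) →ₗ[k] _) else 0) = _) v

theorem ofMatrices_act_gen_zero : (ofMatrices d A B C h).act (gen 0) v = Matrix.toLin' A v :=
  congrArg (Matrix.toLin' · v) (actMatrix_gen A B C).1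

theorem ofMatrices_act_gen_one : (ofMatrices d A B C h).act (gen 1) v = Matrix.toLin' B v :=
  congrArg (Matrix.toLin' · v) (actMatrix_gen A B C).2.1

theorem ofMatrices_act_gen_two : (ofMatrices d A B C h).act (gen 2) v = Matrix.toLin' C v :=
  congrArg (Matrix.toLin' · v) (actMatrix_gen A B C).2.2

end Action

variable (k) [CharZero k]

/-- The given bases already diagonalize `g₁` and `g₂`. -/
theorem V1_prod_V2 : FiniteDimensional k ((V1 k).prod (V2 k)).nichols ∧
    IsTwistOfDiagonal ((V1 k).prod (V2 k)) (twoCopiesA2 k) :=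
  finiteDimensional_and_isTwistOfDiagonal (c := 2) (i := 0) (j := 1) (by decide) (by decide)
    (by decide) (V := V1 k) (W := V2 k) (Pi.basisFun k (Fin 2)) (Pi.basisFun k (Fin 2))
    (fun _ => ofMatrices_proj _) (fun _ => ofMatrices_proj _)
    (fun _ => (ofMatrices_act_gen_zero _).trans (toLin'_neg_one _))
    (fun _ => (ofMatrices_act_gen_one _).trans (toLin'_neg_one _))
    (fun _ => (ofMatrices_act_gen_one _).trans (toLin'_reflection_basisFun _))
    (fun _ => (ofMatrices_act_gen_zero _).trans (toLin'_reflection_basisFun _))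

/-- Here `g₃` swaps the basis of `V₁` and `g₁` swaps that of `V₃`, so both bases are replaced by
eigenvectors of the swap. -/
theorem V1_prod_V3 : FiniteDimensional k ((V1 k).prod (V3 k)).nichols ∧
    IsTwistOfDiagonal ((V1 k).prod (V3 k)) (twoCopiesA2 k) :=
  finiteDimensional_and_isTwistOfDiagonal (c := 1) (i := 0) (j := 2) (by decide) (by decide)
    (by decide) (V := V1 k) (W := V3 k) (swapBasis k) (swapBasis k)
    (fun _ => ofMatrices_proj _) (fun _ => ofMatrices_proj _)
    (fun _ => (ofMatrices_act_gen_zero _).trans (toLin'_neg_one _))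
    (fun _ => (ofMatrices_act_gen_two _).trans (toLin'_neg_one _))
    (fun _ => (ofMatrices_act_gen_two _).trans (toLin'_swap_swapBasis _))
    (fun _ => (ofMatrices_act_gen_zero _).trans (toLin'_swap_swapBasis _))

/-- Only `V₂` needs the eigenvectors of the swap, for `g₃`; on `V₃` the generator `g₂` is diagonal
already. -/
theorem V2_prod_V3 : FiniteDimensional k ((V2 k).prod (V3 k)).nichols ∧
    IsTwistOfDiagonal ((V2 k).prod (V3 k)) (twoCopiesA2 k) :=
  finiteDimensional_and_isTwistOfDiagonal (c := 0) (i := 1) (j := 2) (by decide) (by decide)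
    (by decide) (V := V2 k) (W := V3 k) (swapBasis k) (Pi.basisFun k (Fin 2))
    (fun _ => ofMatrices_proj _) (fun _ => ofMatrices_proj _)
    (fun _ => (ofMatrices_act_gen_one _).trans (toLin'_neg_one _))
    (fun _ => (ofMatrices_act_gen_two _).trans (toLin'_neg_one _))
    (fun _ => (ofMatrices_act_gen_two _).trans (toLin'_swap_swapBasis _))
    (fun _ => (ofMatrices_act_gen_one _).trans (toLin'_reflection_basisFun _))

end Modules

end TwistedNichols

end

theorem mainTheorem9 (k : Type u) [Field k] [IsAlgClosed k] [CharZero k] :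
    ¬ (TwistedNichols.Phi k).IsAbelian ∧
    ((TwistedNichols.V1 k).IsSimple ∧ (TwistedNichols.V2 k).IsSimple ∧
      (TwistedNichols.V3 k).IsSimple) ∧
    (FiniteDimensional k ((TwistedNichols.V1 k).prod (TwistedNichols.V2 k)).nichols ∧
      FiniteDimensional k ((TwistedNichols.V1 k).prod (TwistedNichols.V3 k)).nichols ∧
      FiniteDimensional k ((TwistedNichols.V2 k).prod (TwistedNichols.V3 k)).nichols) ∧
    (TwistedNichols.IsTwistOfDiagonal ((TwistedNichols.V1 k).prod (TwistedNichols.V2 k))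
        (TwistedNichols.twoCopiesA2 k) ∧
      TwistedNichols.IsTwistOfDiagonal ((TwistedNichols.V1 k).prod (TwistedNichols.V3 k))
        (TwistedNichols.twoCopiesA2 k) ∧
      TwistedNichols.IsTwistOfDiagonal ((TwistedNichols.V2 k).prod (TwistedNichols.V3 k))
        (TwistedNichols.twoCopiesA2 k)) := by
  exact ⟨TwistedNichols.Phi_not_isAbelian,
    ⟨TwistedNichols.V1_isSimple, TwistedNichols.V2_isSimple, TwistedNichols.V3_isSimple⟩,
    ⟨(TwistedNichols.V1_prod_V2 k).1, (TwistedNichols.V1_prod_V3 k).1,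
      (TwistedNichols.V2_prod_V3 k).1⟩,
    (TwistedNichols.V1_prod_V2 k).2, (TwistedNichols.V1_prod_V3 k).2,
    (TwistedNichols.V2_prod_V3 k).2⟩
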